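/- **Setting.** A *document event stream* is a well-nested sequence of start-tag, end-tag and text events with a single root element and no two consecutive text events. A *lexical datatype system* consists of a finite set $T$ of datatypes with pairwise distinct regular lexical spaces $\phi(\tau)$ over Unicode, one of them, $\top$, accepting all strings, and of a map from $T$ to a partially ordered set of kinds. For a text $t$, $\mathrm{minReq}(t)$ is the set of those datatypes accepting $t$ that have an inclusion-minimal lexical space, after removal of each one whose kind is greater than that of another one; $\mathrm{dtyped}(w)$ replaces each text $t$ of $w$ by $\mathrm{minReq}(t)$. A *dXVPA* is a modular visibly pushdown automaton with one start module, one entry state per module, the single-exit property and the mixed-content restrictions (all datatype transitions from a state have the same target; no such transition enters a state that is the target of a return into the same module). It accepts datatyped event streams. For a dXVPA $D$ let $L(D)$ be the set of event streams $w$ whose texts lie in the lexical spaces of the datatypes of some accepted datatyped stream, and let $L_{\rm dt}(D)$ be the set of event streams $w$ such that every datatyped stream obtained by choosing one datatype from each label of $\mathrm{dtyped}(w)$ is subsumed, datatype by datatype (inclusion of lexical spaces), by a stream accepted by $D$. *State naming.* Fix $k\ge 1$ and $l\ge1$ ($l=0$ is also allowed for the ancestor-sibling scheme). States are pairs $(u,v)$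 of a typing context and a left-sibling string; the start state is $(\epsilon,\epsilon)$, and $\sigma_i$ denotes the suffix of length $i$. A text moves $(u,v)$ to $(u,\sigma_k(v\$))$; an end tag of $a$ that pops the state $(u',v')$ moves to $(u',\sigma_k(v'a))$; a start tag $a$ pushes $(u,v)$ and moves to $(\sigma_l(ua),\epsilon)$ in the ancestor scheme, and, for $u=r_1\#\cdots\# r_n$, to $(r_{n-l+1}\#\cdots\# r_n\#\sigma_k(va),\epsilon)$ in the ancestor-sibling scheme. *The learner.* It keeps a VPA on named states, with counters, and updates it with each document $w$ by recording the states and transitions visited on $\mathrm{dtyped}(w)$ (incWeightedVPA). Its hypothesis is obtained by *trim* (remove zero-weight states and transitions; between two states keep only the datatypes with maximal lexical space) followed by *genXVPA* (modules are the nonempty typing contexts; all exit states of a module share their return transitions; then *minimize* folds modules with the same element and isomorphic module DFAs until no fold is possible, in an order given by any fixed rule). *Target classes.* A language $L$ of documents is *$k$-$l$-local* for the chosen scheme if it is nonempty, its documents have a common root element and use finitely many element names, and every document $w$ satisfying the following belongs to $L$: each start tag of $w$ occurs in $L$ at the same named state; at the named state of each end tag of $w$ some end tag occurs in $L$; and each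 text $t$ of $w$ is covered by the set $X$ of texts occurring in $L$ at the same named state. *Covered* means in the first class (lexical) that $t\in\phi(\tau)$ for some $\tau\in\mathrm{minReq}(r)$, $r\in X$, and in the second class (datatyped) that every $\tau\in\mathrm{minReq}(t)$ satisfies $\phi(\tau)\subseteq\phi(\tau')$ for some $\tau'\in\mathrm{minReq}(r)$, $r\in X$. **Theorem.** Let $D_E$ be the hypothesis after a nonempty finite sequence $E$ of documents with a common root element. Every $D_E$ is a dXVPA with one-pass preorder typing (the module entered at a start tag is determined by the elements and text positions read up to it). Moreover the learner is 1. *incremental*: the VPA and counters after $E,w$, and hence $D_{E,w}$, are computed by incWeightedVPA, trim and genXVPA from the VPA and counters after $E$ and from $w$ alone; 2. *set-driven*: $D_E=D_{E'}$ whenever $E$ and $E'$ contain the same documents (regardless of order and repetition); 3. *consistent*: every $w$ in $E$ lies in $L(D_E)$ and in $L_{\rm dt}(D_E)$; 4. *conservative*: if the inferred datatyped form of $w$ does not contradict the hypothesis, i.e. $w\in L_{\rm dt}(D_E)$, then $D_{E,w}=D_E$; 5. *strong-monotonic*: $L(D_E)\subseteq L(D_{E,w})$ and $L_{\rm dt}(D_E)\subseteq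 L_{\rm dt}(D_{E,w})$, for every document $w$ with the same root element. It identifies in the limit from positive examples the $k$-$l$-local languages of the first class, with respect to $L(\cdot)$, and those of the second class, with respect to $L_{\rm dt}(\cdot)$: for every enumeration $E(1),E(2),\dots$ of such a language $L$ (in any order, with repetitions) all hypotheses $D_i$ are dXVPAs, and for some $N$ the hypothesis $D_N$ describes $L$ and $D_j=D_N$ for all $j\ge N$. Every language of the first (second) class is $L(D)$ (respectively $L_{\rm dt}(D)$) for a dXVPA $D$ with one-pass preorder typing. -/

import Mathlib

universe u v w

namespace XMLLearner

/-! ### Event streams -/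

/-- Events of a stream. `σ` is the type of qualified element names, `α` the type of the values of
`characters` events. -/
inductive Event (σ : Type u) (α : Type v) where
  | startElement (a : σ) : Event σ α
  | endElement (a : σ) : Event σ α
  | characters (x : α) : Event σ α

/-- Texts are strings over Unicode. -/
abbrev Text : Type := List Char

/-- A stream of events carrying texts. -/
abbrev Stream (σ : Type u) : Type u := List (Event σ Text)

/-- A datatyped event stream over the datatypes `T`. -/
abbrev TypedStream (σ : Type u) (T : Type v) : Type (max u v) := List (Event σ T)

namespace Event

variable {σ : Type u}

def IsCharacters {α : Type v} : Event σ α → Prop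
  | characters _ => True
  | _ => False

/-- Apply a function to the value of a `characters` event. -/
def mapChars {α : Type*} {β : Type*} (f : α → β) : Event σ α → Event σ β
  | startElement a => startElement a
  | endElement a => endElement a
  | characters x => characters (f x)

/-- Same kind of event, same element name, and related values of `characters` events. -/
inductive Rel {α : Type*} {β : Type*} (r : α → β → Prop) : Event σ α → Event σ β → Prop
  | startElement (a : σ) : Rel r (startElement a) (startElement a)
  | endElement (a : σ) : Rel r (endElement a) (endElement a)
  | characters {x : α} {y : β} (h : r x y) : Rel r (characters x) (characters y)

end Event

/-- Well-nested streams (linearizations of forests). -/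
inductive IsForest {σ : Type u} {α : Type v} : List (Event σ α) → Prop
  | nil : IsForest []
  | characters (x : α) (y : List (Event σ α)) :
      IsForest y → IsForest (Event.characters x :: y)
  | element (a : σ) (x y : List (Event σ α)) :
      IsForest x → IsForest y →
        IsForest (Event.startElement a :: (x ++ Event.endElement a :: y))

/-- Document event streams with root element `a`: one well-nested root element, and never two
consecutive `characters` events. -/
def IsDocument {σ : Type u} (a : σ) (w : Stream σ) : Prop :=
  (∃ x, IsForest x ∧ w = Event.startElement a :: (x ++ [Event.endElement a])) ∧
    w.IsChain (fun e f => ¬ (e.IsCharacters ∧ f.IsCharacters))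

/-! ### Lexical datatype systems -/

/-- Lexical datatypes `T` with kinds `K`; the order on kinds is the order of `K`, and
`τ ≤_lex τ'` is `φ τ ≤ φ τ'` (inclusion of lexical spaces). -/
structure DatatypeSystem (T : Type v) (K : Type w) [PartialOrder K] where
  /-- lexical spaces -/
  φ : T → Language Char
  regular : ∀ τ, (φ τ).IsRegular
  distinct : Function.Injective φ
  /-- the datatype of all strings -/
  top : T
  φ_top : φ top = ⊤
  kind : T → K

namespace DatatypeSystem

variable {T : Type v} {K : Type w} [PartialOrder K] (dts : DatatypeSystem T K)

/-- The minimal datatypes, with respect to `≤_lex`, among those that accept the text. -/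
def minLex (t : Text) : Set T :=
  {τ | t ∈ dts.φ τ ∧ ∀ τ', dts.φ τ' < dts.φ τ → t ∉ dts.φ τ'}

/-- Drop every datatype whose kind is greater than the kind of another one. -/
def pref (R : Set T) : Set T := {τ' ∈ R | ¬ ∃ τ ∈ R, dts.kind τ < dts.kind τ'}

def minReq (t : Text) : Set T := dts.pref (dts.minLex t)

/-- The maximal elements of a set of datatypes with respect to `≤_lex`. -/
def maxLex (R : Set T) : Set T := {τ ∈ R | ¬ ∃ τ' ∈ R, dts.φ τ < dts.φ τ'}

/-- Replace every text by the set of its minimally required datatypes. -/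
def dtyped {σ : Type u} (w : Stream σ) : List (Event σ (Set T)) :=
  w.map (Event.mapChars dts.minReq)

/-- A document event stream corresponds to a datatyped event stream. -/
def Corresponds {σ : Type u} (w : Stream σ) (w' : TypedStream σ T) : Prop :=
  List.Forall₂ (Event.Rel (fun t τ => t ∈ dts.φ τ)) w w'

/-- `w'` is one of the datatyped event streams described by the set-valued stream `y`: each
`characters` event carries one of the datatypes offered by `y`. -/
def IsInstance {σ : Type u} (y : List (Event σ (Set T))) (w' : TypedStream σ T) : Prop :=
  List.Forall₂ (Event.Rel (fun (R : Set T) (τ : T) => τ ∈ R)) y w'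

/-- Every datatype of `w'` is lexically subsumed by the corresponding datatype of `w''`. -/
def Subsumed {σ : Type u} (w' w'' : TypedStream σ T) : Prop :=
  List.Forall₂ (Event.Rel (fun τ τ' => dts.φ τ ≤ dts.φ τ')) w' w''

end DatatypeSystem

/-! ### Visibly pushdown automata whose stack alphabet is the set of states -/

inductive Trans (S : Type u) (σ : Type v) (T : Type w) where
  /-- `q → q'` on the start tag `a`, pushing `q` -/
  | call (q : S) (a : σ) (q' : S) : Trans S σ T
  /-- `q → q'` on the datatype `τ` -/
  | int (q : S) (τ : T) (q' : S) : Trans S σ T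
  /-- `q → q'` on the end tag `a`, popping `p` -/
  | ret (q : S) (a : σ) (p : S) (q' : S) : Trans S σ T

/-- One step between configurations (state, stack); the head of the list is the top. -/
inductive Step {S : Type u} {σ : Type v} {T : Type w} (δ : Set (Trans S σ T)) :
    S × List S → Event σ T → S × List S → Prop
  | call {q : S} {a : σ} {q' : S} (s : List S) :
      Trans.call q a q' ∈ δ → Step δ (q, s) (Event.startElement a) (q', q :: s)
  | int {q : S} {τ : T} {q' : S} (s : List S) :
      Trans.int q τ q' ∈ δ → Step δ (q, s) (Event.characters τ) (q', s)
  | ret {q : S} {a : σ} {p q' : S} (s : List S) :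
      Trans.ret q a p q' ∈ δ → Step δ (q, p :: s) (Event.endElement a) (q', s)

inductive Run {S : Type u} {σ : Type v} {T : Type w} (δ : Set (Trans S σ T)) :
    S × List S → TypedStream σ T → S × List S → Prop
  | nil (c : S × List S) : Run δ c [] c
  | cons {c c' c'' : S × List S} {e : Event σ T} {x : TypedStream σ T} :
      Step δ c e c' → Run δ c' x c'' → Run δ c (e :: x) c''

/-! ### Datatyped XVPAs -/

/-- The data of a dXVPA with modules in `C` and states in `S`. Values at elements of `C` outside
`modules` are irrelevant. -/
structure DXVPA (C S σ T : Type*) where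
  /-- the element names -/
  names : Set σ
  modules : Set C
  /-- the element assigned to a module -/
  μ : C → Option σ
  states : C → Set S
  entry : C → S
  exits : C → Set S
  trans : C → Set (Trans S σ T)
  /-- the start module -/
  m₀ : C

/-- States of the VPA of a dXVPA: a new start state, a new final state, and the module states. -/
inductive VState (S : Type u) where
  | start : VState S
  | final : VState S
  | inner (q : S) : VState S

/-- Map the states of a transition. -/
def Trans.map {S : Type*} {S' : Type*} {σ : Type*} {T : Type*} (f : S → S') :
    Trans S σ T → Trans S' σ T
  | .call q a q' => .call (f q) a (f q')
  | .int q τ q' => .int (f q) τ (f q')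
  | .ret q a p q' => .ret (f q) a (f p) (f q')

namespace DXVPA

variable {C S σ T : Type*}

/-- The conditions that make the data a dXVPA, including the single-exit property and the
mixed-content restrictions. -/
structure Valid (A : DXVPA C S σ T) : Prop where
  modules_finite : A.modules.Finite
  m₀_mem : A.m₀ ∈ A.modules
  μ_mem : ∀ m ∈ A.modules, ∃ a ∈ A.names, A.μ m = some a
  μ_surj : ∀ a ∈ A.names, ∃ m ∈ A.modules, A.μ m = some a
  states_finite : ∀ m ∈ A.modules, (A.states m).Finite
  states_disjoint : ∀ m ∈ A.modules, ∀ n ∈ A.modules, m ≠ n → Disjoint (A.states m) (A.states n)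
  entry_mem : ∀ m ∈ A.modules, A.entry m ∈ A.states m
  exits_sub : ∀ m ∈ A.modules, A.exits m ⊆ A.states m
  call_typed : ∀ m ∈ A.modules, ∀ q c q', Trans.call q c q' ∈ A.trans m →
    q ∈ A.states m ∧ ∃ n ∈ A.modules, A.μ n = some c ∧ q' = A.entry n
  int_typed : ∀ m ∈ A.modules, ∀ q τ q', Trans.int q τ q' ∈ A.trans m →
    q ∈ A.states m ∧ q' ∈ A.states m
  /-- an end tag leaves module `m` from an exit state and returns to the module of the state
  saved on the stack -/
  ret_typed : ∀ m ∈ A.modules, ∀ q c p q', Trans.ret q c p q' ∈ A.trans m →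
    q ∈ A.exits m ∧ A.μ m = some c ∧ ∃ n ∈ A.modules, p ∈ A.states n ∧ q' ∈ A.states n
  ret_det : ∀ m ∈ A.modules, ∀ q c p q' q'', Trans.ret q c p q' ∈ A.trans m →
    Trans.ret q c p q'' ∈ A.trans m → q' = q''
  single_exit : ∀ m ∈ A.modules, ∀ x ∈ A.exits m, ∀ y ∈ A.exits m, ∀ c p q',
    Trans.ret x c p q' ∈ A.trans m → Trans.ret y c p q' ∈ A.trans m
  datatype_choice : ∀ m ∈ A.modules, ∀ q τ τ' q' q'', Trans.int q τ q' ∈ A.trans m →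
    Trans.int q τ' q'' ∈ A.trans m → q' = q''
  datatype_sequence : ∀ m ∈ A.modules, ∀ n ∈ A.modules, ∀ q c p q',
    Trans.ret q c p q' ∈ A.trans n → p ∈ A.states m →
      ∀ r τ, Trans.int r τ q' ∉ A.trans m

/-- Transitions of the VPA that gives the semantics. -/
def vpaTrans (A : DXVPA C S σ T) : Set (Trans (VState S) σ T) :=
  {t | ∃ a, A.μ A.m₀ = some a ∧ t = .call .start a (.inner (A.entry A.m₀))} ∪
  {t | ∃ a, A.μ A.m₀ = some a ∧ ∃ q ∈ A.exits A.m₀, t = .ret (.inner q) a .start .final} ∪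
  {t | ∃ m ∈ A.modules, ∃ t' ∈ A.trans m, t = t'.map .inner}

/-- The accepted language of datatyped event streams. -/
def language (A : DXVPA C S σ T) : Set (TypedStream σ T) :=
  {x | Run A.vpaTrans (.start, []) x (.final, [])}

variable {K : Type*} [PartialOrder K]

/-- The event streams with texts accepted for validation: those corresponding to an accepted
datatyped event stream. -/
def docLanguage (dts : DatatypeSystem T K) (A : DXVPA C S σ T) : Set (Stream σ) :=
  {w | ∃ x ∈ A.language, dts.Corresponds w x}

/-- The event streams `w` whose inferred datatyped form `dtyped w` is accepted: every datatyped
event stream described by `dtyped w` is subsumed by an accepted one. -/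
def inferredLanguage (dts : DatatypeSystem T K) (A : DXVPA C S σ T) : Set (Stream σ) :=
  {w | ∀ x, DatatypeSystem.IsInstance (dts.dtyped w) x → ∃ y ∈ A.language, dts.Subsumed x y}

/-- One-pass preorder typing: in an accepted stream the module entered at a start tag is
determined by the part of the stream up to that start tag, irrespective of the datatypes of the
text contents in it. -/
def OnePassPreorderTyped (A : DXVPA C S σ T) : Prop :=
  ∀ (x₁ x₂ y₁ y₂ : TypedStream σ T) (a : σ) (c₁ c₂ : VState S × List (VState S)),
    List.Forall₂ (Event.Rel (fun _ _ => True)) x₁ x₂ →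
    Run A.vpaTrans (.start, []) (x₁ ++ [.startElement a]) c₁ →
    Run A.vpaTrans c₁ y₁ (.final, []) →
    Run A.vpaTrans (.start, []) (x₂ ++ [.startElement a]) c₂ →
    Run A.vpaTrans c₂ y₂ (.final, []) →
    ∀ m₁ ∈ A.modules, ∀ m₂ ∈ A.modules, c₁.1 ∈ VState.inner '' A.states m₁ →
      c₂.1 ∈ VState.inner '' A.states m₂ → m₁ = m₂

/-! ### Minimization -/

/-- Transitions of the DFA of a module on the symbol `i` (a module): call `i` from `q` and come
back to `q'`. -/
def ModuleStep (A : DXVPA C S σ T) (m i : C) (q q' : S) : Prop :=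
  i ∈ A.modules ∧ ∃ c x, Trans.call q c (A.entry i) ∈ A.trans m ∧ Trans.ret x c q q' ∈ A.trans i

/-- `φ` is an isomorphism from the DFA of the module `n` to the DFA of the module `m`; these DFAs
read modules and datatypes. -/
structure IsModuleIso (A : DXVPA C S σ T) (m n : C) (φ : S → S) : Prop where
  bij : Set.BijOn φ (A.states n) (A.states m)
  entry : φ (A.entry n) = A.entry m
  exits : ∀ q ∈ A.states n, q ∈ A.exits n ↔ φ q ∈ A.exits m
  int : ∀ q ∈ A.states n, ∀ q' ∈ A.states n, ∀ τ,
    Trans.int q τ q' ∈ A.trans n ↔ Trans.int (φ q) τ (φ q') ∈ A.trans m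
  step : ∀ q ∈ A.states n, ∀ q' ∈ A.states n, ∀ i,
    A.ModuleStep n i q q' ↔ A.ModuleStep m i (φ q) (φ q')

/-- The module `n` can be folded into the module `m`. -/
def Foldable (A : DXVPA C S σ T) (m n : C) (φ : S → S) : Prop :=
  m ∈ A.modules ∧ n ∈ A.modules ∧ m ≠ n ∧ A.μ m = A.μ n ∧ A.IsModuleIso m n φ

open Classical in
/-- Fold the module `n` into the module `m`: calls of `n` become calls of `m`, the returns of `n`
become returns of the exit states of `m`, and stack and target states of returns into `n` are
replaced by their images in `m`. -/
noncomputable def fold (A : DXVPA C S σ T) (m n : C) (φ : S → S) : DXVPA C S σ T where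
  names := A.names
  modules := A.modules \ {n}
  μ := Function.update A.μ n none
  states := A.states
  entry := A.entry
  exits := A.exits
  trans i :=
    {t | ∃ q c q', Trans.call q c q' ∈ A.trans i ∧
      t = .call q c (if q' = A.entry n then A.entry m else q')} ∪
    {t | ∃ q τ q', Trans.int q τ q' ∈ A.trans i ∧ t = .int q τ q'} ∪
    {t | ∃ q c p q',
      (Trans.ret q c p q' ∈ A.trans i ∨
        (i = m ∧ q ∈ A.exits m ∧ ∃ x, Trans.ret x c p q' ∈ A.trans n)) ∧
      t = if p ∈ A.states n then .ret q c (φ p) (φ q') else .ret q c p q'}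
  m₀ := if n = A.m₀ then m else A.m₀

/-- A rule that chooses which two modules are folded next (and along which bijection), whenever
some fold is possible. -/
def IsFoldStrategy (sel : DXVPA C S σ T → C × C × (S → S)) : Prop :=
  ∀ A : DXVPA C S σ T, (∃ m n φ, A.Foldable m n φ) →
    A.Foldable (sel A).1 (sel A).2.1 (sel A).2.2

open Classical in
/-- One iteration of the minimization loop. -/
noncomputable def foldStep (sel : DXVPA C S σ T → C × C × (S → S)) (A : DXVPA C S σ T) :
    DXVPA C S σ T :=
  if A.Foldable (sel A).1 (sel A).2.1 (sel A).2.2 then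
    A.fold (sel A).1 (sel A).2.1 (sel A).2.2
  else A

/-- Fold until no fold is possible. Every fold removes a module, so that as many iterations as
there are modules suffice. -/
noncomputable def minimize (sel : DXVPA C S σ T → C × C × (S → S)) (A : DXVPA C S σ T) :
    DXVPA C S σ T :=
  (foldStep sel)^[A.modules.ncard] A

end DXVPA

/-! ### State naming -/

inductive Scheme where
  | ancestor : Scheme
  | ancestorSibling : Scheme

/-- Typing contexts: ancestor strings, or ancestor-sibling strings `r₁#⋯#rₙ` given as the list of
the strings `rᵢ`. In left-sibling strings `none` is the placeholder `$` for text. -/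
def Ctx : Scheme → Type u → Type u
  | .ancestor, σ => List σ
  | .ancestorSibling, σ => List (List (Option σ))

/-- Named states: a typing context and a left-sibling string. -/
abbrev NState (s : Scheme) (σ : Type u) : Type u := Ctx s σ × List (Option σ)

/-- The empty typing context. -/
def Ctx.empty {σ : Type u} : (s : Scheme) → Ctx s σ
  | .ancestor => ([] : List σ)
  | .ancestorSibling => ([] : List (List (Option σ)))

/-- The typing context after a start tag; `rtake i` is the suffix of length `i`. -/
def Ctx.extend {σ : Type u} (k l : ℕ) :
    (s : Scheme) → Ctx s σ → List (Option σ) → σ → Ctx s σ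
  | .ancestor => fun (r : List σ) _ a => ((r ++ [a]).rtake l : List σ)
  | .ancestorSibling => fun (r : List (List (Option σ))) z a =>
      (r.rtake l ++ [(z ++ [some a]).rtake k] : List (List (Option σ)))

section Naming

variable {σ : Type u} (s : Scheme) (k l : ℕ)

def initState : NState s σ := (Ctx.empty s, [])

variable {s}

def callName (q : NState s σ) (a : σ) : NState s σ := (Ctx.extend k l s q.1 q.2 a, [])

def intName (q : NState s σ) : NState s σ := (q.1, (q.2 ++ [none]).rtake k)

def retName (_q p : NState s σ) (a : σ) : NState s σ := (p.1, (p.2 ++ [some a]).rtake k)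

/-- The effect of an event on the current named state and the stack of saved named states. -/
def nextConfig {α : Type*} :
    NState s σ × List (NState s σ) → Event σ α → NState s σ × List (NState s σ)
  | (q, z), .startElement a => (callName k l q a, q :: z)
  | (q, p :: z), .endElement a => (retName k q p a, z)
  | (q, []), .endElement _ => (q, [])
  | (q, z), .characters _ => (intName k q, z)

variable (s)

/-- The named state reached after reading a stream. -/
def stateAfter {α : Type*} (x : List (Event σ α)) : NState s σ :=
  (x.foldl (nextConfig k l) (initState s, [])).1

/-- In some document of `L`, the event `e` occurs at the named state `q`. -/
def OccursAt (L : Set (Stream σ)) (q : NState s σ) (e : Event σ Text) : Prop :=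
  ∃ x y, x ++ e :: y ∈ L ∧ stateAfter s k l x = q

end Naming

/-- `t` is in the lexical space of a datatype inferred from a text in `X`. -/
def LexicallyCovered {T K : Type*} [PartialOrder K] (dts : DatatypeSystem T K)
    (X : Set Text) (t : Text) : Prop :=
  ∃ r ∈ X, ∃ τ ∈ dts.minReq r, t ∈ dts.φ τ

/-- Every datatype inferred from `t` is subsumed by a datatype inferred from a text in `X`. -/
def DatatypeCovered {T K : Type*} [PartialOrder K] (dts : DatatypeSystem T K)
    (X : Set Text) (t : Text) : Prop :=
  ∀ τ ∈ dts.minReq t, ∃ r ∈ X, ∃ τ' ∈ dts.minReq r, dts.φ τ ≤ dts.φ τ'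

/-- `k`-`l`-local languages of documents: nonempty, with a common root element, over finitely many
element names, and determined by what may happen at each named state. A document belongs to the
language as soon as each of its start tags, each of its end tags and each of its texts is permitted
at the named state where it occurs; start tags are permitted if they occur in the language at that
state, end tags if some end tag does, and texts if they are covered (in the sense given by
`covered`) by the texts that do. -/
structure IsLocalLanguage {σ : Type u} (covered : Set Text → Text → Prop) (s : Scheme) (k l : ℕ)
    (L : Set (Stream σ)) : Prop where
  nonempty : L.Nonempty
  document : ∃ a, ∀ w ∈ L, IsDocument a w
  finite_names : {a | ∃ w ∈ L, Event.startElement a ∈ w}.Finite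
  closed : ∀ a w, IsDocument a w →
    (∀ x b y, w = x ++ Event.startElement b :: y →
      OccursAt s k l L (stateAfter s k l x) (.startElement b)) →
    (∀ x b y, w = x ++ Event.endElement b :: y →
      ∃ b', OccursAt s k l L (stateAfter s k l x) (.endElement b')) →
    (∀ x t y, w = x ++ Event.characters t :: y →
      covered {r | OccursAt s k l L (stateAfter s k l x) (.characters r)} t) →
    w ∈ L

/-! ### The learner -/

/-- The intermediate VPA; its start state is `initState`. -/
structure InterVPA (S σ T : Type*) where
  names : Set σ
  states : Set S
  final : Set S
  trans : Set (Trans S σ T)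

/-- The intermediate VPA with its counters. -/
structure WeightedVPA (S σ T : Type*) extends InterVPA S σ T where
  wQ : S → ℕ
  wF : S → ℕ
  wδ : Trans S σ T → ℕ

section Learner

variable {σ T K : Type*} [PartialOrder K] {s : Scheme} (k l : ℕ)

open Classical in
/-- Add one to the counters of the elements of `X`. -/
noncomputable def bump {α : Type*} (ω : α → ℕ) (X : Set α) : α → ℕ :=
  fun x => if x ∈ X then ω x + 1 else ω x

/-- Record the transitions `X` into the state `q'`. -/
noncomputable def WeightedVPA.record {S : Type*} (A : WeightedVPA S σ T) (N : Set σ)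
    (X : Set (Trans S σ T)) (q' : S) : WeightedVPA S σ T where
  names := A.names ∪ N
  states := A.states ∪ {q'}
  final := A.final
  trans := A.trans ∪ X
  wQ := bump A.wQ {q'}
  wF := A.wF
  wδ := bump A.wδ X

/-- One event of a pass over a document: update the automaton, the current state and the stack. -/
noncomputable def learnEvent :
    WeightedVPA (NState s σ) σ T × NState s σ × List (NState s σ) → Event σ (Set T) →
      WeightedVPA (NState s σ) σ T × NState s σ × List (NState s σ)
  | (A, q, z), .startElement a =>
      (A.record {a} {Trans.call q a (callName k l q a)} (callName k l q a),
        callName k l q a, q :: z)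
  | (A, q, p :: z), .endElement a =>
      (A.record ∅ {Trans.ret q a p (retName k q p a)} (retName k q p a), retName k q p a, z)
  | (A, q, []), .endElement _ => (A, q, [])
  | (A, q, z), .characters R =>
      (A.record ∅ {t | ∃ τ ∈ R, t = Trans.int q τ (intName k q)} (intName k q), intName k q, z)

/-- Update the intermediate VPA and its counters with a document event stream. -/
noncomputable def incWeightedVPA (dts : DatatypeSystem T K) (A : WeightedVPA (NState s σ) σ T)
    (w : Stream σ) : WeightedVPA (NState s σ) σ T :=
  let r := (dts.dtyped w).foldl (learnEvent k l) (A, initState s, [])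
  { r.1 with final := r.1.final ∪ {r.2.1}, wF := bump r.1.wF {r.2.1} }

/-- Remove zero-weight states and transitions, and keep, between two states, only the maximal
datatypes. -/
def trim {S : Type*} (dts : DatatypeSystem T K) (A : WeightedVPA S σ T) : InterVPA S σ T where
  names := A.names
  states := {q ∈ A.states | A.wQ q ≠ 0}
  final := {q ∈ A.final | A.wF q ≠ 0}
  trans :=
    {t | (∃ q c q', t = .call q c q') ∧ t ∈ A.trans ∧ A.wδ t ≠ 0} ∪
    {t | (∃ q c p q', t = .ret q c p q') ∧ t ∈ A.trans ∧ A.wδ t ≠ 0} ∪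
    {t | ∃ q τ q', t = .int q τ q' ∧
      τ ∈ dts.maxLex {τ' | Trans.int q τ' q' ∈ A.trans ∧ A.wδ (.int q τ' q') ≠ 0}}

open Classical in
/-- The dXVPA of a trimmed intermediate VPA before minimization: modules are the nonempty typing
contexts. All exit states of a module get the return transitions of each of them. Returns to the
start state of the intermediate VPA are no module transitions; they are represented by the exit
states of the start module. -/
noncomputable def toXVPA (A : InterVPA (NState s σ) σ T) :
    DXVPA (Ctx s σ) (NState s σ) σ T where
  names := A.names
  modules := {m | m ≠ Ctx.empty s ∧ ∃ z, (m, z) ∈ A.states}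
  μ m := if h : ∃ c q, Trans.call q c (m, []) ∈ A.trans then some h.choose else none
  states m := {q ∈ A.states | q.1 = m}
  entry m := (m, [])
  exits m := {q ∈ A.states | q.1 = m ∧ ∃ c p q', Trans.ret q c p q' ∈ A.trans}
  trans m :=
    {t | ∃ q c q', t = .call q c q' ∧ t ∈ A.trans ∧ q ∈ A.states ∧ q.1 = m} ∪
    {t | ∃ q τ q', t = .int q τ q' ∧ t ∈ A.trans ∧ q ∈ A.states ∧ q.1 = m ∧
      q' ∈ A.states ∧ q'.1 = m} ∪
    {t | ∃ q c p q', t = .ret q c p q' ∧ p.1 ≠ Ctx.empty s ∧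
      (q ∈ A.states ∧ q.1 = m ∧ ∃ d p' q'', Trans.ret q d p' q'' ∈ A.trans) ∧
      ∃ r ∈ A.states, r.1 = m ∧ Trans.ret r c p q' ∈ A.trans}
  m₀ := @Classical.epsilon _ ⟨Ctx.empty s⟩
    (fun m => ∃ c, Trans.call (initState s) c (m, []) ∈ A.trans)

/-- The type of rules that choose the folds of the minimization. -/
abbrev FoldRule (s : Scheme) (σ T : Type*) :=
  DXVPA (Ctx s σ) (NState s σ) σ T → Ctx s σ × Ctx s σ × (NState s σ → NState s σ)

/-- The dXVPA of a trimmed intermediate VPA. -/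
noncomputable def genXVPA (sel : FoldRule s σ T) (A : InterVPA (NState s σ) σ T) :
    DXVPA (Ctx s σ) (NState s σ) σ T :=
  (toXVPA A).minimize sel

variable (s) in
/-- The initial intermediate VPA. -/
def initVPA : WeightedVPA (NState s σ) σ T where
  names := ∅
  states := {initState s}
  final := ∅
  trans := ∅
  wQ _ := 0
  wF _ := 0
  wδ _ := 0

variable (s) in
/-- The persistent VPA and counters after a sequence of examples. -/
noncomputable def memory (dts : DatatypeSystem T K) (E : List (Stream σ)) :
    WeightedVPA (NState s σ) σ T :=
  E.foldl (incWeightedVPA k l dts) (initVPA s)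

/-- The hypothesis of the learner after a sequence of examples. -/
noncomputable def learn (dts : DatatypeSystem T K) (sel : FoldRule s σ T) (E : List (Stream σ)) :
    DXVPA (Ctx s σ) (NState s σ) σ T :=
  genXVPA sel (trim dts (memory s k l dts E))

end Learner

/-- A sequence of examples: at least one, all of them documents, with a common root element. -/
def IsSample {σ : Type*} (E : List (Stream σ)) : Prop :=
  E ≠ [] ∧ ∃ a, ∀ w ∈ E, IsDocument a w

/-- Identification in the limit from positive examples of the class `𝓛` by the learner `I`, with
hypotheses in `𝓓` describing languages by `lang`. -/
def IdentifiesInLimit {W H : Type*} (I : List W → H) (𝓓 : Set H) (lang : H → Set W)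
    (𝓛 : Set (Set W)) : Prop :=
  ∀ L ∈ 𝓛, ∀ E : ℕ → W, Set.range E = L →
    (∀ i, I ((List.range (i + 1)).map E) ∈ 𝓓) ∧
    ∃ N, lang (I ((List.range (N + 1)).map E)) = L ∧
      ∀ j ≥ N, I ((List.range (j + 1)).map E) = I ((List.range (N + 1)).map E)

end XMLLearner

/-! Names of states depend only on element names and text positions, so what the learner retains is
a set of facts: which start tags, inferred datatypes and end tags (with the state they pop) occur at
which named state. `observed` collects these facts for any set `L` of documents, and
`toXVPA_trim_memory` identifies the unminimized hypothesis after `E` with `toXVPA` of the facts of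
the set of members of `E`. Hence the learner is set-driven; incrementality is the recursion of
`memory`.

Minimization must preserve the language. `Coherent` adds to validity that calls are deterministic
and that calls and returns match. It holds for the unminimized hypothesis (`observed_coherent`) and
survives folding (`Coherent.fold`); the state map `foldState` then relates the runs before and after
a fold in both directions (`Coherent.language_fold`). Coherent automata are deterministic up to the
choice of datatypes, which yields one-pass preorder typing.

Before minimization acceptance is local (`mem_language_observed`): every event must be permitted by
the facts at its configuration, and the final state must be reached. More documents give more facts,
and maximal datatypes are only replaced by larger ones; this gives consistency and strong
monotonicity. An inferred-accepted document adds only returns already shared among exit states and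
datatypes below maximal ones, so the automaton does not change: conservativity.

For a local language the closure condition says that a document all of whose events are permitted
belongs to `L`, so the hypothesis for the whole of `L` describes `L`. Finitely many names yield
finitely many named states, hence finitely many facts; a finite part of `L` witnesses them all, and
the hypothesis is stable once an enumeration has shown it (`exists_finite_observed`,
`learn_converges`). -/

namespace XMLLearner

/-! ### Coherent dXVPAs: determinism up to datatypes, and folds that preserve the language. -/

namespace DXVPA

variable {C S σ T : Type*}

/-- Valid dXVPAs in which calls are deterministic and every call has a matching return and vice
versa. -/
structure Coherent (A : DXVPA C S σ T) : Prop extends A.Valid where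
  call_det : ∀ m ∈ A.modules, ∀ q c q' q'', Trans.call q c q' ∈ A.trans m →
    Trans.call q c q'' ∈ A.trans m → q' = q''
  ret_call : ∀ i ∈ A.modules, ∀ j ∈ A.modules, ∀ x c p q', Trans.ret x c p q' ∈ A.trans i →
    p ∈ A.states j → Trans.call p c (A.entry i) ∈ A.trans j
  call_ret : ∀ i ∈ A.modules, ∀ j ∈ A.modules, ∀ q c, Trans.call q c (A.entry i) ∈ A.trans j →
    ∃ x q', Trans.ret x c q q' ∈ A.trans i

theorem call_mem_vpaTrans {A : DXVPA C S σ T} {p p' : VState S} {a : σ} :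
    Trans.call p a p' ∈ A.vpaTrans ↔
      (p = .start ∧ A.μ A.m₀ = some a ∧ p' = .inner (A.entry A.m₀)) ∨
      ∃ m ∈ A.modules, ∃ q q', p = .inner q ∧ p' = .inner q' ∧ Trans.call q a q' ∈ A.trans m := by
  constructor
  · rintro ((⟨b, hb, h⟩ | ⟨b, hb, q, hq, h⟩) | ⟨m, hm, t, ht, h⟩)
    · cases h; exact .inl ⟨rfl, hb, rfl⟩
    · cases h
    · cases t <;> simp only [Trans.map] at h <;> cases h
      exact .inr ⟨m, hm, _, _, rfl, rfl, ht⟩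
  · rintro (⟨rfl, h, rfl⟩ | ⟨m, hm, q, q', rfl, rfl, h⟩)
    · exact .inl (.inl ⟨a, h, rfl⟩)
    · exact .inr ⟨m, hm, _, h, rfl⟩

theorem int_mem_vpaTrans {A : DXVPA C S σ T} {p p' : VState S} {τ : T} :
    Trans.int p τ p' ∈ A.vpaTrans ↔
      ∃ m ∈ A.modules, ∃ q q', p = .inner q ∧ p' = .inner q' ∧ Trans.int q τ q' ∈ A.trans m := by
  constructor
  · rintro ((⟨b, hb, h⟩ | ⟨b, hb, q, hq, h⟩) | ⟨m, hm, t, ht, h⟩)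
    · cases h
    · cases h
    · cases t <;> simp only [Trans.map] at h <;> cases h
      exact ⟨m, hm, _, _, rfl, rfl, ht⟩
  · rintro ⟨m, hm, q, q', rfl, rfl, h⟩
    exact .inr ⟨m, hm, _, h, rfl⟩

theorem ret_mem_vpaTrans {A : DXVPA C S σ T} {p r p' : VState S} {a : σ} :
    Trans.ret p a r p' ∈ A.vpaTrans ↔
      (∃ q ∈ A.exits A.m₀, p = .inner q ∧ r = .start ∧ p' = .final ∧ A.μ A.m₀ = some a) ∨
      ∃ m ∈ A.modules, ∃ q r' q', p = .inner q ∧ r = .inner r' ∧ p' = .inner q' ∧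
        Trans.ret q a r' q' ∈ A.trans m := by
  constructor
  · rintro ((⟨b, hb, h⟩ | ⟨b, hb, q, hq, h⟩) | ⟨m, hm, t, ht, h⟩)
    · cases h
    · cases h; exact .inl ⟨q, hq, rfl, rfl, rfl, hb⟩
    · cases t <;> simp only [Trans.map] at h <;> cases h
      exact .inr ⟨m, hm, _, _, _, rfl, rfl, rfl, ht⟩
  · rintro (⟨q, hq, rfl, rfl, rfl, h⟩ | ⟨m, hm, q, q', r', rfl, rfl, rfl, h⟩)
    · exact .inl (.inr ⟨a, h, q, hq, rfl⟩)
    · exact .inr ⟨m, hm, _, h, rfl⟩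

theorem Valid.module_unique {A : DXVPA C S σ T} (hA : A.Valid) {m n : C} (hm : m ∈ A.modules)
    (hn : n ∈ A.modules) {q : S} (h : q ∈ A.states m) (h' : q ∈ A.states n) : m = n := by
  by_contra hne
  exact Set.disjoint_left.1 (hA.states_disjoint m hm n hn hne) h h'

theorem Valid.entry_inj {A : DXVPA C S σ T} (hA : A.Valid) {m n : C} (hm : m ∈ A.modules)
    (hn : n ∈ A.modules) (h : A.entry m = A.entry n) : m = n :=
  hA.module_unique hm hn (hA.entry_mem m hm) (h ▸ hA.entry_mem n hn)

/-- State sets of modules are disjoint, so transitions that leave the same state belong to the same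
module, where each kind of transition is deterministic. The datatypes may differ because all
datatype transitions of a state share their target. -/
theorem Coherent.step_unique {A : DXVPA C S σ T} (hA : A.Coherent)
    {c d d' : VState S × List (VState S)} {e e' : Event σ T}
    (he : Event.Rel (fun _ _ => True) e e') (h : Step A.vpaTrans c e d)
    (h' : Step A.vpaTrans c e' d') : d = d' := by
  cases he with
  | startElement a =>
    cases h with
    | call s h =>
      cases h' with
      | call s h' =>
        rw [call_mem_vpaTrans] at h h'
        rcases h with ⟨rfl, h1, rfl⟩ | ⟨m, hm, q, q', rfl, rfl, h⟩
        · rcases h' with ⟨-, h1', rfl⟩ | ⟨m', hm', r, r', h2, rfl, h'⟩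
          · rfl
          · cases h2
        · rcases h' with ⟨h2, h1', rfl⟩ | ⟨m', hm', r, r', h2, rfl, h'⟩
          · cases h2
          · cases h2
            obtain rfl := hA.module_unique hm hm' (hA.call_typed m hm _ _ _ h).1
              (hA.call_typed m' hm' _ _ _ h').1
            rw [hA.call_det m hm _ _ _ _ h h']
  | endElement a =>
    cases h with
    | ret s h =>
      cases h' with
      | ret s h' =>
        rw [ret_mem_vpaTrans] at h h'
        rcases h with ⟨q, hq, rfl, rfl, rfl, h1⟩ | ⟨m, hm, q, r, q', rfl, rfl, rfl, h⟩
        · rcases h' with ⟨q', hq', h2, h3, rfl, h1⟩ | ⟨m', hm', q', r', q'', h2, h3, rfl, h'⟩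
          · rfl
          · cases h3
        · rcases h' with ⟨q', hq', h2, h3, rfl, h1⟩ | ⟨m', hm', q', r', q'', h2, h3, rfl, h'⟩
          · cases h3
          · cases h2; cases h3
            obtain rfl := hA.module_unique hm hm'
              (hA.exits_sub m hm (hA.ret_typed m hm _ _ _ _ h).1)
              (hA.exits_sub m' hm' (hA.ret_typed m' hm' _ _ _ _ h').1)
            rw [hA.ret_det m hm _ _ _ _ _ h h']
  | characters _ =>
    cases h with
    | int s h =>
      cases h' with
      | int s h' =>
        rw [int_mem_vpaTrans] at h h'
        obtain ⟨m, hm, q, q', rfl, rfl, h⟩ := h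
        obtain ⟨m', hm', r, r', h2, rfl, h'⟩ := h'
        cases h2
        obtain rfl := hA.module_unique hm hm' (hA.int_typed m hm _ _ _ h).1
          (hA.int_typed m' hm' _ _ _ h').1
        rw [hA.datatype_choice m hm _ _ _ _ _ h h']

theorem Coherent.run_unique {A : DXVPA C S σ T} (hA : A.Coherent) {x x' : TypedStream σ T}
    (hx : List.Forall₂ (Event.Rel (fun _ _ => True)) x x') {c d d' : VState S × List (VState S)}
    (h : Run A.vpaTrans c x d) (h' : Run A.vpaTrans c x' d') : d = d' := by
  induction hx generalizing c with
  | nil => cases h; cases h'; rfl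
  | cons he _ ih =>
    cases h with
    | cons h1 h2 =>
      cases h' with
      | cons h1' h2' =>
        obtain rfl := hA.step_unique he h1 h1'
        exact ih h2 h2'

theorem Coherent.onePassPreorderTyped {A : DXVPA C S σ T} (hA : A.Coherent) :
    A.OnePassPreorderTyped := by
  intro x₁ x₂ y₁ y₂ a c₁ c₂ hx h₁ _ h₂ _ m₁ hm₁ m₂ hm₂ h h'
  have hx' : List.Forall₂ (Event.Rel (fun _ _ => True)) (x₁ ++ [Event.startElement a])
      (x₂ ++ [Event.startElement a] : TypedStream σ T) :=
    List.rel_append hx (.cons (.startElement a) .nil)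
  obtain rfl := hA.run_unique hx' h₁ h₂
  obtain ⟨q, hq, hq'⟩ := h
  obtain ⟨r, hr, hr'⟩ := h'
  rw [← hr'] at hq'
  cases hq'
  exact hA.module_unique hm₁ hm₂ hq hr

section Fold

variable {A : DXVPA C S σ T} {m n : C} {φ : S → S}

/-- A module isomorphism speaks only of a call together with a return. A single call is completed to
such a pair by `call_ret`, and the element is recovered from the called module, because its returns
must read `μ i`. -/
theorem Coherent.fold_iso_call (hA : A.Coherent) (hf : A.Foldable m n φ) {q : S}
    (hq : q ∈ A.states n) {c : σ} {q' : S} :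
    Trans.call q c q' ∈ A.trans n ↔ Trans.call (φ q) c q' ∈ A.trans m := by
  obtain ⟨hm, hn, hne, hμ, hφ⟩ := hf
  constructor
  · intro h
    obtain ⟨-, i, hi, hc, rfl⟩ := hA.call_typed n hn _ _ _ h
    obtain ⟨x, q', hx⟩ := hA.call_ret i hi n hn _ _ h
    obtain ⟨-, -, j, hj, h1, h2⟩ := hA.ret_typed i hi _ _ _ _ hx
    obtain rfl := hA.module_unique hj hn h1 hq
    obtain ⟨-, c', x', h3, h4⟩ := (hφ.step q hq q' h2 i).1 ⟨hi, c, x, h, hx⟩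
    have := (hA.ret_typed i hi _ _ _ _ h4).2.1
    rw [hc] at this
    cases this
    exact h3
  · intro h
    obtain ⟨-, i, hi, hc, rfl⟩ := hA.call_typed m hm _ _ _ h
    obtain ⟨x, q', hx⟩ := hA.call_ret i hi m hm _ _ h
    obtain ⟨-, -, j, hj, h1, h2⟩ := hA.ret_typed i hi _ _ _ _ hx
    obtain rfl := hA.module_unique hj hm h1 (hφ.bij.mapsTo hq)
    obtain ⟨q'', hq'', rfl⟩ := hφ.bij.surjOn h2
    obtain ⟨-, c', x', h3, h4⟩ := (hφ.step q hq q'' hq'' i).2 ⟨hi, c, x, h, hx⟩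
    have := (hA.ret_typed i hi _ _ _ _ h4).2.1
    rw [hc] at this
    cases this
    exact h3

/-- The isomorphism supplies a return to `φ p` from some exit state of `i`, and the single-exit
property transfers it to `x`. So the returns that `fold` redirects along `φ` are already present. -/
theorem Coherent.fold_iso_ret (hA : A.Coherent) (hf : A.Foldable m n φ) {i : C}
    (hi : i ∈ A.modules) {x : S} {c : σ} {p q' : S} (hp : p ∈ A.states n)
    (h : Trans.ret x c p q' ∈ A.trans i) : Trans.ret x c (φ p) (φ q') ∈ A.trans i := by
  obtain ⟨hm, hn, hne, hμ, hφ⟩ := hf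
  obtain ⟨hx, hc, j, hj, h1, h2⟩ := hA.ret_typed i hi _ _ _ _ h
  obtain rfl := hA.module_unique hj hn h1 hp
  obtain ⟨-, c', x', h3, h4⟩ := (hφ.step p hp q' h2 i).1
    ⟨hi, c, x, hA.ret_call i hi _ hj _ _ _ _ h hp, h⟩
  obtain ⟨h5, h6, -⟩ := hA.ret_typed i hi _ _ _ _ h4
  rw [hc] at h6
  cases h6
  exact hA.single_exit i hi _ h5 _ hx _ _ _ h4

theorem call_mem_fold {i : C} {q : S} {c : σ} {q' : S} :
    Trans.call q c q' ∈ (A.fold m n φ).trans i ↔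
      ∃ q₀, Trans.call q c q₀ ∈ A.trans i ∧
        (q₀ = A.entry n ∧ q' = A.entry m ∨ q₀ ≠ A.entry n ∧ q' = q₀) := by
  classical
  constructor
  · rintro ((⟨q₁, c₁, q₁', h, h1⟩ | ⟨q₁, c₁, q₁', h, h1⟩) | ⟨q₁, c₁, p₁, q₁', h, h1⟩)
    · cases h1
      refine ⟨_, h, ?_⟩
      split_ifs with h2 <;> simp [h2]
    · cases h1
    · split_ifs at h1
  · rintro ⟨q₀, h, h1⟩
    refine .inl (.inl ⟨q, c, q₀, h, ?_⟩)
    rcases h1 with ⟨rfl, rfl⟩ | ⟨h1, rfl⟩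
    · simp
    · simp [h1]

theorem int_mem_fold {i : C} {q : S} {τ : T} {q' : S} :
    Trans.int q τ q' ∈ (A.fold m n φ).trans i ↔ Trans.int q τ q' ∈ A.trans i := by
  constructor
  · rintro ((⟨q₁, c₁, q₁', h, h1⟩ | ⟨q₁, c₁, q₁', h, h1⟩) | ⟨q₁, c₁, p₁, q₁', h, h1⟩)
    · cases h1
    · cases h1; exact h
    · split_ifs at h1
  · intro h
    exact .inl (.inr ⟨_, _, _, h, rfl⟩)

/-- By `fold_iso_ret` redirection creates nothing new. On returns, folding merely deletes those that
pop a state of `n` and gives the exits of `m` the returns of `n`. -/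
theorem Coherent.ret_mem_fold (hA : A.Coherent) (hf : A.Foldable m n φ) {i : C}
    (hi : i ∈ A.modules) {q : S} {c : σ} {p q' : S} :
    Trans.ret q c p q' ∈ (A.fold m n φ).trans i ↔ p ∉ A.states n ∧
      (Trans.ret q c p q' ∈ A.trans i ∨
        (i = m ∧ q ∈ A.exits m ∧ ∃ x, Trans.ret x c p q' ∈ A.trans n)) := by
  constructor
  · rintro ((⟨q₁, c₁, q₁', h, h1⟩ | ⟨q₁, c₁, q₁', h, h1⟩) | ⟨q₁, c₁, p₁, q₁', h, h1⟩)
    · cases h1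
    · cases h1
    · split_ifs at h1 with hp
      · cases h1
        have hp' := hf.2.2.2.2.bij.mapsTo hp
        refine ⟨fun h' => hf.2.2.1 (hA.module_unique hf.1 hf.2.1 hp' h'), ?_⟩
        rcases h with h | ⟨rfl, h2, x, h3⟩
        · exact .inl (hA.fold_iso_ret hf hi hp h)
        · exact .inr ⟨rfl, h2, x, hA.fold_iso_ret hf hf.2.1 hp h3⟩
      · cases h1
        exact ⟨hp, h⟩
  · rintro ⟨hp, h⟩
    exact .inr ⟨q, c, p, q', h, by rw [if_neg hp]⟩

theorem Coherent.fold (hA : A.Coherent) (hf : A.Foldable m n φ) : (A.fold m n φ).Coherent := by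
  classical
  have hm := hf.1
  have hn := hf.2.1
  have hne := hf.2.2.1
  have hμ := hf.2.2.2.1
  have hφ := hf.2.2.2.2
  have hmod : ∀ i, i ∈ (A.fold m n φ).modules ↔ i ∈ A.modules ∧ i ≠ n := fun i => by
    simp [DXVPA.fold]
  have hμf : ∀ i, i ≠ n → (A.fold m n φ).μ i = A.μ i := fun i hi => by
    simp [DXVPA.fold, Function.update_of_ne hi]
  have hst : ∀ i, (A.fold m n φ).states i = A.states i := fun i => rfl
  have hen : ∀ i, (A.fold m n φ).entry i = A.entry i := fun i => rfl
  have hex : ∀ i, (A.fold m n φ).exits i = A.exits i := fun i => rfl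
  -- Needed for `call_ret`: the returns taken over from `n` must leave from some exit of `m`.
  have hex' : (A.exits n).Nonempty → (A.exits m).Nonempty := fun ⟨x, hx⟩ =>
    ⟨φ x, (hφ.exits x (hA.exits_sub n hn hx)).1 hx⟩
  refine ⟨⟨?_, ?_, ?_, ?_, ?_, ?_, ?_, ?_, ?_, ?_, ?_, ?_, ?_, ?_, ?_⟩, ?_, ?_, ?_⟩
  · exact hA.modules_finite.sdiff
  · rw [hmod]
    change (if n = A.m₀ then m else A.m₀) ∈ _ ∧ (if n = A.m₀ then m else A.m₀) ≠ n
    split_ifs with h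
    · exact ⟨hm, hne⟩
    · exact ⟨hA.m₀_mem, fun h' => h h'.symm⟩
  · intro i hi
    rw [hmod] at hi
    rw [hμf i hi.2]
    exact hA.μ_mem i hi.1
  · intro a ha
    obtain ⟨i, hi, h⟩ := hA.μ_surj a ha
    by_cases hin : i = n
    · exact ⟨m, (hmod m).2 ⟨hm, hne⟩, by rw [hμf m hne, hμ, ← hin, h]⟩
    · exact ⟨i, (hmod i).2 ⟨hi, hin⟩, by rw [hμf i hin, h]⟩
  · intro i hi
    exact hA.states_finite i ((hmod i).1 hi).1
  · intro i hi j hj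
    exact hA.states_disjoint i ((hmod i).1 hi).1 j ((hmod j).1 hj).1
  · intro i hi
    exact hA.entry_mem i ((hmod i).1 hi).1
  · intro i hi
    exact hA.exits_sub i ((hmod i).1 hi).1
  · intro i hi q c q' h
    rw [hmod] at hi
    obtain ⟨q₀, h, h1⟩ := call_mem_fold.1 h
    obtain ⟨h2, j, hj, h3, rfl⟩ := hA.call_typed i hi.1 _ _ _ h
    refine ⟨h2, ?_⟩
    rcases h1 with ⟨h1, rfl⟩ | ⟨h1, rfl⟩
    · obtain rfl := hA.entry_inj hj hn h1
      exact ⟨m, (hmod m).2 ⟨hm, hne⟩, by rw [hμf m hne, hμ, h3], rfl⟩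
    · have hjn : j ≠ n := fun h' => h1 (h' ▸ rfl)
      exact ⟨j, (hmod j).2 ⟨hj, hjn⟩, by rw [hμf j hjn, h3], rfl⟩
  · intro i hi q τ q' h
    exact hA.int_typed i ((hmod i).1 hi).1 _ _ _ (int_mem_fold.1 h)
  · intro i hi q c p q' h
    rw [hmod] at hi
    rw [hA.ret_mem_fold hf hi.1] at h
    rw [hex, hμf i hi.2]
    rcases h with ⟨hp, h | ⟨rfl, h1, x, h⟩⟩
    · obtain ⟨h1, h2, j, hj, h3, h4⟩ := hA.ret_typed i hi.1 _ _ _ _ h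
      exact ⟨h1, h2, j, (hmod j).2 ⟨hj, fun h' => hp (h' ▸ h3)⟩, h3, h4⟩
    · obtain ⟨-, h2, j, hj, h3, h4⟩ := hA.ret_typed n hn _ _ _ _ h
      exact ⟨h1, by rw [hμ, h2], j, (hmod j).2 ⟨hj, fun h' => hp (h' ▸ h3)⟩, h3, h4⟩
  · intro i hi q c p q' q'' h h'
    rw [hmod] at hi
    rw [hA.ret_mem_fold hf hi.1] at h h'
    -- If `m` and `n` had returns on the same element and popped state, that state would call both
    -- on the same start tag.
    have key : ∀ {x y r r'}, i = m → Trans.ret x c p r ∈ A.trans i →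
        Trans.ret y c p r' ∈ A.trans n → False := by
      rintro x y r r' rfl h1 h2
      obtain ⟨-, -, j, hj, h3, -⟩ := hA.ret_typed _ hm _ _ _ _ h1
      exact hne (hA.entry_inj hm hn (hA.call_det j hj _ _ _ _
        (hA.ret_call _ hm j hj _ _ _ _ h1 h3) (hA.ret_call _ hn j hj _ _ _ _ h2 h3)))
    rcases h with ⟨hp, h | ⟨him, h1, x, h⟩⟩ <;> rcases h' with ⟨-, h' | ⟨him', h1', y, h'⟩⟩
    · exact hA.ret_det i hi.1 _ _ _ _ _ h h'
    · exact (key him' h h').elim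
    · exact (key him h' h).elim
    · have h2 := hA.single_exit n hn x (hA.ret_typed n hn _ _ _ _ h).1 y
        (hA.ret_typed n hn _ _ _ _ h').1 _ _ _ h
      exact hA.ret_det n hn _ _ _ _ _ h2 h'
  · intro i hi x hx y hy c p q' h
    rw [hmod] at hi
    rw [hA.ret_mem_fold hf hi.1] at h ⊢
    refine ⟨h.1, ?_⟩
    rcases h.2 with h | ⟨rfl, h1, z, h⟩
    · exact .inl (hA.single_exit i hi.1 x hx y hy _ _ _ h)
    · exact .inr ⟨rfl, hy, z, h⟩
  · intro i hi q τ τ' q' q'' h h'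
    exact hA.datatype_choice i ((hmod i).1 hi).1 _ _ _ _ _ (int_mem_fold.1 h) (int_mem_fold.1 h')
  · intro i hi j hj q c p q' h hp r τ h'
    rw [hmod] at hi hj
    rw [hA.ret_mem_fold hf hj.1] at h
    rw [int_mem_fold] at h'
    rcases h with ⟨-, h | ⟨-, -, x, h⟩⟩
    · exact hA.datatype_sequence i hi.1 j hj.1 _ _ _ _ h hp _ _ h'
    · exact hA.datatype_sequence i hi.1 n hn _ _ _ _ h hp _ _ h'
  · intro i hi q c q' q'' h h'
    obtain ⟨q₀, h, h1⟩ := call_mem_fold.1 h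
    obtain ⟨q₀', h', h1'⟩ := call_mem_fold.1 h'
    obtain rfl := hA.call_det i ((hmod i).1 hi).1 _ _ _ _ h h'
    rcases h1 with ⟨h1, rfl⟩ | ⟨h1, rfl⟩ <;> rcases h1' with ⟨h1', rfl⟩ | ⟨h1', rfl⟩ <;> trivial
  · intro i hi j hj x c p q' h hp
    rw [hmod] at hi hj
    rw [hA.ret_mem_fold hf hi.1] at h
    rw [call_mem_fold]
    rcases h with ⟨-, h | ⟨rfl, -, y, h⟩⟩
    · exact ⟨_, hA.ret_call i hi.1 j hj.1 _ _ _ _ h hp,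
        .inr ⟨fun h' => hi.2 (hA.entry_inj hi.1 hn h'), rfl⟩⟩
    · exact ⟨_, hA.ret_call n hn j hj.1 _ _ _ _ h hp, .inl ⟨rfl, rfl⟩⟩
  · intro i hi j hj q c h
    rw [hmod] at hi hj
    obtain ⟨q₀, h0, h1⟩ := call_mem_fold.1 h
    have hq : q ∉ A.states n := fun h' =>
      hj.2 (hA.module_unique hj.1 hn (hA.call_typed j hj.1 _ _ _ h0).1 h')
    rcases h1 with ⟨rfl, h1⟩ | ⟨h1, rfl⟩
    · obtain rfl := hA.entry_inj hi.1 hm h1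
      obtain ⟨x, q', h2⟩ := hA.call_ret n hn j hj.1 _ _ h0
      obtain ⟨y, hy⟩ := hex' ⟨x, (hA.ret_typed n hn _ _ _ _ h2).1⟩
      exact ⟨y, q', (hA.ret_mem_fold hf hi.1).2 ⟨hq, .inr ⟨rfl, hy, x, h2⟩⟩⟩
    · obtain ⟨x, q', h2⟩ := hA.call_ret i hi.1 j hj.1 _ _ h0
      exact ⟨x, q', (hA.ret_mem_fold hf hi.1).2 ⟨hq, .inl h2⟩⟩


open Classical in
/-- The effect of folding the module `n` along `φ` on the states of the VPA. -/
noncomputable def foldState (A : DXVPA C S σ T) (n : C) (φ : S → S) : VState S → VState S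
  | .start => .start
  | .final => .final
  | .inner q => .inner (if q ∈ A.states n then φ q else q)

theorem foldState_of_mem {q : S} (h : q ∈ A.states n) :
    foldState A n φ (.inner q) = .inner (φ q) := by simp [foldState, h]

theorem foldState_of_notMem {q : S} (h : q ∉ A.states n) :
    foldState A n φ (.inner q) = .inner q := by simp [foldState, h]

theorem foldState_eq_start {p : VState S} (h : foldState A n φ p = .start) : p = .start := by
  cases p with
  | start => rfl
  | final => cases h
  | inner q => cases h

theorem Coherent.foldState_entry (hA : A.Coherent) (hf : A.Foldable m n φ) {i : C}
    (hi : i ∈ A.modules) (hin : i ≠ n) :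
    foldState A n φ (.inner (A.entry i)) = .inner (A.entry i) :=
  foldState_of_notMem fun h => hin (hA.module_unique hi hf.2.1 (hA.entry_mem i hi) h)

theorem Foldable.foldState_entry_self (hA : A.Coherent) (hf : A.Foldable m n φ) :
    foldState A n φ (.inner (A.entry n)) = .inner (A.entry m) := by
  rw [foldState_of_mem (hA.entry_mem n hf.2.1), hf.2.2.2.2.entry]

theorem mem_fold_modules {i : C} : i ∈ (A.fold m n φ).modules ↔ i ∈ A.modules ∧ i ≠ n := by
  simp [DXVPA.fold]

theorem Foldable.fold_μ_m₀ (hf : A.Foldable m n φ) :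
    (A.fold m n φ).μ (A.fold m n φ).m₀ = A.μ A.m₀ := by
  classical
  simp only [DXVPA.fold]
  split_ifs with h
  · rw [Function.update_of_ne hf.2.2.1, hf.2.2.2.1, h]
  · rw [Function.update_of_ne (Ne.symm h)]

theorem Coherent.foldState_entry_m₀ (hA : A.Coherent) (hf : A.Foldable m n φ) :
    foldState A n φ (.inner (A.entry A.m₀)) =
      .inner ((A.fold m n φ).entry (A.fold m n φ).m₀) := by
  classical
  change _ = VState.inner (A.entry (if n = A.m₀ then m else A.m₀))
  split_ifs with h
  · rw [← h, hf.foldState_entry_self hA]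
  · rw [hA.foldState_entry hf hA.m₀_mem (Ne.symm h)]

/-- Exits of a module and of its image under folding correspond. -/
theorem Coherent.foldState_exit (hA : A.Coherent) (hf : A.Foldable m n φ) {i : C} (hi : i ∈ A.modules)
    {q : S} (hq : q ∈ A.states i) :
    ∃ q', foldState A n φ (.inner q) = .inner q' ∧
      (i = n → (q ∈ A.exits n ↔ q' ∈ A.exits m) ∧ q' = φ q) ∧ (i ≠ n → q' = q) := by
  by_cases h : i = n
  · subst h
    exact ⟨φ q, foldState_of_mem hq, fun _ => ⟨hf.2.2.2.2.exits q hq, rfl⟩, fun h => (h rfl).elim⟩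
  · exact ⟨q, foldState_of_notMem fun h' => h (hA.module_unique hi hf.2.1 hq h'),
      fun h' => (h h').elim, fun _ => rfl⟩

/-- Calls and text moves of `n` are carried to `m` by the isomorphism, and its returns are taken
over by the exits of `m`. Transitions of other modules survive, up to replacing the entry of `n` and
the states of `n` to which they return. -/
theorem Coherent.step_fold (hA : A.Coherent) (hf : A.Foldable m n φ) {c d : VState S × List (VState S)}
    {e : Event σ T} (h : Step A.vpaTrans c e d) :
    Step (A.fold m n φ).vpaTrans (c.map (foldState A n φ) (List.map (foldState A n φ))) e
      (d.map (foldState A n φ) (List.map (foldState A n φ))) := by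
  have hn := hf.2.1
  have hm := hf.1
  cases h with
  | @call _ a _ s h =>
    refine Step.call _ ?_
    rw [call_mem_vpaTrans] at h ⊢
    rcases h with ⟨rfl, h, rfl⟩ | ⟨j, hj, q, q', rfl, rfl, h⟩
    · exact .inl ⟨rfl, hf.fold_μ_m₀ ▸ h, hA.foldState_entry_m₀ hf⟩
    · right
      obtain ⟨hq, i, hi, -, rfl⟩ := hA.call_typed j hj _ _ _ h
      have key : ∃ q', foldState A n φ (.inner (A.entry i)) = .inner q' ∧
          (A.entry i = A.entry n ∧ q' = A.entry m ∨ A.entry i ≠ A.entry n ∧ q' = A.entry i) := by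
        by_cases hin : i = n
        · subst hin
          exact ⟨_, hf.foldState_entry_self hA, .inl ⟨rfl, rfl⟩⟩
        · exact ⟨_, hA.foldState_entry hf hi hin, .inr ⟨fun h => hin (hA.entry_inj hi hn h), rfl⟩⟩
      obtain ⟨q', h1, h2⟩ := key
      by_cases hjn : j = n
      · subst hjn
        exact ⟨m, mem_fold_modules.2 ⟨hm, hf.2.2.1⟩, φ q, q', foldState_of_mem hq, h1,
          call_mem_fold.2 ⟨_, (hA.fold_iso_call hf hq).1 h, h2⟩⟩
      · exact ⟨j, mem_fold_modules.2 ⟨hj, hjn⟩, q, q',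
          foldState_of_notMem fun h' => hjn (hA.module_unique hj hn hq h'), h1,
          call_mem_fold.2 ⟨_, h, h2⟩⟩
  | int s h =>
    refine Step.int _ ?_
    rw [int_mem_vpaTrans] at h ⊢
    obtain ⟨j, hj, q, q', rfl, rfl, h⟩ := h
    obtain ⟨hq, hq'⟩ := hA.int_typed j hj _ _ _ h
    by_cases hjn : j = n
    · subst hjn
      exact ⟨m, mem_fold_modules.2 ⟨hm, hf.2.2.1⟩, φ q, φ q', foldState_of_mem hq,
        foldState_of_mem hq', int_mem_fold.2 ((hf.2.2.2.2.int q hq q' hq' _).1 h)⟩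
    · exact ⟨j, mem_fold_modules.2 ⟨hj, hjn⟩, q, q',
        foldState_of_notMem fun h' => hjn (hA.module_unique hj hn hq h'),
        foldState_of_notMem fun h' => hjn (hA.module_unique hj hn hq' h'), int_mem_fold.2 h⟩
  | @ret _ a _ _ s h =>
    refine Step.ret _ ?_
    rw [ret_mem_vpaTrans] at h ⊢
    rcases h with ⟨q, hq, rfl, rfl, rfl, h⟩ | ⟨i, hi, q, p, q', rfl, rfl, rfl, h⟩
    · left
      obtain ⟨q', h1, h2, h3⟩ := hA.foldState_exit hf hA.m₀_mem (hA.exits_sub _ hA.m₀_mem hq)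
      refine ⟨q', ?_, h1, rfl, rfl, hf.fold_μ_m₀ ▸ h⟩
      classical
      change q' ∈ A.exits (if n = A.m₀ then m else A.m₀)
      split_ifs with hn0
      · exact (h2 hn0.symm).1.1 (hn0 ▸ hq)
      · rwa [h3 (Ne.symm hn0)]
    · right
      obtain ⟨hq, -, j, hj, hp, hq'⟩ := hA.ret_typed i hi _ _ _ _ h
      have key : ∃ r r', foldState A n φ (.inner p) = .inner r ∧
          foldState A n φ (.inner q') = .inner r' ∧ r ∉ A.states n ∧
          Trans.ret q a r r' ∈ A.trans i := by
        by_cases hjn : j = n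
        · subst hjn
          refine ⟨φ p, φ q', foldState_of_mem hp, foldState_of_mem hq', ?_,
            hA.fold_iso_ret hf hi hp h⟩
          exact fun h' => hf.2.2.1 (hA.module_unique hm hn (hf.2.2.2.2.bij.mapsTo hp) h')
        · have h1 : p ∉ A.states n := fun h' => hjn (hA.module_unique hj hn hp h')
          exact ⟨p, q', foldState_of_notMem h1,
            foldState_of_notMem fun h' => hjn (hA.module_unique hj hn hq' h'), h1, h⟩
      obtain ⟨r, r', h1, h2, h3, h4⟩ := key
      obtain ⟨x, h5, h6, h7⟩ := hA.foldState_exit hf hi (hA.exits_sub i hi hq)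
      by_cases hin : i = n
      · subst hin
        exact ⟨m, mem_fold_modules.2 ⟨hm, hf.2.2.1⟩, x, r, r', h5, h1, h2,
          (hA.ret_mem_fold hf hm).2 ⟨h3, .inr ⟨rfl, (h6 rfl).1.1 hq, q, h4⟩⟩⟩
      · obtain rfl := h7 hin
        exact ⟨i, mem_fold_modules.2 ⟨hi, hin⟩, x, r, r', h5, h1, h2,
          (hA.ret_mem_fold hf hi).2 ⟨h3, .inl h4⟩⟩

theorem Coherent.run_fold (hA : A.Coherent) (hf : A.Foldable m n φ) {c d : VState S × List (VState S)}
    {x : TypedStream σ T} (h : Run A.vpaTrans c x d) :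
    Run (A.fold m n φ).vpaTrans (c.map (foldState A n φ) (List.map (foldState A n φ))) x
      (d.map (foldState A n φ) (List.map (foldState A n φ))) := by
  induction h with
  | nil c => exact .nil _
  | cons h _ ih => exact .cons (hA.step_fold hf h) ih

/-- Configurations whose stack is compatible with the calls of the automaton. -/
inductive Nested (A : DXVPA C S σ T) : VState S → List (VState S) → Prop
  | start : Nested A .start []
  | final : Nested A .final []
  | root {q : S} : q ∈ A.states A.m₀ → Nested A (.inner q) [.start]
  | nest {i j : C} {p q : S} {c : σ} {z : List (VState S)} : i ∈ A.modules → j ∈ A.modules →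
      p ∈ A.states j → Trans.call p c (A.entry i) ∈ A.trans j → q ∈ A.states i →
      Nested A (.inner p) z → Nested A (.inner q) (.inner p :: z)

theorem Nested.replace {A : DXVPA C S σ T} (hA : A.Valid) {i : C} (hi : i ∈ A.modules) {q q' : S}
    {z : List (VState S)} (h : Nested A (.inner q) z) (hq : q ∈ A.states i)
    (hq' : q' ∈ A.states i) : Nested A (.inner q') z := by
  cases h with
  | root h =>
    obtain rfl := hA.module_unique hi hA.m₀_mem hq h
    exact .root hq'
  | nest hj hj' hp hc h hn =>
    obtain rfl := hA.module_unique hi hj hq h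
    exact .nest hi hj' hp hc hq' hn

theorem Coherent.nested_step (hA : A.Coherent) {c d : VState S × List (VState S)}
    {e : Event σ T} (hc : Nested A c.1 c.2) (h : Step A.vpaTrans c e d) : Nested A d.1 d.2 := by
  cases h with
  | call s h =>
    rw [call_mem_vpaTrans] at h
    rcases h with ⟨rfl, h, rfl⟩ | ⟨j, hj, q, q', rfl, rfl, h⟩
    · cases hc
      exact .root (hA.entry_mem _ hA.m₀_mem)
    · obtain ⟨hq, i, hi, -, rfl⟩ := hA.call_typed j hj _ _ _ h
      exact .nest hi hj hq h (hA.entry_mem i hi) hc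
  | int s h =>
    rw [int_mem_vpaTrans] at h
    obtain ⟨j, hj, q, q', rfl, rfl, h⟩ := h
    obtain ⟨hq, hq'⟩ := hA.int_typed j hj _ _ _ h
    exact hc.replace hA.toValid hj hq hq'
  | ret s h =>
    rw [ret_mem_vpaTrans] at h
    rcases h with ⟨q, hq, rfl, rfl, rfl, h⟩ | ⟨i, hi, q, p, q', rfl, rfl, rfl, h⟩
    · cases hc
      exact .final
    · obtain ⟨-, -, j, hj, hp, hq'⟩ := hA.ret_typed i hi _ _ _ _ h
      cases hc with
      | nest _ _ _ _ _ hn => exact hn.replace hA.toValid hj hp hq'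

theorem Foldable.exit_of_foldState (hA : A.Coherent) (hf : A.Foldable m n φ) {i i' : C}
    (hi : i ∈ A.modules) (hi' : i' ∈ A.modules) (hin : i' ≠ n) {q q' : S} (hq : q ∈ A.states i)
    (h : foldState A n φ (.inner q) = .inner q') (hq' : q' ∈ A.exits i') :
    q ∈ A.exits i ∧ A.μ i = A.μ i' ∧ (i = i' ∨ i = n ∧ i' = m) := by
  have h1 := hA.exits_sub i' hi' hq'
  by_cases hi2 : i = n
  · subst hi2
    rw [foldState_of_mem hq] at h
    cases h
    obtain rfl := hA.module_unique hi' hf.1 h1 (hf.2.2.2.2.bij.mapsTo hq)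
    exact ⟨(hf.2.2.2.2.exits q hq).2 hq', hf.2.2.2.1.symm, .inr ⟨rfl, rfl⟩⟩
  · rw [foldState_of_notMem fun h' => hi2 (hA.module_unique hi hf.2.1 hq h')] at h
    cases h
    obtain rfl := hA.module_unique hi' hi h1 hq
    exact ⟨hq', rfl, .inl rfl⟩

/-- The folded automaton simulates `A` and is deterministic, so it suffices that `A` can move at all
on `e`. For end tags `Nested` is essential: the current module was called from the state on top of
the stack, hence has a return popping it, which the single-exit property moves to the current exit.
-/
theorem Coherent.step_of_fold (hA : A.Coherent) (hf : A.Foldable m n φ)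
    {c d : VState S × List (VState S)} {e : Event σ T} (hc : Nested A c.1 c.2)
    (h : Step (A.fold m n φ).vpaTrans (c.map (foldState A n φ) (List.map (foldState A n φ))) e d) :
    ∃ c', Step A.vpaTrans c e c' ∧ c'.map (foldState A n φ) (List.map (foldState A n φ)) = d := by
  suffices h' : ∃ c', Step A.vpaTrans c e c' by
    obtain ⟨c', hc'⟩ := h'
    refine ⟨c', hc', (hA.fold hf).step_unique ?_ (hA.step_fold hf hc') h⟩
    cases e <;> constructor
    trivial
  have hn := hf.2.1
  have hm := hf.1
  obtain ⟨q, z⟩ := c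
  generalize hc2 : Prod.map (foldState A n φ) (List.map (foldState A n φ)) (q, z) = c₂ at h
  cases h with
  | @call q₂ a q₂' s h =>
    simp only [Prod.map_apply, Prod.mk.injEq] at hc2
    obtain ⟨hq2, -⟩ := hc2
    rw [call_mem_vpaTrans] at h
    rcases h with ⟨rfl, h, -⟩ | ⟨j, hj, r, r', rfl, -, h⟩
    · obtain rfl := foldState_eq_start hq2
      exact ⟨_, .call _ (call_mem_vpaTrans.2 (.inl ⟨rfl, hf.fold_μ_m₀ ▸ h, rfl⟩))⟩
    · rw [mem_fold_modules] at hj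
      obtain ⟨r₀, h0, -⟩ := call_mem_fold.1 h
      have hr := (hA.call_typed j hj.1 _ _ _ h0).1
      cases q with
      | start => cases hq2
      | final => cases hq2
      | inner q =>
        by_cases hq : q ∈ A.states n
        · rw [foldState_of_mem hq] at hq2
          cases hq2
          obtain rfl := hA.module_unique hj.1 hm hr (hf.2.2.2.2.bij.mapsTo hq)
          exact ⟨_, .call _ (call_mem_vpaTrans.2 (.inr ⟨n, hn, _, _, rfl, rfl,
            (hA.fold_iso_call hf hq).2 h0⟩))⟩
        · rw [foldState_of_notMem hq] at hq2
          cases hq2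
          exact ⟨_, .call _ (call_mem_vpaTrans.2 (.inr ⟨j, hj.1, _, _, rfl, rfl, h0⟩))⟩
  | @int q₂ τ q₂' s h =>
    simp only [Prod.map_apply, Prod.mk.injEq] at hc2
    obtain ⟨hq2, -⟩ := hc2
    rw [int_mem_vpaTrans] at h
    obtain ⟨j, hj, r, r', rfl, -, h⟩ := h
    rw [mem_fold_modules] at hj
    rw [int_mem_fold] at h
    obtain ⟨hr, hr'⟩ := hA.int_typed j hj.1 _ _ _ h
    cases q with
    | start => cases hq2
    | final => cases hq2
    | inner q =>
      by_cases hq : q ∈ A.states n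
      · rw [foldState_of_mem hq] at hq2
        cases hq2
        obtain rfl := hA.module_unique hj.1 hm hr (hf.2.2.2.2.bij.mapsTo hq)
        obtain ⟨r'', hr'', rfl⟩ := hf.2.2.2.2.bij.surjOn hr'
        exact ⟨_, .int _ (int_mem_vpaTrans.2 ⟨n, hn, _, _, rfl, rfl,
          (hf.2.2.2.2.int q hq _ hr'' _).2 h⟩)⟩
      · rw [foldState_of_notMem hq] at hq2
        cases hq2
        exact ⟨_, .int _ (int_mem_vpaTrans.2 ⟨j, hj.1, _, _, rfl, rfl, h⟩)⟩
  | @ret q₂ a p₂ q₂' s h =>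
    simp only [Prod.map_apply, Prod.mk.injEq] at hc2
    obtain ⟨hq2, hz⟩ := hc2
    rw [ret_mem_vpaTrans] at h
    cases hc with
    | start => simp at hz
    | final => simp at hz
    | @root q hq =>
      rcases h with ⟨r, hr, rfl, rfl, rfl, h⟩ | ⟨i, hi, r, p, r', rfl, rfl, rfl, h⟩
      · have hm0 := (hA.fold hf).m₀_mem
        rw [mem_fold_modules] at hm0
        have := (hf.exit_of_foldState hA hA.m₀_mem hm0.1 hm0.2 hq hq2 hr).1
        exact ⟨_, .ret _ (ret_mem_vpaTrans.2 (.inl ⟨q, this, rfl, rfl, rfl, hf.fold_μ_m₀ ▸ h⟩))⟩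
      · simp [foldState] at hz
    | @nest i j p q b z hi hj hp hcall hq _ =>
      rcases h with ⟨r, hr, rfl, rfl, rfl, h⟩ | ⟨i', hi', r, p', r', rfl, rfl, rfl, h⟩
      · simp [foldState] at hz
      · obtain ⟨hr, hμ, -⟩ := (hA.fold hf).ret_typed i' hi' _ _ _ _ h
        rw [mem_fold_modules] at hi'
        change r ∈ A.exits i' at hr
        have hμ' : A.μ i' = some a := by
          classical
          simpa [DXVPA.fold, Function.update_of_ne hi'.2] using hμ
        obtain ⟨hq', h1, -⟩ := hf.exit_of_foldState hA hi hi'.1 hi'.2 hq hq2 hr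
        obtain ⟨x, q', hx⟩ := hA.call_ret i hi j hj _ _ hcall
        obtain ⟨h2, h3, -⟩ := hA.ret_typed i hi _ _ _ _ hx
        rw [h1, hμ'] at h3
        cases h3
        exact ⟨_, .ret _ (ret_mem_vpaTrans.2 (.inr ⟨i, hi, _, _, _, rfl, rfl, rfl,
          hA.single_exit i hi x h2 q hq' _ _ _ hx⟩))⟩

theorem Coherent.run_of_fold (hA : A.Coherent) (hf : A.Foldable m n φ)
    {c d : VState S × List (VState S)} {x : TypedStream σ T} (hc : Nested A c.1 c.2)
    (h : Run (A.fold m n φ).vpaTrans (c.map (foldState A n φ) (List.map (foldState A n φ))) x d) :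
    ∃ c', Run A.vpaTrans c x c' ∧ c'.map (foldState A n φ) (List.map (foldState A n φ)) = d := by
  induction x generalizing c with
  | nil => cases h; exact ⟨c, .nil _, rfl⟩
  | cons e x ih =>
    cases h with
    | cons h1 h2 =>
      obtain ⟨c', hs, rfl⟩ := hA.step_of_fold hf hc h1
      obtain ⟨c'', hr, rfl⟩ := ih (hA.nested_step hc hs) h2
      exact ⟨c'', .cons hs hr, rfl⟩

theorem Coherent.language_fold (hA : A.Coherent) (hf : A.Foldable m n φ) :
    (A.fold m n φ).language = A.language := by
  ext x
  constructor
  · intro h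
    obtain ⟨⟨q, z⟩, h1, h2⟩ := hA.run_of_fold hf (c := (.start, [])) .start h
    simp only [Prod.map_apply, Prod.mk.injEq, List.map_eq_nil_iff] at h2
    obtain ⟨h2, rfl⟩ := h2
    -- Only `.final` is mapped to `.final`.
    cases q <;> cases h2
    exact h1
  · intro h
    exact hA.run_fold hf h

end Fold

theorem Coherent.minimize {A : DXVPA C S σ T} (hA : A.Coherent)
    (sel : DXVPA C S σ T → C × C × (S → S)) :
    (A.minimize sel).Coherent ∧ (A.minimize sel).language = A.language := by
  suffices h : ∀ i, ((foldStep sel)^[i] A).Coherent ∧ ((foldStep sel)^[i] A).language = A.language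
    from h _
  intro i
  induction i with
  | zero => exact ⟨hA, rfl⟩
  | succ i ih =>
    rw [Function.iterate_succ_apply']
    unfold foldStep
    split_ifs with hf
    · exact ⟨ih.1.fold hf, (ih.1.language_fold hf).trans ih.2⟩
    · exact ih

end DXVPA
end XMLLearner

namespace XMLLearner

/-! ### Named states: what a context remembers, finiteness, and configurations along a stream. -/

section Naming

variable {σ : Type u} {s : Scheme} {k l : ℕ} {α : Type*}

theorem rtake_concat {β : Type*} {n : ℕ} (hn : 1 ≤ n) (z : List β) (x : β) :
    (z ++ [x]).rtake n = z.rtake (n - 1) ++ [x] := by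
  obtain ⟨n, rfl⟩ := Nat.exists_eq_add_of_le' hn
  rw [List.rtake_concat_succ, Nat.add_sub_cancel]

theorem length_rtake_le {β : Type*} (n : ℕ) (z : List β) : (z.rtake n).length ≤ n := by
  rw [List.rtake, List.length_drop]
  omega

theorem mem_of_mem_rtake {β : Type*} {n : ℕ} {z : List β} {x : β} (h : x ∈ z.rtake n) : x ∈ z :=
  List.mem_of_mem_drop h

/-- With `l ≥ 1` the last ancestor survives truncation; the other scheme always appends a block
after truncating. -/
theorem Ctx.extend_ne_empty (hl : s = Scheme.ancestor → 1 ≤ l) (r : Ctx s σ)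
    (z : List (Option σ)) (a : σ) : Ctx.extend k l s r z a ≠ Ctx.empty s := by
  cases s with
  | ancestor =>
    have h : ∀ r : List σ, (r ++ [a]).rtake l ≠ [] := fun r => by
      rw [rtake_concat (hl rfl)]
      exact List.append_ne_nil_of_right_ne_nil _ (by simp)
    exact h r
  | ancestorSibling =>
    exact List.append_ne_nil_of_right_ne_nil _ (by simp)

/-- The innermost element is the last symbol of the context or, thanks to `k ≥ 1`, of its last
block. -/
theorem Ctx.extend_inj (hk : 1 ≤ k) (hl : s = Scheme.ancestor → 1 ≤ l) {r r' : Ctx s σ}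
    {z z' : List (Option σ)} {a a' : σ} (h : Ctx.extend k l s r z a = Ctx.extend k l s r' z' a') :
    a = a' := by
  cases s with
  | ancestor =>
    have h' : ∀ r r' : List σ, (r ++ [a]).rtake l = (r' ++ [a']).rtake l → a = a' := by
      intro r r' h
      rw [rtake_concat (hl rfl), rtake_concat (hl rfl)] at h
      simpa using (List.append_inj' h rfl).2
    exact h' r r' h
  | ancestorSibling =>
    simp only [Ctx.extend] at h
    have h := (List.append_inj' h rfl).2
    rw [List.singleton_inj, rtake_concat hk, rtake_concat hk] at h
    simpa using (List.append_inj' h rfl).2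

/-- The sets of lists of bounded length over a finite set are finite. -/
theorem finite_lists {β : Type*} {F : Set β} (hF : F.Finite) (n : ℕ) :
    {z : List β | z.length ≤ n ∧ ∀ x ∈ z, x ∈ F}.Finite := by
  have := hF.to_subtype
  refine ((List.finite_length_le F n).image (List.map Subtype.val)).subset ?_
  rintro z ⟨hz, hz'⟩
  refine ⟨z.pmap Subtype.mk hz', ?_, ?_⟩
  · simpa using hz
  · simp [List.map_pmap]

/-- Over finitely many element names there are finitely many named states. -/
theorem exists_finite_namedStates (s : Scheme) (k l : ℕ) {F : Set σ} (hF : F.Finite) :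
    ∃ B : Set (NState s σ), B.Finite ∧ initState s ∈ B ∧
      (∀ q ∈ B, ∀ a ∈ F, callName k l q a ∈ B) ∧ (∀ q ∈ B, intName k q ∈ B) ∧
      ∀ p ∈ B, ∀ q, ∀ a ∈ F, retName k q p a ∈ B := by
  have hZ := finite_lists ((hF.image some).insert none) k
  set Z := {z : List (Option σ) | z.length ≤ k ∧ ∀ x ∈ z, x ∈ insert none (some '' F)} with hZdef
  have hsib : ∀ z ∈ Z, ∀ x ∈ insert none (some '' F), (z ++ [x]).rtake k ∈ Z := by
    intro z hz x hx
    refine ⟨length_rtake_le _ _, fun y hy => ?_⟩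
    rcases List.mem_append.1 (mem_of_mem_rtake hy) with h | h
    · exact hz.2 y h
    · rw [List.mem_singleton.1 h]
      exact hx
  have hnil : [] ∈ Z := by simp [hZdef]
  have key : ∃ U : Set (Ctx s σ), U.Finite ∧ Ctx.empty s ∈ U ∧
      ∀ r ∈ U, ∀ z ∈ Z, ∀ a ∈ F, Ctx.extend k l s r z a ∈ U := by
    cases s with
    | ancestor =>
      refine ⟨_, finite_lists hF l, ⟨Nat.zero_le _, fun _ h => absurd h List.not_mem_nil⟩, ?_⟩
      rintro r ⟨-, hr⟩ z - a ha
      refine ⟨length_rtake_le _ _, fun y hy => ?_⟩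
      rcases List.mem_append.1 (mem_of_mem_rtake hy) with h | h
      · exact hr y h
      · rw [List.mem_singleton.1 h]
        exact ha
    | ancestorSibling =>
      -- An ancestor-sibling context keeps `l` blocks and then appends one more.
      refine ⟨_, finite_lists hZ (l + 1),
        ⟨Nat.zero_le _, fun _ h => absurd h List.not_mem_nil⟩, ?_⟩
      rintro r ⟨-, hr⟩ z hz a ha
      refine ⟨?_, fun y hy => ?_⟩
      · simpa [Ctx.extend] using length_rtake_le l r
      · rcases List.mem_append.1 hy with h | h
        · exact hr y (mem_of_mem_rtake h)
        · rw [List.mem_singleton.1 h]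
          exact hsib z hz _ (.inr ⟨a, ha, rfl⟩)
  obtain ⟨U, hU, hU0, hU1⟩ := key
  exact ⟨U ×ˢ Z, hU.prod hZ, ⟨hU0, hnil⟩, fun q hq a ha => ⟨hU1 _ hq.1 _ hq.2 a ha, hnil⟩,
    fun q hq => ⟨hq.1, hsib _ hq.2 _ (.inl rfl)⟩,
    fun p hp q a ha => ⟨hp.1, hsib _ hp.2 _ (.inr ⟨a, ha, rfl⟩)⟩⟩

@[simp] theorem nextConfig_startElement (q : NState s σ) (z : List (NState s σ)) (a : σ) :
    nextConfig k l (q, z) (Event.startElement a : Event σ α) = (callName k l q a, q :: z) := by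
  cases z <;> rfl

@[simp] theorem nextConfig_characters (q : NState s σ) (z : List (NState s σ)) (x : α) :
    nextConfig k l (q, z) (Event.characters x : Event σ α) = (intName k q, z) := by
  cases z <;> rfl

@[simp] theorem nextConfig_endElement (q p : NState s σ) (z : List (NState s σ)) (a : σ) :
    nextConfig k l (q, p :: z) (Event.endElement a : Event σ α) = (retName k q p a, z) := rfl

/-- Names ignore the values of text events, so a document, its datatyped forms and the streams
subsuming them visit the same configurations. -/
theorem foldl_nextConfig_forall₂ {β : Type*} {r : α → β → Prop} {x : List (Event σ α)}
    {y : List (Event σ β)} (h : List.Forall₂ (Event.Rel r) x y)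
    (c : NState s σ × List (NState s σ)) :
    x.foldl (nextConfig k l) c = y.foldl (nextConfig k l) c := by
  induction h generalizing c with
  | nil => rfl
  | cons h _ ih =>
    obtain ⟨q, z⟩ := c
    rw [List.foldl_cons, List.foldl_cons, ih]
    congr 1
    cases h
    · simp
    · cases z <;> rfl
    · simp

/-- Reading a forest changes neither the typing context nor the stack. -/
theorem IsForest.foldl_nextConfig {x : List (Event σ α)} (h : IsForest x) (q : NState s σ)
    (z : List (NState s σ)) :
    ∃ q', x.foldl (nextConfig k l) (q, z) = (q', z) ∧ q'.1 = q.1 := by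
  induction h generalizing q z with
  | nil => exact ⟨q, rfl, rfl⟩
  | characters t y _ ih =>
    rw [List.foldl_cons, nextConfig_characters]
    exact ih (intName k q) z
  | element a x y _ _ ihx ihy =>
    rw [List.foldl_cons, nextConfig_startElement, List.foldl_append, List.foldl_cons]
    obtain ⟨q', h1, -⟩ := ihx (callName k l q a) (q :: z)
    rw [h1, nextConfig_endElement]
    exact ihy (retName k q' q a) z

end Naming

/-! ### Streams that close a list of open elements. -/

section Closing

variable {σ : Type u} {α : Type v}

/-- The stream closes the given open elements (innermost first) and nothing else. -/
def Closes : List σ → List (Event σ α) → Prop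
  | [], y => y = []
  | c :: cs, y => ∃ x y', IsForest x ∧ y = x ++ Event.endElement c :: y' ∧ Closes cs y'

/-- The forest before the end tag of `c` begins with an element `a`; its content is split off, and
the rest of the forest still precedes that end tag. -/
theorem Closes.of_startElement {c a : σ} {cs : List σ} {y : List (Event σ α)}
    (h : Closes (c :: cs) (Event.startElement a :: y)) :
    ∃ x y', IsForest x ∧ y = x ++ Event.endElement a :: y' ∧ Closes (c :: cs) y' := by
  obtain ⟨x, y', hx, h, hy⟩ := h
  cases hx with
  | nil => simp at h
  | characters => simp at h
  | element b x₁ x₂ h1 h2 =>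
    simp only [List.cons_append, List.cons.injEq, Event.startElement.injEq] at h
    obtain ⟨rfl, rfl⟩ := h
    exact ⟨x₁, x₂ ++ Event.endElement c :: y', h1, by simp, x₂, y', h2, rfl, hy⟩

theorem Closes.of_characters {c : σ} {t : α} {cs : List σ} {y : List (Event σ α)}
    (h : Closes (c :: cs) (Event.characters t :: y)) : Closes (c :: cs) y := by
  obtain ⟨x, y', hx, h, hy⟩ := h
  cases hx with
  | nil => simp at h
  | element => simp at h
  | characters t' x hx =>
    simp only [List.cons_append, List.cons.injEq] at h
    exact ⟨x, y', hx, h.2, hy⟩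

theorem Closes.of_endElement {c b : σ} {cs : List σ} {y : List (Event σ α)}
    (h : Closes (c :: cs) (Event.endElement b :: y)) : b = c ∧ Closes cs y := by
  obtain ⟨x, y', hx, h, hy⟩ := h
  cases hx with
  | nil =>
    simp only [List.nil_append, List.cons.injEq, Event.endElement.injEq] at h
    obtain ⟨rfl, rfl⟩ := h
    exact ⟨rfl, hy⟩
  | element => simp at h
  | characters => simp at h

theorem Closes.startElement {c a : σ} {cs : List σ} {y : List (Event σ α)}
    (h : Closes (a :: c :: cs) y) : Closes (c :: cs) (Event.startElement a :: y) := by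
  obtain ⟨x, y', hx, rfl, x', y'', hx', rfl, h⟩ := h
  exact ⟨_, y'', .element a x x' hx hx', by simp, h⟩

theorem Closes.characters {c : σ} {t : α} {cs : List σ} {y : List (Event σ α)}
    (h : Closes (c :: cs) y) : Closes (c :: cs) (Event.characters t :: y) := by
  obtain ⟨x, y', hx, rfl, h⟩ := h
  exact ⟨_, y', .characters t x hx, rfl, h⟩

theorem Closes.endElement {c : σ} {cs : List σ} {y : List (Event σ α)}
    (h : Closes cs y) : Closes (c :: cs) (Event.endElement c :: y) :=
  ⟨[], y, .nil, rfl, h⟩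

theorem IsForest.startElement_mem_of_endElement_mem {x : List (Event σ α)} (h : IsForest x) {a : σ}
    (ha : Event.endElement a ∈ x) : Event.startElement a ∈ x := by
  induction h with
  | nil => simp at ha
  | characters t y _ ih => simp at ha ⊢; exact ih ha
  | element b x y _ _ ihx ihy =>
    simp only [List.mem_cons, List.mem_append, reduceCtorEq, false_or, Event.endElement.injEq,
      Event.startElement.injEq] at ha ⊢
    rcases ha with h | h | h
    · exact .inr (.inl (ihx h))
    · exact .inl h
    · exact .inr (.inr (ihy h))

theorem IsDocument.startElement_mem_of_endElement_mem {r : σ} {w : Stream σ} (h : IsDocument r w)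
    {a : σ} (ha : Event.endElement a ∈ w) : Event.startElement a ∈ w := by
  obtain ⟨⟨x, hx, rfl⟩, -⟩ := h
  have : IsForest (Event.startElement r :: (x ++ Event.endElement r :: [])) :=
    .element r x [] hx .nil
  exact this.startElement_mem_of_endElement_mem ha

end Closing

/-! ### Facts that occur in a set of documents, and the configurations inside documents. -/

section Occurrences

variable {σ : Type u} (s : Scheme) (k l : ℕ) (L : Set (Stream σ))

/-- In some document of `L`, an end tag of `c` occurs at the named state `r` and pops `p`. -/
def PopsAt (r : NState s σ) (c : σ) (p : NState s σ) : Prop :=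
  ∃ x y z, x ++ Event.endElement c :: y ∈ L ∧
    x.foldl (nextConfig k l) (initState s, []) = (r, p :: z)

/-- The named states reached after at least one event in a document of `L`. -/
def visited : Set (NState s σ) :=
  {q | ∃ x e y, x ++ e :: y ∈ L ∧ stateAfter s k l (x ++ [e]) = q}

/-- The datatypes inferred from the texts that occur in `L` at the named state `q`. -/
def inferredAt {T K : Type*} [PartialOrder K] (dts : DatatypeSystem T K) (q : NState s σ) : Set T :=
  {τ | ∃ t, OccursAt s k l L q (.characters t) ∧ τ ∈ dts.minReq t}

/-- Inside the root element `a`: `os` are the open elements, `q` is the named state and `z` the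
stack, such that start tags of `L` lead to these contexts. -/
inductive Linked (a : σ) : List σ → NState s σ → List (NState s σ) → Prop
  | root {q : NState s σ} : OccursAt s k l L (initState s) (.startElement a) →
      q.1 = (callName k l (initState s) a).1 → Linked a [a] q [initState s]
  | nest {os : List σ} {p : NState s σ} {z : List (NState s σ)} {c : σ} {q : NState s σ} :
      Linked a os p z → OccursAt s k l L p (.startElement c) → q.1 = (callName k l p c).1 →
      Linked a (c :: os) q (p :: z)

variable {s k l L} {a : σ} {os : List σ} {q : NState s σ} {z : List (NState s σ)}

theorem Linked.congr (h : Linked s k l L a os q z) {q' : NState s σ} (hq : q'.1 = q.1) :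
    Linked s k l L a os q' z := by
  cases h with
  | root h h' => exact .root h (hq.trans h')
  | nest h h' h'' => exact .nest h h' (hq.trans h'')

theorem Linked.startElement (h : Linked s k l L a os q z) {b : σ}
    (hb : OccursAt s k l L q (.startElement b)) :
    Linked s k l L a (b :: os) (callName k l q b) (q :: z) :=
  .nest h hb rfl

theorem Linked.exists_cons (h : Linked s k l L a os q z) :
    ∃ c os' p z', os = c :: os' ∧ z = p :: z' ∧ q.1 = (callName k l p c).1 ∧
      OccursAt s k l L p (.startElement c) ∧
      ((os' = [] ∧ p = initState s ∧ z' = [] ∧ c = a) ∨ Linked s k l L a os' p z') := by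
  cases h with
  | root h h' => exact ⟨_, _, _, _, rfl, rfl, h', h, .inl ⟨rfl, rfl, rfl, rfl⟩⟩
  | nest h h' h'' => exact ⟨_, _, _, _, rfl, rfl, h'', h', .inr h⟩

theorem Linked.ne_empty (hl : s = Scheme.ancestor → 1 ≤ l)
    (h : Linked s k l L a os q z) : q.1 ≠ Ctx.empty s := by
  obtain ⟨c, os', p, z', -, -, h, -⟩ := h.exists_cons
  rw [h]
  exact Ctx.extend_ne_empty hl _ _ _

/-- The configurations inside a document of `L`. -/
theorem IsDocument.prefix_config {w : Stream σ} (hw : w ∈ L) (hd : IsDocument a w)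
    {x y : Stream σ} (hxy : w = x ++ y) (hx : x ≠ []) :
    ∃ os q z, x.foldl (nextConfig k l) (initState s, []) = (q, z) ∧ Closes os y ∧
      ((os = [] ∧ z = [] ∧ ∃ r, q = retName k r (initState s) a) ∨ Linked s k l L a os q z) := by
  induction x using List.reverseRecOn generalizing y with
  | nil => exact (hx rfl).elim
  | append_singleton x e ih =>
    rw [List.append_assoc, List.singleton_append] at hxy
    rw [List.foldl_append, List.foldl_cons, List.foldl_nil]
    by_cases hx0 : x = []
    · subst hx0
      obtain ⟨⟨v, hv, hwv⟩, -⟩ := hd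
      rw [hwv] at hxy
      simp only [List.nil_append, List.cons.injEq] at hxy
      obtain ⟨rfl, rfl⟩ := hxy
      refine ⟨[a], _, _, nextConfig_startElement _ _ _, ⟨v, [], hv, rfl, rfl⟩, .inr (.root ?_ rfl)⟩
      exact ⟨[], v ++ [.endElement a], hwv ▸ hw, rfl⟩
    · obtain ⟨os, q, z, h1, h2, h3⟩ := ih hxy hx0
      rw [h1]
      -- Nothing can follow once the root element is closed.
      rcases h3 with ⟨rfl, -⟩ | h3
      · cases h2
      obtain ⟨c, os', p, z', rfl, rfl, h4, h5, h6⟩ := h3.exists_cons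
      cases e with
      | startElement b =>
        obtain ⟨x', y', hx', rfl, hy'⟩ := h2.of_startElement
        have h7 : Closes (b :: c :: os') (x' ++ Event.endElement b :: y') := ⟨x', y', hx', rfl, hy'⟩
        refine ⟨_, _, _, nextConfig_startElement _ _ _, h7, .inr (h3.startElement ⟨x, _, hxy ▸ hw, ?_⟩)⟩
        rw [stateAfter, h1]
      | endElement b =>
        obtain ⟨rfl, h7⟩ := h2.of_endElement
        refine ⟨_, _, _, nextConfig_endElement _ _ _ _, h7, ?_⟩
        rcases h6 with ⟨rfl, rfl, rfl, rfl⟩ | h6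
        · exact .inl ⟨rfl, rfl, q, rfl⟩
        · exact .inr (h6.congr rfl)
      | characters t =>
        exact ⟨c :: os', _, _, nextConfig_characters _ _ _, h2.of_characters, .inr (h3.congr rfl)⟩

/-- The event still to be read rules out the case of `prefix_config` in which the root is already
closed. -/
theorem IsDocument.event_config {w : Stream σ} (hw : w ∈ L) (hd : IsDocument a w)
    {x y : Stream σ} {e : Event σ Text} (hxy : w = x ++ e :: y) :
    (x = [] ∧ e = .startElement a) ∨ (x ≠ [] ∧
      ∃ os q z, x.foldl (nextConfig k l) (initState s, []) = (q, z) ∧ Closes os (e :: y) ∧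
        Linked s k l L a os q z) := by
  by_cases hx : x = []
  · subst hx
    obtain ⟨⟨v, hv, hwv⟩, -⟩ := hd
    rw [hwv] at hxy
    simp only [List.nil_append, List.cons.injEq] at hxy
    exact .inl ⟨rfl, hxy.1.symm⟩
  · obtain ⟨os, q, z, h1, h2, h3⟩ := hd.prefix_config (s := s) (k := k) (l := l) hw hxy hx
    rcases h3 with ⟨rfl, -⟩ | h3
    · cases h2
    · exact .inr ⟨hx, os, q, z, h1, h2, h3⟩

theorem mem_visited_of_ne_nil {x : Stream σ} {y : Stream σ} (h : x ++ y ∈ L) (hx : x ≠ []) :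
    stateAfter s k l x ∈ visited s k l L := by
  induction x using List.reverseRecOn with
  | nil => exact (hx rfl).elim
  | append_singleton x e _ => exact ⟨x, e, y, by simpa using h, rfl⟩

/-- Every event after the root start tag occurs inside the root, where contexts are nonempty; the
start state is thus never met again. -/
theorem OccursAt.cases_init (hl : s = Scheme.ancestor → 1 ≤ l)
    (hL : ∀ w ∈ L, IsDocument a w) {e : Event σ Text}
    (h : OccursAt s k l L q e) :
    (q = initState s ∧ e = .startElement a) ∨
      (q.1 ≠ Ctx.empty s ∧ q ∈ visited s k l L ∧ ∃ os z, Linked s k l L a os q z) := by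
  obtain ⟨x, y, hw, rfl⟩ := h
  rcases (hL _ hw).event_config (s := s) (k := k) (l := l) hw rfl with
    ⟨rfl, he⟩ | ⟨hx, os, q, z, h1, -, h3⟩
  · exact .inl ⟨rfl, he⟩
  · refine .inr ⟨?_, mem_visited_of_ne_nil hw hx, os, z, ?_⟩ <;> rw [stateAfter, h1]
    · exact h3.ne_empty hl
    · exact h3

/-- Inside a document the popped state is the one whose start tag created the current context, and
well-nestedness gives both tags the same name. -/
theorem PopsAt.spec (hL : ∀ w ∈ L, IsDocument a w) {r p : NState s σ} {c : σ}
    (h : PopsAt s k l L r c p) :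
    r.1 = (callName k l p c).1 ∧ r ∈ visited s k l L ∧ retName k r p c ∈ visited s k l L ∧
      OccursAt s k l L r (.endElement c) ∧ OccursAt s k l L p (.startElement c) := by
  obtain ⟨x, y, z, hw, hx⟩ := h
  rcases (hL _ hw).event_config (s := s) (k := k) (l := l) hw rfl with
    ⟨rfl, he⟩ | ⟨hx0, os, q, z', h1, h2, h3⟩
  · cases he
  · rw [hx] at h1
    cases h1
    obtain ⟨c', os', p', z', rfl, h4, h5, h6, -⟩ := h3.exists_cons
    cases h4
    obtain ⟨rfl, -⟩ := h2.of_endElement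
    have hr : stateAfter s k l x = r := by rw [stateAfter, hx]
    refine ⟨h5, hr ▸ mem_visited_of_ne_nil hw hx0, ⟨x, _, y, hw, ?_⟩, ⟨x, y, hw, hr⟩, h6⟩
    rw [stateAfter, List.foldl_append, hx, List.foldl_cons, nextConfig_endElement, List.foldl_nil]

/-- The content up to the matching end tag is a forest and leaves the stack as it was, so that end
tag pops the state saved by the start tag. This is the source of `call_ret`. -/
theorem OccursAt.startElement_pops (hL : ∀ w ∈ L, IsDocument a w) {c : σ}
    (h : OccursAt s k l L q (.startElement c)) :
    ∃ r, PopsAt s k l L r c q := by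
  obtain ⟨x, y, hw, rfl⟩ := h
  have key : ∀ v y', y = v ++ Event.endElement c :: y' → IsForest v →
      ∃ r, PopsAt s k l L r c (stateAfter s k l x) := by
    rintro v y' rfl hv
    obtain ⟨r, hr, -⟩ := hv.foldl_nextConfig (k := k) (l := l)
      (callName k l (stateAfter s k l x) c)
      (stateAfter s k l x :: (x.foldl (nextConfig k l) (initState s, [])).2)
    refine ⟨r, x ++ Event.startElement c :: v, y',
      (x.foldl (nextConfig k l) (initState s, [])).2, by simpa using hw, ?_⟩
    rw [List.foldl_append, List.foldl_cons]
    rw [stateAfter] at hr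
    convert hr using 2
    · exact nextConfig_startElement _ _ _
    · rfl
  rcases (hL _ hw).event_config (s := s) (k := k) (l := l) hw rfl with
    ⟨rfl, he⟩ | ⟨hx0, os, q, z', h1, h2, h3⟩
  · cases he
    obtain ⟨⟨v, hv, hwv⟩, -⟩ := hL _ hw
    simp only [List.nil_append, List.cons.injEq, true_and] at hwv
    exact key v [] hwv hv
  · obtain ⟨c', os', p', z', rfl, rfl, -⟩ := h3.exists_cons
    obtain ⟨v, y', hv, hy, -⟩ := h2.of_startElement
    exact key v y' hy hv

theorem OccursAt.callName_visited {c : σ} (h : OccursAt s k l L q (.startElement c)) :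
    callName k l q c ∈ visited s k l L := by
  obtain ⟨x, y, hw, rfl⟩ := h
  refine ⟨x, _, y, hw, ?_⟩
  rw [stateAfter, List.foldl_append, List.foldl_cons, List.foldl_nil]
  exact congrArg Prod.fst (nextConfig_startElement _ _ _)

theorem OccursAt.intName_visited {t : Text} (h : OccursAt s k l L q (.characters t)) :
    intName k q ∈ visited s k l L := by
  obtain ⟨x, y, hw, rfl⟩ := h
  refine ⟨x, _, y, hw, ?_⟩
  rw [stateAfter, List.foldl_append, List.foldl_cons, List.foldl_nil]
  exact congrArg Prod.fst (nextConfig_characters _ _ _)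

theorem visited_cases (hL : ∀ w ∈ L, IsDocument a w)
    (h : q ∈ visited s k l L) :
    (∃ r, q = retName k r (initState s) a) ∨
      ∃ p c, OccursAt s k l L p (.startElement c) ∧ q.1 = (callName k l p c).1 := by
  obtain ⟨x, e, y, hw, rfl⟩ := h
  have hw' : x ++ [e] ++ y ∈ L := by simpa using hw
  obtain ⟨os, q, z, h1, -, h3⟩ := (hL _ hw').prefix_config (s := s) (k := k) (l := l) hw' rfl
    (by simp)
  rw [stateAfter, h1]
  rcases h3 with ⟨-, -, h3⟩ | h3
  · exact .inl h3
  · obtain ⟨c, _, p, _, -, -, h4, h5, -⟩ := h3.exists_cons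
    exact .inr ⟨p, c, h5, h4⟩

theorem visited_finite (hL : ∀ w ∈ L, IsDocument a w)
    (hF : {b | ∃ w ∈ L, Event.startElement b ∈ w}.Finite) :
    (visited s k l L).Finite := by
  obtain ⟨B, hB, h0, hcall, hint, hret⟩ := exists_finite_namedStates s k l hF
  refine hB.subset ?_
  -- The invariant includes the stack, because an end tag computes its target from the popped state.
  suffices h : ∀ x y, x ++ y ∈ L → ∀ q ∈ (x.foldl (nextConfig k l) (initState s, [])).1 ::
      (x.foldl (nextConfig k l) (initState s, [])).2, q ∈ B by
    rintro q ⟨x, e, y, hw, rfl⟩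
    exact h (x ++ [e]) y (by simpa using hw) _ List.mem_cons_self
  intro x
  induction x using List.reverseRecOn with
  | nil =>
    rintro - - q hq
    obtain rfl := List.mem_singleton.1 hq
    exact h0
  | append_singleton x e ih =>
    intro y hw
    have hw' : x ++ e :: y ∈ L := by simpa using hw
    have ih := ih (e :: y) hw'
    rw [List.foldl_append, List.foldl_cons, List.foldl_nil]
    generalize x.foldl (nextConfig k l) (initState s, []) = c at ih
    obtain ⟨q, z⟩ := c
    simp only [List.mem_cons, forall_eq_or_imp] at ih ⊢
    cases e with
    | startElement b =>
      simp only [nextConfig_startElement, List.mem_cons, forall_eq_or_imp]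
      exact ⟨hcall q ih.1 b ⟨_, hw', by simp⟩, ih⟩
    | endElement b =>
      cases z with
      | nil => exact ih
      | cons p z =>
        simp only [List.mem_cons, forall_eq_or_imp] at ih
        exact ⟨hret p ih.2.1 q b ⟨_, hw', (hL _ hw').startElement_mem_of_endElement_mem (by simp)⟩,
          ih.2.2⟩
    | characters t =>
      simp only [nextConfig_characters]
      exact ⟨hint q ih.1, ih.2⟩

end Occurrences

end XMLLearner

namespace XMLLearner

/-! ### The memory of the learner as a set of facts. -/

section Memory

variable {σ T K : Type*} [PartialOrder K] {s : Scheme} {k l : ℕ}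

variable (s k l) in
/-- The intermediate VPA, after trimming, of a set of documents; its final states are immaterial. -/
def observed (dts : DatatypeSystem T K) (L : Set (Stream σ)) : InterVPA (NState s σ) σ T where
  names := {a | ∃ w ∈ L, Event.startElement a ∈ w}
  states := visited s k l L
  final := ∅
  trans := {t | match t with
    | .call q a q' => OccursAt s k l L q (.startElement a) ∧ q' = callName k l q a
    | .int q τ q' => τ ∈ dts.maxLex (inferredAt s k l L dts q) ∧ q' = intName k q
    | .ret q a p q' => PopsAt s k l L q a p ∧ q' = retName k q p a}

variable (k l) in
/-- The transitions recorded at an event. -/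
def eventTrans : NState s σ × List (NState s σ) → Event σ (Set T) → Set (Trans (NState s σ) σ T)
  | (q, _), .startElement a => {Trans.call q a (callName k l q a)}
  | (q, p :: _), .endElement a => {Trans.ret q a p (retName k q p a)}
  | (_, []), .endElement _ => ∅
  | (q, _), .characters R => {t | ∃ τ ∈ R, t = Trans.int q τ (intName k q)}

variable (k l) in
/-- The states recorded at an event. -/
def eventStates : NState s σ × List (NState s σ) → Event σ (Set T) → Set (NState s σ)
  | (_, []), .endElement _ => ∅
  | c, e => {(nextConfig k l c e).1}

/-- The names recorded at an event. -/
def eventNames : Event σ (Set T) → Set σ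
  | .startElement a => {a}
  | _ => ∅

/-- The names, states and transitions seen by the automaton and its counters. -/
structure WeightedVPA.Tracks {S : Type*} (A : WeightedVPA S σ T) (N : Set σ) (Q : Set S)
    (X : Set (Trans S σ T)) : Prop where
  names : A.names = N
  -- Only an inclusion: the initial VPA contains `initState` with counter zero, which `trim`
  -- discards.
  states : Q ⊆ A.states
  wQ : ∀ q, A.wQ q ≠ 0 ↔ q ∈ Q
  trans : A.trans = X
  wδ : ∀ t, A.wδ t ≠ 0 ↔ t ∈ X

theorem bump_ne_zero {α : Type*} {ω : α → ℕ} {X : Set α} {x : α} :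
    bump ω X x ≠ 0 ↔ ω x ≠ 0 ∨ x ∈ X := by
  unfold bump
  split_ifs with h <;> simp [h]

theorem WeightedVPA.Tracks.record {S : Type*} {A : WeightedVPA S σ T} {N : Set σ} {Q : Set S}
    {X : Set (Trans S σ T)} (h : A.Tracks N Q X) (N' : Set σ) (X' : Set (Trans S σ T)) (q : S) :
    (A.record N' X' q).Tracks (N ∪ N') (Q ∪ {q}) (X ∪ X') where
  names := by simp [WeightedVPA.record, h.names]
  states := Set.union_subset_union_left _ h.states
  wQ q := by simp only [WeightedVPA.record, bump_ne_zero, h.wQ, Set.mem_union]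
  trans := by simp [WeightedVPA.record, h.trans]
  wδ t := by simp only [WeightedVPA.record, bump_ne_zero, h.wδ, Set.mem_union]

theorem WeightedVPA.Tracks.learnEvent {A : WeightedVPA (NState s σ) σ T} {N : Set σ}
    {Q : Set (NState s σ)} {X : Set (Trans (NState s σ) σ T)} (h : A.Tracks N Q X)
    (c : NState s σ × List (NState s σ)) (e : Event σ (Set T)) :
    ∃ A', XMLLearner.learnEvent k l (A, c) e = (A', nextConfig k l c e) ∧
      A'.Tracks (N ∪ eventNames e) (Q ∪ eventStates k l c e) (X ∪ eventTrans k l c e) := by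
  obtain ⟨q, z⟩ := c
  cases e with
  | startElement a => cases z <;> exact ⟨_, rfl, h.record _ _ _⟩
  | endElement a =>
    cases z with
    | nil =>
      refine ⟨A, rfl, ?_⟩
      simpa [eventNames, eventStates, eventTrans] using h
    | cons p z => exact ⟨_, rfl, h.record _ _ _⟩
  | characters R => cases z <;> exact ⟨_, rfl, h.record _ _ _⟩

variable (k l) in
/-- Everything that `f` yields along a document, read from the configuration `c`. -/
def gather {β : Type*} (dts : DatatypeSystem T K)
    (f : NState s σ × List (NState s σ) → Event σ (Set T) → Set β)
    (c : NState s σ × List (NState s σ)) (w : Stream σ) : Set β :=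
  {b | ∃ x e y, w = x ++ e :: y ∧ b ∈ f (x.foldl (nextConfig k l) c) (e.mapChars dts.minReq)}

theorem nextConfig_mapChars {α β : Type*} (f : α → β) (c : NState s σ × List (NState s σ))
    (e : Event σ α) : nextConfig k l c (e.mapChars f) = nextConfig k l c e := by
  obtain ⟨q, z⟩ := c
  cases e <;> cases z <;> rfl

theorem gather_nil {β : Type*} (dts : DatatypeSystem T K)
    (f : NState s σ × List (NState s σ) → Event σ (Set T) → Set β)
    (c : NState s σ × List (NState s σ)) : gather k l dts f c [] = ∅ := by
  ext b
  simp [gather]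

theorem gather_cons {β : Type*} (dts : DatatypeSystem T K)
    (f : NState s σ × List (NState s σ) → Event σ (Set T) → Set β)
    (c : NState s σ × List (NState s σ)) (e : Event σ Text) (w : Stream σ) :
    gather k l dts f c (e :: w) =
      f c (e.mapChars dts.minReq) ∪ gather k l dts f (nextConfig k l c e) w := by
  ext b
  constructor
  · rintro ⟨x, e', y, hx, hb⟩
    cases x with
    | nil =>
      simp only [List.nil_append, List.cons.injEq] at hx
      exact .inl (hx.1 ▸ hb)
    | cons e'' x =>
      simp only [List.cons_append, List.cons.injEq] at hx
      obtain ⟨rfl, rfl⟩ := hx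
      exact .inr ⟨x, e', y, rfl, hb⟩
  · rintro (hb | ⟨x, e', y, rfl, hb⟩)
    · exact ⟨[], e, w, rfl, hb⟩
    · exact ⟨e :: x, e', y, rfl, hb⟩

theorem WeightedVPA.Tracks.foldl_learnEvent (dts : DatatypeSystem T K) (w : Stream σ)
    {A : WeightedVPA (NState s σ) σ T} {N : Set σ}
    {Q : Set (NState s σ)} {X : Set (Trans (NState s σ) σ T)} (h : A.Tracks N Q X)
    (c : NState s σ × List (NState s σ)) :
    ∃ A' c', (dts.dtyped w).foldl (XMLLearner.learnEvent k l) (A, c) = (A', c') ∧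
      A'.Tracks (N ∪ gather k l dts (fun _ => eventNames) c w)
        (Q ∪ gather k l dts (eventStates k l) c w) (X ∪ gather k l dts (eventTrans k l) c w) := by
  induction w generalizing A N Q X c with
  | nil => exact ⟨A, c, rfl, by simpa [gather_nil] using h⟩
  | cons e w ih =>
    obtain ⟨A', h1, h2⟩ := h.learnEvent (k := k) (l := l) c (e.mapChars dts.minReq)
    obtain ⟨A'', c'', h3, h4⟩ := ih h2 (nextConfig k l c (e.mapChars dts.minReq))
    refine ⟨A'', c'', ?_, ?_⟩
    · rw [← h3, ← h1]
      rfl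
    · rw [gather_cons, gather_cons, gather_cons]
      simpa only [Set.union_assoc, nextConfig_mapChars] using h4

theorem memory_append (dts : DatatypeSystem T K) (E : List (Stream σ)) (w : Stream σ) :
    memory s k l dts (E ++ [w]) = incWeightedVPA k l dts (memory s k l dts E) w := by
  simp [memory]

/-- Each pass restarts from `(initState s, [])` whatever the memory is, so the contributions of the
documents simply unite. -/
theorem memory_tracks (dts : DatatypeSystem T K) (E : List (Stream σ)) :
    (memory s k l dts E).Tracks
      {a | ∃ w ∈ E, a ∈ gather k l dts (fun _ => eventNames) (initState s, []) w}
      {q | ∃ w ∈ E, q ∈ gather k l dts (eventStates k l) (initState s, []) w}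
      {t | ∃ w ∈ E, t ∈ gather k l dts (eventTrans k l) (initState s, []) w} := by
  induction E using List.reverseRecOn with
  | nil => constructor <;> simp [memory, initVPA]
  | append_singleton E w ih =>
    rw [memory_append]
    obtain ⟨A', c', h1, h2⟩ := ih.foldl_learnEvent (k := k) (l := l) dts w (initState s, [])
    have h3 : ∀ {N Q X}, A'.Tracks N Q X →
        (incWeightedVPA k l dts (memory s k l dts E) w).Tracks N Q X := by
      intro N Q X h2
      simp only [incWeightedVPA, h1]
      exact ⟨h2.names, h2.states, h2.wQ, h2.trans, h2.wδ⟩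
    convert h3 h2 using 1 <;>
    · ext b
      simp [or_and_right, exists_or]

theorem call_mem_eventTrans {c : NState s σ × List (NState s σ)} {e : Event σ (Set T)}
    {q q' : NState s σ} {a : σ} : Trans.call q a q' ∈ eventTrans k l c e ↔
      e = .startElement a ∧ c.1 = q ∧ q' = callName k l q a := by
  obtain ⟨r, z⟩ := c
  cases e <;> cases z <;> simp [eventTrans] <;> grind

theorem int_mem_eventTrans {c : NState s σ × List (NState s σ)} {e : Event σ (Set T)}
    {q q' : NState s σ} {τ : T} : Trans.int q τ q' ∈ eventTrans k l c e ↔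
      ∃ R, e = .characters R ∧ τ ∈ R ∧ c.1 = q ∧ q' = intName k q := by
  obtain ⟨r, z⟩ := c
  cases e <;> cases z <;> simp [eventTrans] <;> grind

theorem ret_mem_eventTrans {c : NState s σ × List (NState s σ)} {e : Event σ (Set T)}
    {q p q' : NState s σ} {a : σ} : Trans.ret q a p q' ∈ eventTrans k l c e ↔
      e = .endElement a ∧ (∃ z, c = (q, p :: z)) ∧ q' = retName k q p a := by
  obtain ⟨r, z⟩ := c
  cases e <;> cases z <;> simp [eventTrans] <;> grind

/-- The hypothesis before minimization depends only on the set of examples. -/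
theorem toXVPA_trim_memory (dts : DatatypeSystem T K) {E : List (Stream σ)}
    (hE : ∀ w ∈ E, ∃ a, IsDocument a w) :
    toXVPA (trim dts (memory s k l dts E)) = toXVPA (observed s k l dts {w | w ∈ E}) := by
  have hM := memory_tracks (s := s) (k := k) (l := l) dts E
  -- `toXVPA` does not read the final states, so they are erased before comparing.
  suffices h : { trim dts (memory s k l dts E) with final := ∅ } =
      observed s k l dts {w | w ∈ E} by
    rw [← h]
    rfl
  have hcall : ∀ q a q', Trans.call q a q' ∈ (memory s k l dts E).trans ↔
      OccursAt s k l {w | w ∈ E} q (.startElement a) ∧ q' = callName k l q a := by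
    intro q a q'
    rw [hM.trans]
    constructor
    · rintro ⟨w, hw, x, e, y, rfl, h⟩
      obtain ⟨h1, h2, rfl⟩ := call_mem_eventTrans.1 h
      cases e <;> cases h1
      exact ⟨⟨x, y, hw, h2⟩, rfl⟩
    · rintro ⟨⟨x, y, hw, h⟩, rfl⟩
      exact ⟨_, hw, x, _, y, rfl, call_mem_eventTrans.2 ⟨rfl, h, rfl⟩⟩
  have hret : ∀ q a p q', Trans.ret q a p q' ∈ (memory s k l dts E).trans ↔
      PopsAt s k l {w | w ∈ E} q a p ∧ q' = retName k q p a := by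
    intro q a p q'
    rw [hM.trans]
    constructor
    · rintro ⟨w, hw, x, e, y, rfl, h⟩
      obtain ⟨h1, ⟨z, h2⟩, rfl⟩ := ret_mem_eventTrans.1 h
      cases e <;> cases h1
      exact ⟨⟨x, y, z, hw, h2⟩, rfl⟩
    · rintro ⟨⟨x, y, z, hw, h⟩, rfl⟩
      exact ⟨_, hw, x, _, y, rfl, ret_mem_eventTrans.2 ⟨rfl, ⟨z, h⟩, rfl⟩⟩
  have hint : ∀ q τ q', Trans.int q τ q' ∈ (memory s k l dts E).trans ↔
      τ ∈ inferredAt s k l {w | w ∈ E} dts q ∧ q' = intName k q := by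
    intro q τ q'
    rw [hM.trans]
    constructor
    · rintro ⟨w, hw, x, e, y, rfl, h⟩
      obtain ⟨R, h1, h2, h3, rfl⟩ := int_mem_eventTrans.1 h
      cases e <;> cases h1
      exact ⟨⟨_, ⟨x, y, hw, h3⟩, h2⟩, rfl⟩
    · rintro ⟨⟨t, ⟨x, y, hw, h⟩, hτ⟩, rfl⟩
      exact ⟨_, hw, x, _, y, rfl, int_mem_eventTrans.2 ⟨_, rfl, hτ, h, rfl⟩⟩
  have hw : ∀ t, t ∈ (memory s k l dts E).trans → (memory s k l dts E).wδ t ≠ 0 := fun t ht =>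
    (hM.wδ t).2 (hM.trans ▸ ht)
  simp only [trim, observed, InterVPA.mk.injEq, true_and]
  refine ⟨?_, ?_, ?_⟩
  · rw [hM.names]
    ext a
    constructor
    · rintro ⟨w, hw, x, e, y, rfl, h⟩
      cases e with
      | startElement b => exact ⟨_, hw, by simp [show a = b from h]⟩
      | endElement b => exact h.elim
      | characters b => exact h.elim
    · rintro ⟨w, hw, h⟩
      obtain ⟨x, y, rfl⟩ := List.append_of_mem h
      exact ⟨_, hw, x, _, y, rfl, rfl⟩
  · have h1 : {q ∈ (memory s k l dts E).states | (memory s k l dts E).wQ q ≠ 0} =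
        {q | ∃ w ∈ E, q ∈ gather k l dts (eventStates k l) (initState s, []) w} := by
      ext q
      exact ⟨fun h => (hM.wQ q).1 h.2, fun h => ⟨hM.states h, (hM.wQ q).2 h⟩⟩
    rw [h1]
    have key : ∀ w ∈ E, ∀ x e y, w = x ++ e :: y → ∀ q,
        q ∈ eventStates k l (x.foldl (nextConfig k l) (initState s, []))
          (e.mapChars dts.minReq) ↔ stateAfter s k l (x ++ [e]) = q := by
      intro w hw x e y hxy q
      obtain ⟨a, ha⟩ := hE w hw
      have h2 : stateAfter s k l (x ++ [e]) =
          (nextConfig k l (x.foldl (nextConfig k l) (initState s, []))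
            (e.mapChars dts.minReq)).1 := by
        rw [stateAfter, List.foldl_append, nextConfig_mapChars]
        rfl
      rw [h2, @eq_comm _ _ q]
      -- In a document no end tag meets an empty stack, the only case in which no state is recorded.
      rcases ha.event_config (s := s) (k := k) (l := l) (L := {w | w ∈ E}) hw hxy with
        ⟨rfl, rfl⟩ | ⟨-, os, r, z, h3, -, h4⟩
      · rfl
      · rw [h3]
        obtain ⟨_, _, p, z', -, rfl, -⟩ := h4.exists_cons
        cases e <;> rfl
    ext q
    constructor
    · rintro ⟨w, hw, x, e, y, rfl, h⟩
      exact ⟨x, e, y, hw, (key _ hw x e y rfl q).1 h⟩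
    · rintro ⟨x, e, y, hw, h⟩
      exact ⟨_, hw, x, e, y, rfl, (key _ hw x e y rfl q).2 h⟩
  · ext t
    cases t with
    | call q a q' =>
      constructor
      · rintro ((⟨-, h, -⟩ | ⟨⟨_, _, _, _, h⟩, -⟩) | ⟨_, _, _, h, -⟩)
        · exact (hcall _ _ _).1 h
        · cases h
        · cases h
      · intro h
        have h := (hcall q a q').2 h
        exact .inl (.inl ⟨⟨_, _, _, rfl⟩, h, hw _ h⟩)
    | ret q a p q' =>
      constructor
      · rintro ((⟨⟨_, _, _, h⟩, -⟩ | ⟨-, h, -⟩) | ⟨_, _, _, h, -⟩)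
        · cases h
        · exact (hret _ _ _ _).1 h
        · cases h
      · intro h
        have h := (hret q a p q').2 h
        exact .inl (.inr ⟨⟨_, _, _, _, rfl⟩, h, hw _ h⟩)
    | int q τ q' =>
      -- A text move determines its target, so trimming datatypes between two states amounts to
      -- trimming them at the source.
      have h1 : ∀ q q', {τ | Trans.int q τ q' ∈ (memory s k l dts E).trans ∧
          (memory s k l dts E).wδ (.int q τ q') ≠ 0} =
          {τ | τ ∈ inferredAt s k l {w | w ∈ E} dts q ∧ q' = intName k q} := by
        intro q q'
        ext τ
        rw [Set.mem_ofPred_eq, Set.mem_ofPred_eq, ← hint]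
        exact ⟨fun h => h.1, fun h => ⟨h, hw _ h⟩⟩
      constructor
      · rintro ((⟨⟨_, _, _, h⟩, -⟩ | ⟨⟨_, _, _, _, h⟩, -⟩) | ⟨_, _, _, h, hτ⟩)
        · cases h
        · cases h
        · cases h
          rw [h1] at hτ
          exact ⟨⟨hτ.1.1, fun ⟨τ', h2, h3⟩ => hτ.2 ⟨τ', ⟨h2, hτ.1.2⟩, h3⟩⟩, hτ.1.2⟩
      · rintro ⟨hτ, rfl⟩
        refine .inr ⟨_, _, _, rfl, ?_⟩
        rw [h1]
        exact ⟨⟨hτ.1, rfl⟩, fun ⟨τ', h2, h3⟩ => hτ.2 ⟨τ', h2.1, h3⟩⟩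

end Memory
end XMLLearner

namespace XMLLearner

/-! ### The hypothesis before minimization: coherence and local acceptance. -/

section Observed

variable {σ : Type u} {T K : Type*} [PartialOrder K] {s : Scheme} {k l : ℕ}
  {dts : DatatypeSystem T K} {L : Set (Stream σ)} {a : σ}

theorem mem_observed_exits {m : Ctx s σ} {q : NState s σ} :
    q ∈ (toXVPA (observed s k l dts L)).exits m ↔
      q ∈ visited s k l L ∧ q.1 = m ∧ ∃ c p, PopsAt s k l L q c p :=
  ⟨fun ⟨h1, h2, c, p, _, h3⟩ => ⟨h1, h2, c, p, h3.1⟩,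
    fun ⟨h1, h2, c, p, h3⟩ => ⟨h1, h2, c, p, _, h3, rfl⟩⟩

theorem call_mem_observed {m : Ctx s σ} {q q' : NState s σ} {c : σ} :
    Trans.call q c q' ∈ (toXVPA (observed s k l dts L)).trans m ↔
      OccursAt s k l L q (.startElement c) ∧ q' = callName k l q c ∧
        q ∈ visited s k l L ∧ q.1 = m := by
  constructor
  · rintro ((⟨_, _, _, h, h1, h2, h3⟩ | ⟨_, _, _, h, -⟩) | ⟨_, _, _, _, h, -⟩)
    · cases h
      exact ⟨h1.1, h1.2, h2, h3⟩
    · cases h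
    · cases h
  · rintro ⟨h1, h2, h3, h4⟩
    exact .inl (.inl ⟨_, _, _, rfl, ⟨h1, h2⟩, h3, h4⟩)

theorem int_mem_observed {m : Ctx s σ} {q q' : NState s σ} {τ : T} :
    Trans.int q τ q' ∈ (toXVPA (observed s k l dts L)).trans m ↔
      τ ∈ dts.maxLex (inferredAt s k l L dts q) ∧ q' = intName k q ∧
        q ∈ visited s k l L ∧ q.1 = m := by
  constructor
  · rintro ((⟨_, _, _, h, -⟩ | ⟨_, _, _, h, h1, h2, h3, -⟩) | ⟨_, _, _, _, h, -⟩)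
    · cases h
    · cases h
      exact ⟨h1.1, h1.2, h2, h3⟩
    · cases h
  · rintro ⟨h1, rfl, h3, h4⟩
    obtain ⟨t, ht, -⟩ := h1.1
    exact .inl (.inr ⟨_, _, _, rfl, ⟨h1, rfl⟩, h3, h4, ht.intName_visited, h4⟩)

theorem ret_mem_observed {m : Ctx s σ} {q p q' : NState s σ} {c : σ} :
    Trans.ret q c p q' ∈ (toXVPA (observed s k l dts L)).trans m ↔
      p.1 ≠ Ctx.empty s ∧ (q ∈ visited s k l L ∧ q.1 = m ∧ ∃ d p', PopsAt s k l L q d p') ∧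
        (∃ r ∈ visited s k l L, r.1 = m ∧ PopsAt s k l L r c p) ∧ q' = retName k q p c := by
  constructor
  · rintro ((⟨_, _, _, h, -⟩ | ⟨_, _, _, h, -⟩) |
      ⟨_, _, _, _, h, h1, ⟨h2, h3, d, p', _, h4⟩, r, h5, h6, h7⟩)
    · cases h
    · cases h
    · cases h
      exact ⟨h1, ⟨h2, h3, d, p', h4.1⟩, ⟨r, h5, h6, h7.1⟩, h7.2⟩
  · rintro ⟨h1, ⟨h2, h3, d, p', h4⟩, ⟨r, h5, h6, h7⟩, rfl⟩
    exact .inr ⟨_, _, _, _, rfl, h1, ⟨h2, h3, d, p', _, h4, rfl⟩, r, h5, h6, h7, rfl⟩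

/-- The context determines the element by `Ctx.extend_inj`, so the choice made in `μ` has only one
possible outcome. -/
theorem observed_μ (hk : 1 ≤ k) (hl : s = Scheme.ancestor → 1 ≤ l) {q : NState s σ} {c : σ}
    (h : OccursAt s k l L q (.startElement c)) :
    (toXVPA (observed s k l dts L)).μ (callName k l q c).1 = some c := by
  have h' : ∃ d p, Trans.call p d ((callName k l q c).1, []) ∈ (observed s k l dts L).trans :=
    ⟨c, q, h, rfl⟩
  have h1 : (toXVPA (observed s k l dts L)).μ (callName k l q c).1 = some h'.choose := dif_pos h'
  obtain ⟨p, -, h2⟩ := h'.choose_spec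
  rw [h1, Option.some_inj]
  exact (Ctx.extend_inj hk hl (congrArg Prod.fst h2)).symm

theorem occursAt_root (hL : ∀ w ∈ L, IsDocument a w) (hne : L.Nonempty) :
    OccursAt s k l L (initState s) (.startElement a) := by
  obtain ⟨w, hw⟩ := hne
  obtain ⟨⟨x, -, rfl⟩, -⟩ := hL w hw
  exact ⟨[], _, hw, rfl⟩

theorem OccursAt.eq_root (hl : s = Scheme.ancestor → 1 ≤ l) (hL : ∀ w ∈ L, IsDocument a w)
    {e : Event σ Text} (h : OccursAt s k l L (initState s) e) : e = .startElement a := by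
  rcases h.cases_init hl hL with h | h
  · exact h.2
  · exact (h.1 rfl).elim

/-- Only the root start tag occurs at the start state, which leaves a single candidate for the
choice of `m₀`. -/
theorem observed_m₀ (hl : s = Scheme.ancestor → 1 ≤ l) (hL : ∀ w ∈ L, IsDocument a w)
    (hne : L.Nonempty) :
    (toXVPA (observed s k l dts L)).m₀ = (callName k l (initState s) a).1 := by
  have h : ∃ m, ∃ c, Trans.call (initState s) c (m, []) ∈ (observed s k l dts L).trans :=
    ⟨(callName k l (initState s) a).1, a, occursAt_root hL hne, rfl⟩
  have h1 : ∃ c, Trans.call (initState s) c ((toXVPA (observed s k l dts L)).m₀, []) ∈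
      (observed s k l dts L).trans :=
    @Classical.epsilon_spec_aux _ ⟨Ctx.empty s⟩ _ h
  obtain ⟨c, h2, h3⟩ := h1
  cases h2.eq_root hl hL
  exact congrArg Prod.fst h3

theorem observed_module_called (hL : ∀ w ∈ L, IsDocument a w) {q : NState s σ}
    (hq : q ∈ visited s k l L) (hq' : q.1 ≠ Ctx.empty s) :
    ∃ p c, OccursAt s k l L p (.startElement c) ∧ q.1 = (callName k l p c).1 := by
  rcases visited_cases hL hq with ⟨r, rfl⟩ | h
  · exact (hq' rfl).elim
  · exact h

theorem callName_mem_modules (hl : s = Scheme.ancestor → 1 ≤ l) {q : NState s σ} {c : σ}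
    (h : OccursAt s k l L q (.startElement c)) :
    (callName k l q c).1 ∈ (toXVPA (observed s k l dts L)).modules :=
  ⟨Ctx.extend_ne_empty hl _ _ _, [], h.callName_visited⟩

theorem mem_modules_of_visited {q : NState s σ} (h : q ∈ visited s k l L)
    (h' : q.1 ≠ Ctx.empty s) : q.1 ∈ (toXVPA (observed s k l dts L)).modules :=
  ⟨h', q.2, h⟩

theorem PopsAt.visited_of_ne_empty (hl : s = Scheme.ancestor → 1 ≤ l)
    (hL : ∀ w ∈ L, IsDocument a w) {r p : NState s σ} {c : σ} (h : PopsAt s k l L r c p)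
    (hp : p.1 ≠ Ctx.empty s) : p ∈ visited s k l L := by
  rcases (h.spec hL).2.2.2.2.cases_init hl hL with h | h
  · exact (hp (h.1 ▸ rfl)).elim
  · exact h.2.1

/-- With `k ≥ 1` the sibling string ends in the placeholder after a text and in a name after an
element. This is what makes `datatype_sequence` hold. -/
theorem intName_ne_retName (hk : 1 ≤ k) (q r p : NState s σ) (c : σ) :
    intName k q ≠ retName k r p c := by
  intro h
  have h := congrArg Prod.snd h
  simp only [intName, retName] at h
  rw [rtake_concat hk, rtake_concat hk] at h
  simpa using (List.append_inj' h rfl).2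

/-- The hypothesis before minimization is a coherent dXVPA. -/
theorem observed_coherent (hk : 1 ≤ k) (hl : s = Scheme.ancestor → 1 ≤ l)
    (hL : ∀ w ∈ L, IsDocument a w) (hne : L.Nonempty)
    (hF : {b | ∃ w ∈ L, Event.startElement b ∈ w}.Finite) :
    (toXVPA (observed s k l dts L)).Coherent := by
  have hfin := visited_finite (s := s) (k := k) (l := l) hL hF
  refine ⟨⟨?_, ?_, ?_, ?_, ?_, ?_, ?_, ?_, ?_, ?_, ?_, ?_, ?_, ?_, ?_⟩, ?_, ?_, ?_⟩
  · refine (hfin.image Prod.fst).subset ?_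
    rintro m ⟨-, z, hz⟩
    exact ⟨_, hz, rfl⟩
  · rw [observed_m₀ hl hL hne]
    exact callName_mem_modules hl (occursAt_root hL hne)
  · rintro m ⟨hm, z, hz⟩
    obtain ⟨p, c, h, h'⟩ := observed_module_called hL hz hm
    change m = _ at h'
    subst h'
    obtain ⟨x, y, hw, hx⟩ := h
    exact ⟨c, ⟨_, hw, by simp⟩, observed_μ hk hl ⟨x, y, hw, hx⟩⟩
  · rintro b ⟨w, hw, hb⟩
    obtain ⟨x, y, rfl⟩ := List.append_of_mem hb
    have h : OccursAt s k l L (stateAfter s k l x) (.startElement b) := ⟨x, y, hw, rfl⟩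
    exact ⟨_, callName_mem_modules hl h, observed_μ hk hl h⟩
  · intro m _
    exact hfin.subset fun q hq => hq.1
  · rintro m - n - hmn
    exact Set.disjoint_left.2 fun q hq hq' => hmn (hq.2.symm.trans hq'.2)
  · rintro m ⟨hm, z, hz⟩
    obtain ⟨p, c, h, h'⟩ := observed_module_called hL hz hm
    change m = _ at h'
    subst h'
    exact ⟨h.callName_visited, rfl⟩
  · rintro m - q hq
    exact ⟨hq.1, hq.2.1⟩
  · rintro m - q c q' h
    obtain ⟨h1, rfl, h2, h3⟩ := call_mem_observed.1 h
    exact ⟨⟨h2, h3⟩, _, callName_mem_modules hl h1, observed_μ hk hl h1, rfl⟩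
  · rintro m - q τ q' h
    obtain ⟨h1, rfl, h2, h3⟩ := int_mem_observed.1 h
    obtain ⟨t, ht, -⟩ := h1.1
    exact ⟨⟨h2, h3⟩, ht.intName_visited, h3⟩
  · rintro m hm q c p q' h
    obtain ⟨h1, ⟨h2, h3, d, p', h4⟩, ⟨r, h5, rfl, h6⟩, rfl⟩ := ret_mem_observed.1 h
    obtain ⟨h7, -, h8, -, h9⟩ := h6.spec hL
    have hp := h6.visited_of_ne_empty hl hL h1
    exact ⟨mem_observed_exits.2 ⟨h2, h3, d, p', h4⟩, h7 ▸ observed_μ hk hl h9, p.1,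
      mem_modules_of_visited hp h1, ⟨hp, rfl⟩, h8, rfl⟩
  · rintro m - q c p q' q'' h h'
    rw [(ret_mem_observed.1 h).2.2.2, (ret_mem_observed.1 h').2.2.2]
  · rintro m - x hx y hy c p q' h
    obtain ⟨h1, -, h2, rfl⟩ := ret_mem_observed.1 h
    exact ret_mem_observed.2 ⟨h1, mem_observed_exits.1 hy, h2, rfl⟩
  · rintro m - q τ τ' q' q'' h h'
    rw [(int_mem_observed.1 h).2.1, (int_mem_observed.1 h').2.1]
  · rintro m - n - q c p q' h - r τ h'
    have h1 := (ret_mem_observed.1 h).2.2.2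
    rw [(int_mem_observed.1 h').2.1] at h1
    exact intName_ne_retName hk _ _ _ _ h1
  · rintro m - q c q' q'' h h'
    rw [(call_mem_observed.1 h).2.1, (call_mem_observed.1 h').2.1]
  · rintro i - j - x c p q' h hp
    obtain ⟨h1, -, ⟨r, h5, rfl, h6⟩, rfl⟩ := ret_mem_observed.1 h
    obtain ⟨h7, -, -, -, h8⟩ := h6.spec hL
    exact call_mem_observed.2 ⟨h8, Prod.ext h7 rfl, hp⟩
  · rintro i - j hj q c h
    obtain ⟨h1, h2, h3, rfl⟩ := call_mem_observed.1 h
    obtain rfl : i = _ := congrArg Prod.fst h2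
    obtain ⟨r, hr⟩ := h1.startElement_pops hL
    obtain ⟨h4, h5, -⟩ := hr.spec hL
    exact ⟨r, _, ret_mem_observed.2 ⟨hj.1, ⟨h5, h4, c, q, hr⟩, ⟨r, h5, h4, hr⟩, rfl⟩⟩

/-! ### The language of the hypothesis before minimization -/

variable (s k l) in
/-- The events permitted at a configuration of named states. -/
def Permitted (dts : DatatypeSystem T K) (L : Set (Stream σ))
    (c : NState s σ × List (NState s σ)) : Event σ T → Prop
  | .startElement b => OccursAt s k l L c.1 (.startElement b)
  -- The exit and the observed return may belong to different states of one context, in accordance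
  -- with the sharing of returns among exits.
  | .endElement b => (∃ d p, PopsAt s k l L c.1 d p) ∧
      ∃ p z r, c.2 = p :: z ∧ r.1 = c.1.1 ∧ PopsAt s k l L r b p
  | .characters τ => τ ∈ dts.maxLex (inferredAt s k l L dts c.1)

variable (s k l) in
/-- All events of the stream are permitted where they occur. -/
def Follows (dts : DatatypeSystem T K) (L : Set (Stream σ)) :
    NState s σ × List (NState s σ) → TypedStream σ T → Prop
  | _, [] => True
  | c, e :: y => Permitted s k l dts L c e ∧ Follows dts L (nextConfig k l c e) y

open Classical in
/-- The state of the VPA of the hypothesis that stands for a named state. -/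
noncomputable def vstate (q : NState s σ) : VState (NState s σ) :=
  if q.1 = Ctx.empty s then (if q.2 = [] then .start else .final) else .inner q

/-- The configuration of the VPA of the hypothesis for a configuration of named states. -/
noncomputable def vconfig (c : NState s σ × List (NState s σ)) :
    VState (NState s σ) × List (VState (NState s σ)) :=
  (vstate c.1, c.2.map vstate)

theorem vstate_init : vstate (initState s : NState s σ) = .start := by
  simp [vstate, initState]

theorem vstate_inner {q : NState s σ} (h : q.1 ≠ Ctx.empty s) : vstate q = .inner q := by
  simp [vstate, h]

theorem retName_ne_nil (hk : 1 ≤ k) (r p : NState s σ) (c : σ) : (retName k r p c).2 ≠ [] := by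
  rw [retName, rtake_concat hk]
  simp

theorem vstate_ret (hk : 1 ≤ k) (r : NState s σ) (c : σ) :
    vstate (retName k r (initState s) c) = .final := by
  have h : (retName k r (initState s) c).1 = Ctx.empty s := rfl
  rw [vstate, if_pos h, if_neg (retName_ne_nil hk _ _ _)]

theorem vstate_eq_inner {q q' : NState s σ} (h : vstate q = .inner q') :
    q = q' ∧ q.1 ≠ Ctx.empty s := by
  unfold vstate at h
  split_ifs at h with h1 h2
  cases h
  exact ⟨rfl, h1⟩

variable (s k l L a) in
/-- The configurations that are reached on the way to acceptance. -/
inductive Reached : NState s σ × List (NState s σ) → Prop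
  | init : Reached (initState s, [])
  | inner {os : List σ} {q : NState s σ} {z : List (NState s σ)} : Linked s k l L a os q z →
      Reached (q, z)
  | final (r : NState s σ) : Reached (retName k r (initState s) a, [])

/-- The state after the root has the empty context but a nonempty sibling string, so it is neither
the start state nor inside a module. -/
theorem not_occursAt_final (hk : 1 ≤ k) (hl : s = Scheme.ancestor → 1 ≤ l)
    (hL : ∀ w ∈ L, IsDocument a w) {r : NState s σ} {c : σ}
    {e : Event σ Text} (h : OccursAt s k l L (retName k r (initState s) c) e) : False := by
  rcases h.cases_init hl hL with ⟨h, -⟩ | h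
  · exact retName_ne_nil hk _ _ _ (congrArg Prod.snd h)
  · exact h.1 rfl

theorem Reached.next (hk : 1 ≤ k) (hl : s = Scheme.ancestor → 1 ≤ l)
    (hL : ∀ w ∈ L, IsDocument a w) {c : NState s σ × List (NState s σ)}
    (hc : Reached s k l L a c) {e : Event σ T} (he : Permitted s k l dts L c e) :
    Reached s k l L a (nextConfig k l c e) := by
  cases hc with
  | init =>
    cases e with
    | startElement b =>
      have he' : OccursAt s k l L (initState s) (.startElement b) := he
      cases he'.eq_root hl hL
      exact .inner (.root he' rfl)
    | endElement b =>
      obtain ⟨-, p, z, r, h, -⟩ := he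
      cases h
    | characters τ =>
      obtain ⟨t, ht, -⟩ := he.1
      cases OccursAt.eq_root hl hL ht
  | inner hc =>
    cases e with
    | startElement b =>
      rw [nextConfig_startElement]
      exact .inner (hc.startElement he)
    | endElement b =>
      obtain ⟨-, p, z, r, h, hr, hb⟩ := he
      obtain ⟨c, os', p', z', rfl, rfl, h1, h2, h3⟩ := hc.exists_cons
      cases h
      -- The end tag was observed in the current context, and the context determines the innermost
      -- open element.
      obtain rfl : b = c := Ctx.extend_inj hk hl (((hb.spec hL).1.symm.trans hr).trans h1)
      rw [nextConfig_endElement]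
      rcases h3 with ⟨rfl, rfl, rfl, rfl⟩ | h3
      · exact .final _
      · exact .inner (h3.congr rfl)
    | characters τ =>
      rw [nextConfig_characters]
      exact .inner (hc.congr rfl)
  | final r =>
    cases e with
    | startElement b => exact (not_occursAt_final hk hl hL (r := r) he).elim
    | endElement b =>
      obtain ⟨-, p, z, r, h, -⟩ := he
      cases h
    | characters τ =>
      obtain ⟨t, ht, -⟩ := he.1
      exact (not_occursAt_final hk hl hL (r := r) ht).elim

theorem Linked.visited_tail (hl : s = Scheme.ancestor → 1 ≤ l) (hL : ∀ w ∈ L, IsDocument a w)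
    {os : List σ} {q p : NState s σ} {z : List (NState s σ)}
    (h : Linked s k l L a os q (p :: z)) :
    (p = initState s ∧ z = [] ∧ os = [a]) ∨ p.1 ≠ Ctx.empty s := by
  obtain ⟨c, os', p', z', rfl, h, -, -, h3⟩ := h.exists_cons
  cases h
  rcases h3 with ⟨rfl, rfl, rfl, rfl⟩ | h3
  · exact .inl ⟨rfl, rfl, rfl⟩
  · exact .inr (h3.ne_empty hl)

/-- The steps of the hypothesis are the permitted events. -/
theorem Reached.step_iff (hk : 1 ≤ k) (hl : s = Scheme.ancestor → 1 ≤ l)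
    (hL : ∀ w ∈ L, IsDocument a w) (hne : L.Nonempty) {c : NState s σ × List (NState s σ)}
    (hc : Reached s k l L a c) {e : Event σ T}
    {d : VState (NState s σ) × List (VState (NState s σ))} :
    Step (toXVPA (observed s k l dts L)).vpaTrans (vconfig c) e d ↔
      Permitted s k l dts L c e ∧ d = vconfig (nextConfig k l c e) := by
  have hroot := occursAt_root (s := s) (k := k) (l := l) hL hne
  have hm₀ := observed_m₀ (dts := dts) hl hL hne (k := k)
  have hμ₀ : (toXVPA (observed s k l dts L)).μ (toXVPA (observed s k l dts L)).m₀ = some a := by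
    rw [hm₀]
    exact observed_μ hk hl hroot
  obtain ⟨q, z⟩ := c
  constructor
  · intro h
    generalize hv : vconfig (q, z) = v at h
    cases h with
    | @call q₁ b q₁' z₁ h =>
      simp only [vconfig, Prod.mk.injEq] at hv
      obtain ⟨hq, rfl⟩ := hv
      rcases DXVPA.call_mem_vpaTrans.1 h with ⟨rfl, h1, rfl⟩ | ⟨m, hm, r, r', rfl, rfl, h1⟩
      · cases hc with
        | init =>
          rw [hμ₀] at h1
          cases h1
          refine ⟨hroot, ?_⟩
          rw [nextConfig_startElement, vconfig, vstate_inner (Ctx.extend_ne_empty hl _ _ _)]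
          simp only [List.map_cons, List.map_nil, vstate_init, Prod.mk.injEq, and_true]
          rw [hm₀]
          rfl
        | inner hc => simp [vstate_inner (hc.ne_empty hl)] at hq
        | final => simp [vstate_ret hk] at hq
      · obtain ⟨rfl, hq'⟩ := vstate_eq_inner hq
        obtain ⟨h2, rfl, -⟩ := call_mem_observed.1 h1
        refine ⟨h2, ?_⟩
        rw [nextConfig_startElement, vconfig, vstate_inner (Ctx.extend_ne_empty hl _ _ _)]
        simp [vstate_inner hq']
    | @int q₁ τ q₁' z₁ h =>
      simp only [vconfig, Prod.mk.injEq] at hv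
      obtain ⟨hq, rfl⟩ := hv
      obtain ⟨m, hm, r, r', rfl, rfl, h1⟩ := DXVPA.int_mem_vpaTrans.1 h
      obtain ⟨rfl, hq'⟩ := vstate_eq_inner hq
      obtain ⟨h2, rfl, -⟩ := int_mem_observed.1 h1
      refine ⟨h2, ?_⟩
      rw [nextConfig_characters, vconfig, vstate_inner (q := intName k q) hq']
    | @ret q₁ b p₁ q₁' z₁ h =>
      simp only [vconfig, Prod.mk.injEq] at hv
      obtain ⟨hq, hz⟩ := hv
      cases z with
      | nil => cases hz
      | cons p z =>
      simp only [List.map_cons, List.cons.injEq] at hz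
      obtain ⟨hp, rfl⟩ := hz
      rcases DXVPA.ret_mem_vpaTrans.1 h with
        ⟨r, h1, rfl, rfl, rfl, h2⟩ | ⟨m, hm, r, p', r', rfl, rfl, rfl, h1⟩
      · obtain ⟨rfl, hq'⟩ := vstate_eq_inner hq
        rw [hμ₀] at h2
        cases h2
        cases hc with
        | inner hc =>
          rcases hc.visited_tail hl hL with ⟨rfl, rfl, -⟩ | h3
          · obtain ⟨h4, h5, c, p, h6⟩ := mem_observed_exits.1 h1
            -- The return into `.final` refers to no observed event; the end tag of the root in a
            -- document of `L` provides one.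
            obtain ⟨r, hr⟩ := hroot.startElement_pops hL
            refine ⟨⟨⟨c, p, h6⟩, _, _, r, rfl, ?_, hr⟩, ?_⟩
            · rw [(hr.spec hL).1]
              exact (h5.trans hm₀).symm
            · rw [nextConfig_endElement, vconfig, vstate_ret hk]
          · rw [vstate_inner h3] at hp
            cases hp
      · obtain ⟨rfl, hq'⟩ := vstate_eq_inner hq
        obtain ⟨rfl, hp'⟩ := vstate_eq_inner hp
        obtain ⟨-, ⟨-, h2, h3⟩, ⟨r, -, h4, h5⟩, rfl⟩ := ret_mem_observed.1 h1
        refine ⟨⟨h3, _, _, r, rfl, h4.trans h2.symm, h5⟩, ?_⟩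
        rw [nextConfig_endElement, vconfig, vstate_inner (q := retName k q p b) hp']
  · rintro ⟨he, rfl⟩
    have hnext := hc.next hk hl hL he
    cases e with
    | startElement b =>
      have he' : OccursAt s k l L q (.startElement b) := he
      rw [nextConfig_startElement]
      refine Step.call _ (DXVPA.call_mem_vpaTrans.2 ?_)
      rw [vstate_inner (q := callName k l q b) (Ctx.extend_ne_empty hl _ _ _)]
      rcases he'.cases_init hl hL with ⟨rfl, h1⟩ | ⟨h1, h2, -⟩
      · cases h1
        refine .inl ⟨vstate_init, hμ₀, ?_⟩
        rw [hm₀]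
        rfl
      · exact .inr ⟨q.1, mem_modules_of_visited h2 h1, q, _, vstate_inner h1, rfl,
          call_mem_observed.2 ⟨he', rfl, h2, rfl⟩⟩
    | characters τ =>
      have he' : τ ∈ dts.maxLex (inferredAt s k l L dts q) := he
      obtain ⟨t, ht, -⟩ := he'.1
      rw [nextConfig_characters]
      refine Step.int _ (DXVPA.int_mem_vpaTrans.2 ?_)
      rcases ht.cases_init hl hL with ⟨rfl, h1⟩ | ⟨h1, h2, -⟩
      · cases h1
      · exact ⟨q.1, mem_modules_of_visited h2 h1, q, _, vstate_inner h1,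
          vstate_inner (q := intName k q) h1, int_mem_observed.2 ⟨he', rfl, h2, rfl⟩⟩
    | endElement b =>
      obtain ⟨⟨d, p', h1⟩, p, z, r, rfl, h2, h3⟩ := he
      obtain ⟨h4, h5, h6, h7, h8⟩ := h3.spec hL
      obtain ⟨-, h9, -, h10, -⟩ := h1.spec hL
      rw [nextConfig_endElement]
      refine Step.ret _ (DXVPA.ret_mem_vpaTrans.2 ?_)
      have hq : q.1 ≠ Ctx.empty s := by
        rw [← show r.1 = q.1 from h2, h4]
        exact Ctx.extend_ne_empty hl _ _ _
      rcases h8.cases_init hl hL with ⟨rfl, h11⟩ | ⟨h11, h12, -⟩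
      · cases h11
        refine .inl ⟨q, mem_observed_exits.2 ⟨h9, ?_, d, p', h1⟩, vstate_inner hq, vstate_init,
          vstate_ret hk q _, hμ₀⟩
        rw [hm₀, ← h4, h2]
      · exact .inr ⟨q.1, mem_modules_of_visited h9 hq, q, p, _, vstate_inner hq,
          vstate_inner h11, vstate_inner (q := retName k q p b) h11,
          ret_mem_observed.2 ⟨h11, ⟨h9, rfl, d, p', h1⟩, ⟨r, h5, h2, h3⟩, rfl⟩⟩

theorem Reached.run_iff (hk : 1 ≤ k) (hl : s = Scheme.ancestor → 1 ≤ l)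
    (hL : ∀ w ∈ L, IsDocument a w) (hne : L.Nonempty) {y : TypedStream σ T}
    {c : NState s σ × List (NState s σ)} (hc : Reached s k l L a c)
    {d : VState (NState s σ) × List (VState (NState s σ))} :
    Run (toXVPA (observed s k l dts L)).vpaTrans (vconfig c) y d ↔
      Follows s k l dts L c y ∧ d = vconfig (y.foldl (nextConfig k l) c) := by
  induction y generalizing c with
  | nil =>
    constructor
    · intro h
      cases h
      exact ⟨trivial, rfl⟩
    · rintro ⟨-, rfl⟩
      exact .nil _
  | cons e y ih =>
    constructor
    · intro h
      cases h with
      | cons h1 h2 =>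
        obtain ⟨h3, rfl⟩ := (hc.step_iff hk hl hL hne).1 h1
        obtain ⟨h4, rfl⟩ := (ih (hc.next hk hl hL h3)).1 h2
        exact ⟨⟨h3, h4⟩, rfl⟩
    · rintro ⟨⟨h3, h4⟩, rfl⟩
      exact .cons ((hc.step_iff hk hl hL hne).2 ⟨h3, rfl⟩)
        ((ih (hc.next hk hl hL h3)).2 ⟨h4, rfl⟩)

variable (s k l) in
/-- The stream leads from the configuration `c` to the final state. -/
def Completes {α : Type*} (c : NState s σ × List (NState s σ)) (y : List (Event σ α)) : Prop :=
  vconfig (y.foldl (nextConfig k l) c) = (.final, [])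

theorem mem_language_observed (hk : 1 ≤ k) (hl : s = Scheme.ancestor → 1 ≤ l)
    (hL : ∀ w ∈ L, IsDocument a w) (hne : L.Nonempty) {y : TypedStream σ T} :
    y ∈ (toXVPA (observed s k l dts L)).language ↔
      Follows s k l dts L (initState s, []) y ∧ Completes s k l (initState s, []) y := by
  have h : vconfig (initState s, []) = ((.start, []) : VState (NState s σ) × _) := by
    simp [vconfig, vstate_init]
  rw [DXVPA.language, Set.mem_ofPred_eq, ← h, Reached.run_iff hk hl hL hne .init, Completes,
    @eq_comm _ (VState.final, _)]

end Observed
end XMLLearner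

namespace XMLLearner

/-! ### Inferred datatypes, maximal datatypes and subsumption. -/

section Datatypes

variable {T K : Type*} [PartialOrder K] {dts : DatatypeSystem T K}

namespace DatatypeSystem

/-- `top` accepts `t` and `T` is finite, so some accepting lexical space is minimal, and among these
some kind is minimal. -/
theorem minReq_nonempty [Finite T] (t : Text) : (dts.minReq t).Nonempty := by
  obtain ⟨τ, hτ, hmin⟩ := (Set.toFinite {τ | t ∈ dts.φ τ}).exists_minimalFor dts.φ _
    ⟨dts.top, by rw [Set.mem_ofPred_eq, dts.φ_top]; trivial⟩
  have h : (dts.minLex t).Nonempty :=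
    ⟨τ, hτ, fun τ' h h' => h.not_ge (hmin h' h.le)⟩
  obtain ⟨τ, hτ, hmin⟩ := (Set.toFinite (dts.minLex t)).exists_minimalFor dts.kind _ h
  exact ⟨τ, hτ, fun ⟨τ', h, h'⟩ => h'.not_ge (hmin h h'.le)⟩

theorem mem_of_mem_minReq {t : Text} {τ : T} (h : τ ∈ dts.minReq t) : t ∈ dts.φ τ := h.1.1

theorem exists_maxLex [Finite T] {R : Set T} {τ : T} (h : τ ∈ R) :
    ∃ τ' ∈ dts.maxLex R, dts.φ τ ≤ dts.φ τ' := by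
  obtain ⟨τ', hτ', hmax⟩ := (Set.toFinite {τ' ∈ R | dts.φ τ ≤ dts.φ τ'}).exists_maximalFor dts.φ _
    ⟨τ, h, le_rfl⟩
  exact ⟨τ', ⟨hτ'.1, fun ⟨τ'', h1, h2⟩ => h2.not_ge (hmax ⟨h1, hτ'.2.trans h2.le⟩ h2.le)⟩, hτ'.2⟩

/-- Adding datatypes that are subsumed by maximal ones does not change the maximal ones. -/
theorem maxLex_eq_of_subsumed {R R' : Set T} (h : R ⊆ R')
    (h' : ∀ τ ∈ R', ∃ τ' ∈ dts.maxLex R, dts.φ τ ≤ dts.φ τ') : dts.maxLex R' = dts.maxLex R := by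
  ext τ
  constructor
  · rintro ⟨h1, h2⟩
    obtain ⟨τ', h3, h4⟩ := h' τ h1
    rcases h4.eq_or_lt with h5 | h5
    -- Distinct datatypes have distinct lexical spaces.
    · rwa [dts.distinct h5]
    · exact (h2 ⟨τ', h h3.1, h5⟩).elim
  · rintro ⟨h1, h2⟩
    refine ⟨h h1, fun ⟨τ', h3, h4⟩ => ?_⟩
    obtain ⟨τ'', h5, h6⟩ := h' τ' h3
    exact h2 ⟨τ'', h5.1, h4.trans_le h6⟩

variable {σ : Type*}

theorem Corresponds.trans_subsumed {w : Stream σ} {x y : TypedStream σ T}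
    (h : dts.Corresponds w x) (h' : dts.Subsumed x y) : dts.Corresponds w y := by
  unfold Corresponds at *
  induction h generalizing y with
  | nil => cases h'; exact .nil
  | cons h1 _ ih =>
    cases h' with
    | cons h2 h3 =>
      refine .cons ?_ (ih h3)
      cases h1 <;> cases h2 <;> constructor
      rename_i h1 _ h2
      exact h2 h1

theorem Subsumed.trans {x y z : TypedStream σ T} (h : dts.Subsumed x y) (h' : dts.Subsumed y z) :
    dts.Subsumed x z := by
  unfold Subsumed at *
  induction h generalizing z with
  | nil => cases h'; exact .nil
  | cons h1 _ ih =>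
    cases h' with
    | cons h2 h3 =>
      refine .cons ?_ (ih h3)
      cases h1 <;> cases h2 <;> constructor
      rename_i h1 _ h2
      exact h1.trans h2

theorem IsInstance.corresponds {w : Stream σ} {x : TypedStream σ T}
    (h : IsInstance (dts.dtyped w) x) : dts.Corresponds w x := by
  unfold IsInstance dtyped at h
  rw [List.forall₂_map_left_iff] at h
  refine h.imp fun e f hef => ?_
  cases e <;> cases hef <;> constructor
  rename_i h
  exact mem_of_mem_minReq h

theorem exists_isInstance [Finite T] (w : Stream σ) :
    ∃ x, IsInstance (dts.dtyped w) x := by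
  induction w with
  | nil => exact ⟨[], .nil⟩
  | cons e w ih =>
    obtain ⟨x, hx⟩ := ih
    cases e with
    | startElement a => exact ⟨_, .cons (.startElement a) hx⟩
    | endElement a => exact ⟨_, .cons (.endElement a) hx⟩
    | characters t =>
      obtain ⟨τ, hτ⟩ := dts.minReq_nonempty t
      exact ⟨_, .cons (.characters hτ) hx⟩

end DatatypeSystem

namespace DXVPA

variable {C S C' S' σ : Type*} {A : DXVPA C S σ T} {A' : DXVPA C' S' σ T}

/-- Inclusion of the datatyped languages would be too strong, as learning may replace a datatype by
a larger one; inclusion up to subsumption suffices. -/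
theorem docLanguage_mono (h : ∀ y ∈ A.language, ∃ y' ∈ A'.language, dts.Subsumed y y') :
    A.docLanguage dts ⊆ A'.docLanguage dts := by
  rintro w ⟨x, hx, hw⟩
  obtain ⟨y, hy, hxy⟩ := h x hx
  exact ⟨y, hy, hw.trans_subsumed hxy⟩

theorem inferredLanguage_mono (h : ∀ y ∈ A.language, ∃ y' ∈ A'.language, dts.Subsumed y y') :
    A.inferredLanguage dts ⊆ A'.inferredLanguage dts := by
  intro w hw x hx
  obtain ⟨y, hy, hxy⟩ := hw x hx
  obtain ⟨y', hy', hyy⟩ := h y hy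
  exact ⟨y', hy', hxy.trans hyy⟩

end DXVPA

end Datatypes

/-! ### Monotonicity and consistency of the hypothesis. -/

section Hypothesis

variable {σ : Type u} {T K : Type*} [PartialOrder K] {s : Scheme} {k l : ℕ}
  {dts : DatatypeSystem T K} {L : Set (Stream σ)} {a : σ}

theorem Follows.permitted {α : Type*} {R : α → T → Prop} {x y : List (Event σ α)} {e : Event σ α}
    {v : TypedStream σ T} {c : NState s σ × List (NState s σ)} (h : Follows s k l dts L c v)
    (hv : List.Forall₂ (Event.Rel R) (x ++ e :: y) v) :
    ∃ e', Event.Rel R e e' ∧ Permitted s k l dts L (x.foldl (nextConfig k l) c) e' := by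
  induction x generalizing c v with
  | nil =>
    cases hv with
    | cons h1 h2 => exact ⟨_, h1, h.1⟩
  | cons f x ih =>
    cases hv with
    | @cons _ f' _ v h1 h2 =>
      obtain ⟨e', h3, h4⟩ := ih h.2 h2
      refine ⟨e', h3, ?_⟩
      have h5 : List.Forall₂ (Event.Rel R) [f] [f'] := .cons h1 .nil
      have h6 := foldl_nextConfig_forall₂ (k := k) (l := l) h5 c
      simp only [List.foldl_cons, List.foldl_nil] at h6
      rw [List.foldl_cons, h6]
      exact h4

theorem OccursAt.mono {L' : Set (Stream σ)} (hLL : L ⊆ L') {q : NState s σ} {e : Event σ Text}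
    (h : OccursAt s k l L q e) : OccursAt s k l L' q e := by
  obtain ⟨x, y, hw, hx⟩ := h
  exact ⟨x, y, hLL hw, hx⟩

theorem PopsAt.mono {L' : Set (Stream σ)} (hLL : L ⊆ L') {q p : NState s σ} {c : σ}
    (h : PopsAt s k l L q c p) : PopsAt s k l L' q c p := by
  obtain ⟨x, y, z, hw, hx⟩ := h
  exact ⟨x, y, z, hLL hw, hx⟩

theorem visited_mono {L' : Set (Stream σ)} (hLL : L ⊆ L') :
    visited s k l L ⊆ visited s k l L' := by
  rintro q ⟨x, e, y, hw, hx⟩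
  exact ⟨x, e, y, hLL hw, hx⟩

theorem inferredAt_mono {L' : Set (Stream σ)} (hLL : L ⊆ L') (q : NState s σ) :
    inferredAt s k l L dts q ⊆ inferredAt s k l L' dts q := by
  rintro τ ⟨t, ht, hτ⟩
  exact ⟨t, ht.mono hLL, hτ⟩

/-- A datatype maximal for `L` need not be maximal for `L'`, but lies below one that is, and
exchanging them leaves the named states unchanged. -/
theorem Follows.mono [Finite T] {L' : Set (Stream σ)} (hLL : L ⊆ L') {y : TypedStream σ T}
    {c : NState s σ × List (NState s σ)} (h : Follows s k l dts L c y) :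
    ∃ y', dts.Subsumed y y' ∧ Follows s k l dts L' c y' := by
  induction y generalizing c with
  | nil => exact ⟨[], .nil, trivial⟩
  | cons e y ih =>
    obtain ⟨y', h1, h2⟩ := ih h.2
    have h0 := h.1
    obtain ⟨q, z⟩ := c
    cases e with
    | startElement b =>
      exact ⟨_, .cons (.startElement b) h1, OccursAt.mono hLL h0, h2⟩
    | endElement b =>
      obtain ⟨⟨d, p, h3⟩, p', z', r, h4, h5, h6⟩ := h0
      exact ⟨_, .cons (.endElement b) h1,
        ⟨⟨d, p, h3.mono hLL⟩, p', z', r, h4, h5, h6.mono hLL⟩, h2⟩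
    | characters τ =>
      obtain ⟨τ', h3, h4⟩ := dts.exists_maxLex (inferredAt_mono hLL q h0.1)
      refine ⟨.characters τ' :: y', .cons (.characters h4) h1, h3, ?_⟩
      rw [nextConfig_characters] at h2 ⊢
      exact h2

theorem Completes.of_forall₂ {α β : Type*} {R : α → β → Prop} {c : NState s σ × List (NState s σ)}
    {x : List (Event σ α)} {y : List (Event σ β)} (h : Completes s k l c x)
    (hxy : List.Forall₂ (Event.Rel R) x y) : Completes s k l c y := by
  rwa [Completes, ← foldl_nextConfig_forall₂ hxy]

theorem language_observed_mono [Finite T] (hk : 1 ≤ k) (hl : s = Scheme.ancestor → 1 ≤ l)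
    {L' : Set (Stream σ)} (hLL : L ⊆ L') (hL : ∀ w ∈ L', IsDocument a w) (hne : L.Nonempty) :
    ∀ y ∈ (toXVPA (observed s k l dts L)).language,
      ∃ y' ∈ (toXVPA (observed s k l dts L')).language, dts.Subsumed y y' := by
  intro y hy
  obtain ⟨h1, h2⟩ := (mem_language_observed hk hl (fun w hw => hL w (hLL hw)) hne).1 hy
  obtain ⟨y', h3, h4⟩ := h1.mono hLL
  exact ⟨y', (mem_language_observed hk hl hL (hne.mono hLL)).2 ⟨h4, h2.of_forall₂ h3⟩, h3⟩

/-- Each event is permitted because `v ++ w` itself witnesses it; the prefix `v` is the parameter of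
an induction on `w`. -/
theorem exists_follows [Finite T] (hL : ∀ w ∈ L, IsDocument a w) {w v : Stream σ}
    (hw : v ++ w ∈ L) {x : TypedStream σ T}
    (hx : DatatypeSystem.IsInstance (dts.dtyped w) x) :
    ∃ y, dts.Subsumed x y ∧
      Follows s k l dts L (v.foldl (nextConfig k l) (initState s, [])) y := by
  induction w generalizing v x with
  | nil =>
    cases hx
    exact ⟨[], .nil, trivial⟩
  | cons e w ih =>
    cases hx with
    | cons h1 h2 =>
      obtain ⟨y, h3, h4⟩ := ih (v := v ++ [e]) (by simpa using hw) h2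
      rw [List.foldl_append, List.foldl_cons, List.foldl_nil] at h4
      cases e with
      | startElement b =>
        cases h1
        exact ⟨.startElement b :: y, .cons (.startElement b) h3, ⟨v, w, hw, rfl⟩, h4⟩
      | endElement b =>
        cases h1
        refine ⟨.endElement b :: y, .cons (.endElement b) h3, ?_⟩
        rcases (hL _ hw).event_config (s := s) (k := k) (l := l) hw rfl with
          ⟨-, he⟩ | ⟨-, os, q, z, h5, -, h6⟩
        · cases he
        · obtain ⟨_, _, p, z', -, rfl, -⟩ := h6.exists_cons
          rw [h5, nextConfig_endElement] at h4
          rw [h5]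
          have h7 : PopsAt s k l L q b p := ⟨v, w, z', hw, h5⟩
          exact ⟨⟨⟨b, p, h7⟩, p, z', q, rfl, rfl, h7⟩, h4⟩
      | characters t =>
        cases h1 with
        | characters h1 =>
          have h5 : OccursAt s k l L (v.foldl (nextConfig k l) (initState s, [])).1
              (.characters t) := ⟨v, w, hw, rfl⟩
          obtain ⟨τ', h6, h7⟩ := dts.exists_maxLex
            (show _ ∈ inferredAt s k l L dts _ from ⟨t, h5, h1⟩)
          refine ⟨.characters τ' :: y, .cons (.characters h7) h3, h6, ?_⟩
          generalize v.foldl (nextConfig k l) (initState s, []) = c at h4 ⊢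
          obtain ⟨q, z⟩ := c
          rw [nextConfig_characters] at h4 ⊢
          exact h4

theorem IsDocument.completes (hk : 1 ≤ k) {w : Stream σ} (hd : IsDocument a w) :
    Completes s k l (initState s, []) w := by
  have hw : w ≠ [] := by
    obtain ⟨⟨x, -, rfl⟩, -⟩ := hd
    simp
  -- The document serves as its own one-element language and is read to the end.
  obtain ⟨os, q, z, h1, h2, h3⟩ := hd.prefix_config (s := s) (k := k) (l := l)
    (Set.mem_singleton w) (List.append_nil w).symm hw
  rw [Completes, h1]
  rcases h3 with ⟨-, rfl, r, rfl⟩ | h3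
  · simp [vconfig, vstate_ret hk]
  · obtain ⟨_, _, _, _, rfl, -⟩ := h3.exists_cons
    obtain ⟨x, y', -, h, -⟩ := h2
    simp at h

/-- Every datatyped form of a document of `L` is subsumed by an accepted stream. -/
theorem exists_mem_language_observed [Finite T] (hk : 1 ≤ k) (hl : s = Scheme.ancestor → 1 ≤ l)
    (hL : ∀ w ∈ L, IsDocument a w) {w : Stream σ} (hw : w ∈ L) {x : TypedStream σ T}
    (hx : DatatypeSystem.IsInstance (dts.dtyped w) x) :
    ∃ y ∈ (toXVPA (observed s k l dts L)).language, dts.Subsumed x y := by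
  obtain ⟨y, h1, h2⟩ := exists_follows (s := s) (k := k) (l := l) hL (v := []) hw hx
  exact ⟨y, (mem_language_observed hk hl hL ⟨w, hw⟩).2
    ⟨h2, ((hL w hw).completes hk).of_forall₂ hx.corresponds |>.of_forall₂ h1⟩, h1⟩

theorem subset_languages_observed [Finite T] (hk : 1 ≤ k) (hl : s = Scheme.ancestor → 1 ≤ l)
    (hL : ∀ w ∈ L, IsDocument a w) :
    L ⊆ (toXVPA (observed s k l dts L)).docLanguage dts ∧
      L ⊆ (toXVPA (observed s k l dts L)).inferredLanguage dts := by
  constructor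
  · intro w hw
    obtain ⟨x, hx⟩ := dts.exists_isInstance w
    obtain ⟨y, hy, hxy⟩ := exists_mem_language_observed (dts := dts) hk hl hL hw hx
    exact ⟨y, hy, hx.corresponds.trans_subsumed hxy⟩
  · intro w hw x hx
    exact exists_mem_language_observed hk hl hL hw hx

/-! ### Accepted streams are documents -/

/-- The last sibling symbol reveals the preceding event: there is none after a start tag, and it is
a name after an end tag. So the text would directly follow another text. -/
theorem OccursAt.not_after_text (hk : 1 ≤ k) (hL : ∀ w ∈ L, IsDocument a w) {q : NState s σ}
    {t : Text} (h : OccursAt s k l L (intName k q) (.characters t)) : False := by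
  obtain ⟨x, y, hw, hx⟩ := h
  have hnil : (intName k q).2 ≠ [] := by
    rw [intName, rtake_concat hk]
    simp
  rcases List.eq_nil_or_concat' x with rfl | ⟨x, e, rfl⟩
  · exact hnil (congrArg Prod.snd hx).symm
  · rw [stateAfter, List.foldl_append, List.foldl_cons, List.foldl_nil] at hx
    cases e with
    | startElement b =>
      exact hnil (by rw [← hx, ← Prod.mk.eta (p := List.foldl _ _ x), nextConfig_startElement]; rfl)
    | characters t' =>
      have h := (hL _ hw).2
      rw [List.append_assoc, List.singleton_append] at h
      have h := List.isChain_cons_cons.1 (List.isChain_append.1 h).2.1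
      exact h.1 ⟨trivial, trivial⟩
    | endElement b =>
      rw [List.append_assoc, List.singleton_append] at hw
      rcases (hL _ hw).event_config (s := s) (k := k) (l := l) hw rfl with
        ⟨-, he⟩ | ⟨-, os, r, z, h1, -, h2⟩
      · cases he
      · obtain ⟨_, _, p, z', -, rfl, -⟩ := h2.exists_cons
        rw [h1, nextConfig_endElement] at hx
        exact intName_ne_retName hk q r p b hx.symm

theorem Follows.isChain (hk : 1 ≤ k) (hL : ∀ w ∈ L, IsDocument a w) {R : Text → T → Prop}
    {w : Stream σ} {y : TypedStream σ T} {c : NState s σ × List (NState s σ)}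
    (h : Follows s k l dts L c y) (hwy : List.Forall₂ (Event.Rel R) w y) :
    w.IsChain (fun e f => ¬ (e.IsCharacters ∧ f.IsCharacters)) := by
  induction hwy generalizing c with
  | nil => exact .nil
  | cons h1 h2 ih =>
    have ih' := ih h.2
    cases h2 with
    | nil => exact .singleton _
    | cons h3 h4 =>
      refine List.isChain_cons_cons.2 ⟨?_, ih'⟩
      rintro ⟨h5, h6⟩
      cases h1 with
      | startElement => exact h5
      | endElement => exact h5
      | characters =>
        cases h3 with
        | startElement => exact h6
        | endElement => exact h6
        | characters =>
          have h7 := h.2.1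
          obtain ⟨q, z⟩ := c
          rw [nextConfig_characters] at h7
          obtain ⟨t, ht, -⟩ := h7.1
          exact ht.not_after_text hk hL

/-- The context fixes the innermost open element, so a permitted end tag closes exactly that one.
The stream cannot complete inside an element, and nothing is permitted after the root. -/
theorem Linked.closes (hk : 1 ≤ k) (hl : s = Scheme.ancestor → 1 ≤ l)
    (hL : ∀ w ∈ L, IsDocument a w) {R : Text → T → Prop} {w : Stream σ} {y : TypedStream σ T}
    {os : List σ} {q : NState s σ} {z : List (NState s σ)} (hc : Linked s k l L a os q z)
    (h : Follows s k l dts L (q, z) y) (h' : Completes s k l (q, z) y)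
    (hwy : List.Forall₂ (Event.Rel R) w y) : Closes os w := by
  induction hwy generalizing os q z with
  | nil =>
    have h' := congrArg Prod.fst h'
    simp [vconfig, vstate_inner (hc.ne_empty hl)] at h'
  | cons h1 h2 ih =>
    have h3 := h.1
    have h4 := h.2
    rw [Completes, List.foldl_cons] at h'
    obtain ⟨c, os', p, z', rfl, rfl, h5, h6, h7⟩ := hc.exists_cons
    cases h1 with
    | startElement b =>
      rw [nextConfig_startElement] at h4 h'
      exact (ih (hc.startElement h3) h4 h').startElement
    | characters =>
      rw [nextConfig_characters] at h4 h'
      exact (ih (hc.congr (q' := intName k q) rfl) h4 h').characters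
    | endElement b =>
      rw [nextConfig_endElement] at h4 h'
      obtain ⟨-, p', z'', r, h8, hr, hb⟩ := h3
      cases h8
      obtain rfl : b = c := Ctx.extend_inj hk hl (((hb.spec hL).1.symm.trans hr).trans h5)
      rcases h7 with ⟨rfl, rfl, rfl, rfl⟩ | h7
      · refine Closes.endElement ?_
        cases h2 with
        | nil => rfl
        | @cons e f w' y' h9 h10 =>
          have h11 := h4.1
          cases h9 with
          | startElement b => exact (not_occursAt_final hk hl hL (r := q) h11).elim
          | endElement b =>
            obtain ⟨-, p, z, r, h, -⟩ := h11
            cases h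
          | characters =>
            obtain ⟨t, ht, -⟩ := h11.1
            exact (not_occursAt_final hk hl hL (r := q) ht).elim
      · exact (ih (h7.congr (q' := retName k q p b) rfl) h4 h').endElement

theorem isDocument_of_mem_language (hk : 1 ≤ k) (hl : s = Scheme.ancestor → 1 ≤ l)
    (hL : ∀ w ∈ L, IsDocument a w) {R : Text → T → Prop} {w : Stream σ} {y : TypedStream σ T}
    (h : Follows s k l dts L (initState s, []) y) (h' : Completes s k l (initState s, []) y)
    (hwy : List.Forall₂ (Event.Rel R) w y) : IsDocument a w := by
  refine ⟨?_, h.isChain hk hL hwy⟩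
  cases hwy with
  | nil =>
    have h' := congrArg Prod.fst h'
    simp [vconfig, vstate_init] at h'
  | cons h1 h2 =>
    have h3 := h.1
    have h4 := h.2
    rw [Completes, List.foldl_cons] at h'
    cases h1 with
    | startElement b =>
      have h3 : OccursAt s k l L (initState s) (.startElement b) := h3
      cases h3.eq_root hl hL
      rw [nextConfig_startElement] at h4 h'
      obtain ⟨x, y', hx, rfl, rfl⟩ := (Linked.root h3 rfl).closes hk hl hL h4 h' h2
      exact ⟨x, hx, rfl⟩
    | characters =>
      obtain ⟨t, ht, -⟩ := h3.1
      cases OccursAt.eq_root hl hL ht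
    | endElement b =>
      obtain ⟨-, p', z'', r, h8, -⟩ := h3
      cases h8

/-- What acceptance of `w` by the hypothesis says about its events. -/
theorem mem_docLanguage_observed (hk : 1 ≤ k) (hl : s = Scheme.ancestor → 1 ≤ l)
    (hL : ∀ w ∈ L, IsDocument a w) (hne : L.Nonempty) {w : Stream σ}
    (h : w ∈ (toXVPA (observed s k l dts L)).docLanguage dts) :
    IsDocument a w ∧ ∀ x e y, w = x ++ e :: y → ∃ e' : Event σ T,
      Event.Rel (fun t τ => t ∈ dts.φ τ) e e' ∧
        Permitted s k l dts L (x.foldl (nextConfig k l) (initState s, [])) e' := by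
  obtain ⟨y, hy, hwy⟩ := h
  obtain ⟨h1, h2⟩ := (mem_language_observed hk hl hL hne).1 hy
  refine ⟨isDocument_of_mem_language hk hl hL h1 h2 hwy, ?_⟩
  rintro x e y rfl
  exact h1.permitted hwy

theorem mem_inferredLanguage_observed [Finite T] (hk : 1 ≤ k) (hl : s = Scheme.ancestor → 1 ≤ l)
    (hL : ∀ w ∈ L, IsDocument a w) (hne : L.Nonempty) {w : Stream σ}
    (h : w ∈ (toXVPA (observed s k l dts L)).inferredLanguage dts) :
    IsDocument a w ∧ ∀ x e y, w = x ++ e :: y →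
      ∀ e' : Event σ T, Event.Rel (fun t τ => τ ∈ dts.minReq t) e e' → ∃ e'' : Event σ T,
      Event.Rel (fun τ τ' => dts.φ τ ≤ dts.φ τ') e' e'' ∧
        Permitted s k l dts L (x.foldl (nextConfig k l) (initState s, [])) e'' := by
  constructor
  · obtain ⟨x, hx⟩ := dts.exists_isInstance w
    obtain ⟨y, hy, hxy⟩ := h x hx
    obtain ⟨h1, h2⟩ := (mem_language_observed hk hl hL hne).1 hy
    exact isDocument_of_mem_language hk hl hL h1 h2 (hx.corresponds.trans_subsumed hxy)
  · rintro x e y rfl e' he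
    -- The datatype prescribed at this position is extended to an instance of the whole document by
    -- arbitrary choices elsewhere.
    obtain ⟨x', hx⟩ := dts.exists_isInstance x
    obtain ⟨y', hy⟩ := dts.exists_isInstance y
    have he' : Event.Rel (fun (R : Set T) (τ : T) => τ ∈ R) (e.mapChars dts.minReq) e' := by
      cases he <;> constructor
      assumption
    have hi : DatatypeSystem.IsInstance (dts.dtyped (x ++ e :: y)) (x' ++ e' :: y') := by
      rw [DatatypeSystem.dtyped, List.map_append, List.map_cons]
      exact List.rel_append hx (.cons he' hy)
    obtain ⟨v, hv, hsub⟩ := h _ hi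
    obtain ⟨h1, h2⟩ := (mem_language_observed hk hl hL hne).1 hv
    rw [foldl_nextConfig_forall₂ hx.corresponds]
    exact h1.permitted hsub

/-! ### Conservativity -/

/-- Of the returns, `toXVPA` sees only which states have one and which are available somewhere in a
context. Conservativity needs this latitude: an accepted document may combine an exit state with a
popped state never observed together. -/
theorem toXVPA_congr {V V' : InterVPA (NState s σ) σ T} (hn : V.names = V'.names)
    (hs : V.states = V'.states)
    (hcall : ∀ q c q', Trans.call q c q' ∈ V.trans ↔ Trans.call q c q' ∈ V'.trans)
    (hint : ∀ q τ q', Trans.int q τ q' ∈ V.trans ↔ Trans.int q τ q' ∈ V'.trans)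
    (hexit : ∀ q, (∃ c p q', Trans.ret q c p q' ∈ V.trans) ↔
      ∃ c p q', Trans.ret q c p q' ∈ V'.trans)
    (hret : ∀ m c p q', (∃ r ∈ V.states, r.1 = m ∧ Trans.ret r c p q' ∈ V.trans) ↔
      ∃ r ∈ V'.states, r.1 = m ∧ Trans.ret r c p q' ∈ V'.trans) :
    toXVPA V = toXVPA V' := by
  have hμ : ∀ m, (toXVPA V).μ m = (toXVPA V').μ m := by
    intro m
    have h : (fun c => ∃ q, Trans.call q c (m, []) ∈ V.trans) =
        fun c => ∃ q, Trans.call q c (m, []) ∈ V'.trans := by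
      funext c
      simp only [hcall]
    -- `μ` is defined by a choice, which agrees only once the predicates themselves are equal.
    have key : ∀ P P' : σ → Prop, P = P' → ∀ (d : Decidable (∃ c, P c)) (d' : Decidable (∃ c, P' c)),
        (if h : ∃ c, P c then some h.choose else none) =
          if h : ∃ c, P' c then some h.choose else none := by
      rintro P _ rfl d d'
      congr
    exact key _ _ h _ _
  have hm₀ : (toXVPA V).m₀ = (toXVPA V').m₀ := by
    simp only [toXVPA, hcall]
  have htr : ∀ m, (toXVPA V).trans m = (toXVPA V').trans m := by
    intro m
    simp only [toXVPA]
    congr 1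
    · congr 1
      · ext t
        constructor <;> rintro ⟨q, c, q', rfl, h1, h2⟩
        · exact ⟨q, c, q', rfl, (hcall _ _ _).1 h1, hs ▸ h2⟩
        · exact ⟨q, c, q', rfl, (hcall _ _ _).2 h1, hs ▸ h2⟩
      · ext t
        constructor <;> rintro ⟨q, c, q', rfl, h1, h2⟩
        · exact ⟨q, c, q', rfl, (hint _ _ _).1 h1, hs ▸ h2⟩
        · exact ⟨q, c, q', rfl, (hint _ _ _).2 h1, hs ▸ h2⟩
    · ext t
      constructor <;> rintro ⟨q, c, p, q', rfl, h1, ⟨h2, h3, h4⟩, h5⟩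
      · exact ⟨q, c, p, q', rfl, h1, ⟨hs ▸ h2, h3, (hexit q).1 h4⟩, (hret _ _ _ _).1 h5⟩
      · exact ⟨q, c, p, q', rfl, h1, ⟨hs ▸ h2, h3, (hexit q).2 h4⟩, (hret _ _ _ _).2 h5⟩
  have hex : ∀ m, (toXVPA V).exits m = (toXVPA V').exits m := by
    intro m
    simp only [toXVPA, hexit, hs]
  have hmod : (toXVPA V).modules = (toXVPA V').modules := by
    simp only [toXVPA, hs]
  have hst : (toXVPA V).states = (toXVPA V').states := by
    simp only [toXVPA, hs]
  have key : ∀ A A' : DXVPA (Ctx s σ) (NState s σ) σ T, A.names = A'.names →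
      A.modules = A'.modules → A.μ = A'.μ → A.states = A'.states → A.entry = A'.entry →
      A.exits = A'.exits → A.trans = A'.trans → A.m₀ = A'.m₀ → A = A' := by
    rintro ⟨⟩ ⟨⟩ h1 h2 h3 h4 h5 h6 h7 h8
    cases h1; cases h2; cases h3; cases h4; cases h5; cases h6; cases h7; cases h8
    rfl
  exact key _ _ hn hmod (funext hμ) hst rfl (funext hex) (funext htr) hm₀

theorem OccursAt.or_of_subset {L' : Set (Stream σ)} {w : Stream σ} (h : ∀ v ∈ L', v ∈ L ∨ v = w)
    {q : NState s σ} {e : Event σ Text} (h' : OccursAt s k l L' q e) :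
    OccursAt s k l L q e ∨ ∃ x y, w = x ++ e :: y ∧ stateAfter s k l x = q := by
  obtain ⟨x, y, hw, hx⟩ := h'
  rcases h _ hw with h | h
  · exact .inl ⟨x, y, h, hx⟩
  · exact .inr ⟨x, y, h.symm, hx⟩

/-- Every event of `w` is permitted, so `w` contributes known facts, returns already covered by the
sharing among exits, and datatypes below maximal ones; `toXVPA` and `maxLex` forget the last two. -/
theorem toXVPA_observed_conservative [Finite T] (hk : 1 ≤ k) (hl : s = Scheme.ancestor → 1 ≤ l)
    {L' : Set (Stream σ)} {w : Stream σ} (hLL : L ⊆ L') (h : ∀ v ∈ L', v ∈ L ∨ v = w)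
    (hL : ∀ v ∈ L, IsDocument a v) (hne : L.Nonempty)
    (hw : w ∈ (toXVPA (observed s k l dts L)).inferredLanguage dts) :
    toXVPA (observed s k l dts L') = toXVPA (observed s k l dts L) := by
  obtain ⟨hd, hw⟩ := mem_inferredLanguage_observed hk hl hL hne hw
  have hstart : ∀ x b y, w = x ++ Event.startElement b :: y →
      OccursAt s k l L (stateAfter s k l x) (.startElement b) := by
    intro x b y hxy
    obtain ⟨e'', h1, h2⟩ := hw x _ y hxy (.startElement b) (.startElement b)
    cases h1
    exact h2
  have hend : ∀ x b y, w = x ++ Event.endElement b :: y →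
      (∃ d p, PopsAt s k l L (stateAfter s k l x) d p) ∧ ∃ p z r,
        (x.foldl (nextConfig k l) (initState s, [])).2 = p :: z ∧
        r.1 = (stateAfter s k l x).1 ∧ PopsAt s k l L r b p := by
    intro x b y hxy
    obtain ⟨e'', h1, h2⟩ := hw x _ y hxy (.endElement b) (.endElement b)
    cases h1
    exact h2
  have htext : ∀ x t y, w = x ++ Event.characters t :: y → ∀ τ ∈ dts.minReq t,
      ∃ τ' ∈ dts.maxLex (inferredAt s k l L dts (stateAfter s k l x)),
        dts.φ τ ≤ dts.φ τ' := by
    intro x t y hxy τ hτ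
    obtain ⟨e'', h1, h2⟩ := hw x _ y hxy (.characters τ) (.characters hτ)
    cases h1 with
    | characters h1 => exact ⟨_, h2, h1⟩
  have hcall : ∀ q b, OccursAt s k l L' q (.startElement b) ↔
      OccursAt s k l L q (.startElement b) := by
    refine fun q b => ⟨fun h' => ?_, fun h' => h'.mono hLL⟩
    rcases h'.or_of_subset h with h' | ⟨x, y, hxy, rfl⟩
    · exact h'
    · exact hstart x b y hxy
  have hvis : visited s k l L' = visited s k l L := by
    refine Set.Subset.antisymm ?_ (visited_mono hLL)
    rintro q ⟨x, e, y, hv, rfl⟩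
    rcases h _ hv with h | h
    · exact ⟨x, e, y, h, rfl⟩
    · have hs : stateAfter s k l (x ++ [e]) =
          (nextConfig k l (x.foldl (nextConfig k l) (initState s, [])) e).1 := by
        rw [stateAfter, List.foldl_append]
        rfl
      rw [hs]
      cases e with
      | startElement b =>
        have := (hstart x b y h.symm).callName_visited
        rwa [← Prod.mk.eta (p := List.foldl _ _ x), nextConfig_startElement]
      | endElement b =>
        obtain ⟨-, p, z, r, h1, -, h3⟩ := hend x b y h.symm
        have := (h3.spec hL).2.2.1
        rwa [← Prod.mk.eta (p := List.foldl _ _ x), h1, nextConfig_endElement]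
      | characters t =>
        -- Only an inferred datatype of `t` can lead to a text of `L` at this state.
        obtain ⟨τ, hτ⟩ := dts.minReq_nonempty t
        obtain ⟨τ', ⟨⟨t', ht', -⟩, -⟩, -⟩ := htext x t y h.symm τ hτ
        have := ht'.intName_visited
        rwa [← Prod.mk.eta (p := List.foldl _ _ x), nextConfig_characters]
  have hinf : ∀ q, dts.maxLex (inferredAt s k l L' dts q) =
      dts.maxLex (inferredAt s k l L dts q) := by
    intro q
    refine DatatypeSystem.maxLex_eq_of_subsumed (inferredAt_mono hLL q) ?_
    rintro τ ⟨t, ht, hτ⟩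
    rcases ht.or_of_subset h with h' | ⟨x, y, hxy, rfl⟩
    · exact dts.exists_maxLex ⟨t, h', hτ⟩
    · exact htext x t y hxy τ hτ
  have hpop : ∀ q b p, PopsAt s k l L' q b p →
      (∃ d p', PopsAt s k l L q d p') ∧ ∃ r, r.1 = q.1 ∧ PopsAt s k l L r b p := by
    rintro q b p ⟨x, y, z, hv, hx⟩
    rcases h _ hv with h | h
    · have h' : PopsAt s k l L q b p := ⟨x, y, z, h, hx⟩
      exact ⟨⟨b, p, h'⟩, q, rfl, h'⟩
    · have h' := hend x b y h.symm
      rw [stateAfter, hx] at h'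
      obtain ⟨h1, p', z', r, h2, h3⟩ := h'
      cases h2
      exact ⟨h1, r, h3⟩
  refine toXVPA_congr ?_ hvis ?_ ?_ ?_ ?_
  · ext b
    constructor
    · rintro ⟨v, hv, hb⟩
      rcases h v hv with h | rfl
      · exact ⟨v, h, hb⟩
      · obtain ⟨x, y, hxy⟩ := List.append_of_mem hb
        obtain ⟨x', y', hv', -⟩ := hstart x b y hxy
        exact ⟨_, hv', by simp⟩
    · rintro ⟨v, hv, hb⟩
      exact ⟨v, hLL hv, hb⟩
  · intro q c q'
    exact and_congr_left' (hcall q c)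
  · intro q τ q'
    change _ ∧ _ ↔ _ ∧ _
    rw [hinf]
  · intro q
    constructor
    · rintro ⟨c, p, q', h1, -⟩
      obtain ⟨⟨d, p', h2⟩, -⟩ := hpop q c p h1
      exact ⟨d, p', _, h2, rfl⟩
    · rintro ⟨c, p, q', h1, h2⟩
      exact ⟨c, p, q', h1.mono hLL, h2⟩
  · intro m c p q'
    constructor
    · rintro ⟨r, -, rfl, h1, rfl⟩
      obtain ⟨-, r', h2, h3⟩ := hpop r c p h1
      exact ⟨r', (h3.spec hL).2.1, h2, h3, rfl⟩
    · rintro ⟨r, h1, rfl, h2, rfl⟩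
      exact ⟨r, visited_mono hLL h1, rfl, h2.mono hLL, rfl⟩

/-! ### Local languages -/

/-- Acceptance gives, event by event, the premises of the closure condition; a permitted datatype
was inferred from a text of `L`, which then covers the given text. -/
theorem IsLocalLanguage.docLanguage_observed [Finite T] (hk : 1 ≤ k)
    (hl : s = Scheme.ancestor → 1 ≤ l) (hL : IsLocalLanguage (LexicallyCovered dts) s k l L) :
    (toXVPA (observed s k l dts L)).docLanguage dts = L := by
  obtain ⟨a, ha⟩ := hL.document
  refine Set.Subset.antisymm ?_ (subset_languages_observed hk hl ha).1
  intro w hw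
  obtain ⟨hd, hw⟩ := mem_docLanguage_observed hk hl ha hL.nonempty hw
  refine hL.closed a w hd ?_ ?_ ?_
  · intro x b y hxy
    obtain ⟨e', h1, h2⟩ := hw x _ y hxy
    cases h1
    exact h2
  · intro x b y hxy
    obtain ⟨e', h1, h2⟩ := hw x _ y hxy
    cases h1
    obtain ⟨⟨d, p, h3⟩, -⟩ := h2
    exact ⟨d, (h3.spec ha).2.2.2.1⟩
  · intro x t y hxy
    obtain ⟨e', h1, h2⟩ := hw x _ y hxy
    cases h1 with
    | characters h1 =>
      obtain ⟨⟨r, hr, hτ⟩, -⟩ := h2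
      exact ⟨r, hr, _, hτ, h1⟩

/-- Acceptance is demanded for every choice of inferred datatypes, which matches the universal
quantifier in `DatatypeCovered`. -/
theorem IsLocalLanguage.inferredLanguage_observed [Finite T] (hk : 1 ≤ k)
    (hl : s = Scheme.ancestor → 1 ≤ l) (hL : IsLocalLanguage (DatatypeCovered dts) s k l L) :
    (toXVPA (observed s k l dts L)).inferredLanguage dts = L := by
  obtain ⟨a, ha⟩ := hL.document
  refine Set.Subset.antisymm ?_ (subset_languages_observed hk hl ha).2
  intro w hw
  obtain ⟨hd, hw⟩ := mem_inferredLanguage_observed hk hl ha hL.nonempty hw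
  refine hL.closed a w hd ?_ ?_ ?_
  · intro x b y hxy
    obtain ⟨e', h1, h2⟩ := hw x _ y hxy (.startElement b) (.startElement b)
    cases h1
    exact h2
  · intro x b y hxy
    obtain ⟨e', h1, h2⟩ := hw x _ y hxy (.endElement b) (.endElement b)
    cases h1
    obtain ⟨⟨d, p, h3⟩, -⟩ := h2
    exact ⟨d, (h3.spec ha).2.2.2.1⟩
  · intro x t y hxy τ hτ
    obtain ⟨e', h1, h2⟩ := hw x _ y hxy (.characters τ) (.characters hτ)
    cases h1 with
    | characters h1 =>
      obtain ⟨⟨r, hr, hτ⟩, -⟩ := h2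
      exact ⟨r, hr, _, hτ, h1⟩

/-- Finitely many facts with witnesses in `L` have a finite set of witnesses. -/
theorem exists_finite_witnesses {β W : Type*} {B : Set β} (hB : B.Finite) {L : Set W}
    (R : β → W → Prop) (h : ∀ b ∈ B, ∃ w ∈ L, R b w) :
    ∃ F ⊆ L, F.Finite ∧ ∀ b ∈ B, ∃ w ∈ F, R b w := by
  choose f hf hR using h
  have := hB.to_subtype
  refine ⟨Set.range fun b : B => f b b.2, ?_, Set.finite_range _,
    fun b hb => ⟨_, ⟨⟨b, hb⟩, rfl⟩, hR b hb⟩⟩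
  rintro _ ⟨b, rfl⟩
  exact hf _ _

/-- A finite part of `L` determines what the learner observes. -/
theorem exists_finite_observed [Finite T] (hl : s = Scheme.ancestor → 1 ≤ l)
    (hL : ∀ w ∈ L, IsDocument a w)
    (hF : {b | ∃ w ∈ L, Event.startElement b ∈ w}.Finite) :
    ∃ F ⊆ L, F.Finite ∧ ∀ L', F ⊆ L' → L' ⊆ L →
      observed s k l dts L' = observed s k l dts L := by
  have hQ := visited_finite (s := s) (k := k) (l := l) hL hF
  have hQ' := hQ.insert (initState s)
  have hocc : ∀ {q e}, OccursAt s k l L q e → q ∈ insert (initState s) (visited s k l L) := by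
    intro q e h
    rcases h.cases_init hl hL with h | h
    · exact .inl h.1
    · exact .inr h.2.1
  have hname : ∀ {q b}, OccursAt s k l L q (.startElement b) →
      b ∈ {b | ∃ w ∈ L, Event.startElement b ∈ w} := by
    rintro q b ⟨x, y, hw, -⟩
    exact ⟨_, hw, by simp⟩
  -- Five finite families of facts determine `observed`: names, visited states, start tags, pops and
  -- inferred datatypes. Texts may be infinitely many, but only their datatypes count.
  obtain ⟨F₁, hF₁, hf₁, h₁⟩ := exists_finite_witnesses hF (fun b w => Event.startElement b ∈ w)
    fun b hb => hb
  obtain ⟨F₂, hF₂, hf₂, h₂⟩ := exists_finite_witnesses hQ (fun q w => q ∈ visited s k l {w}) (L := L)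
    (fun q ⟨x, e, y, hw, hx⟩ => ⟨_, hw, x, e, y, rfl, hx⟩)
  obtain ⟨F₃, hF₃, hf₃, h₃⟩ := exists_finite_witnesses (L := L)
    (B := {b : NState s σ × σ | OccursAt s k l L b.1 (.startElement b.2)})
    ((hQ'.prod hF).subset fun b hb => ⟨hocc hb, hname hb⟩)
    (fun b w => OccursAt s k l {w} b.1 (.startElement b.2))
    (fun b ⟨x, y, hw, hx⟩ => ⟨_, hw, x, y, rfl, hx⟩)
  obtain ⟨F₄, hF₄, hf₄, h₄⟩ := exists_finite_witnesses (L := L)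
    (B := {b : NState s σ × σ × NState s σ | PopsAt s k l L b.1 b.2.1 b.2.2})
    ((hQ.prod (hF.prod hQ')).subset fun b hb =>
      ⟨(PopsAt.spec hL hb).2.1, hname (PopsAt.spec hL hb).2.2.2.2,
        hocc (PopsAt.spec hL hb).2.2.2.2⟩)
    (fun b w => PopsAt s k l {w} b.1 b.2.1 b.2.2)
    (fun b ⟨x, y, z, hw, hx⟩ => ⟨_, hw, x, y, z, rfl, hx⟩)
  obtain ⟨F₅, hF₅, hf₅, h₅⟩ := exists_finite_witnesses (L := L)
    (B := {b : NState s σ × T | b.2 ∈ inferredAt s k l L dts b.1})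
    ((hQ'.prod (Set.toFinite Set.univ)).subset fun b ⟨t, ht, _⟩ => ⟨hocc ht, trivial⟩)
    (fun b w => b.2 ∈ inferredAt s k l {w} dts b.1)
    (fun b ⟨t, ⟨x, y, hw, hx⟩, ht⟩ => ⟨_, hw, t, ⟨x, y, rfl, hx⟩, ht⟩)
  refine ⟨F₁ ∪ F₂ ∪ F₃ ∪ F₄ ∪ F₅, by simp [*], by simp [*], fun L' hFL hLL => ?_⟩
  simp only [Set.union_subset_iff] at hFL
  obtain ⟨⟨⟨⟨g₁, g₂⟩, g₃⟩, g₄⟩, g₅⟩ := hFL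
  have hvis : visited s k l L' = visited s k l L := by
    refine Set.Subset.antisymm (visited_mono hLL) fun q hq => ?_
    obtain ⟨w, hw, h⟩ := h₂ q hq
    exact visited_mono (Set.singleton_subset_iff.2 (g₂ hw)) h
  have hcall : ∀ q b, OccursAt s k l L' q (.startElement b) ↔
      OccursAt s k l L q (.startElement b) := by
    refine fun q b => ⟨fun h => h.mono hLL, fun h => ?_⟩
    obtain ⟨w, hw, h⟩ := h₃ (q, b) h
    exact h.mono (Set.singleton_subset_iff.2 (g₃ hw))
  have hpop : ∀ q b p, PopsAt s k l L' q b p ↔ PopsAt s k l L q b p := by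
    refine fun q b p => ⟨fun h => h.mono hLL, fun h => ?_⟩
    obtain ⟨w, hw, h⟩ := h₄ (q, b, p) h
    exact h.mono (Set.singleton_subset_iff.2 (g₄ hw))
  have hinf : ∀ q, inferredAt s k l L' dts q = inferredAt s k l L dts q := by
    refine fun q => Set.Subset.antisymm (inferredAt_mono hLL q) fun τ hτ => ?_
    obtain ⟨w, hw, h⟩ := h₅ (q, τ) hτ
    exact inferredAt_mono (Set.singleton_subset_iff.2 (g₅ hw)) q h
  have hnames : {b | ∃ w ∈ L', Event.startElement b ∈ w} =
      {b | ∃ w ∈ L, Event.startElement b ∈ w} := by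
    ext b
    constructor
    · rintro ⟨w, hw, h⟩
      exact ⟨w, hLL hw, h⟩
    · intro hb
      obtain ⟨w, hw, h⟩ := h₁ b hb
      exact ⟨w, g₁ hw, h⟩
  simp only [observed, hnames, hvis, hcall, hpop, hinf]

/-! ### The learner -/

theorem learn_eq (dts : DatatypeSystem T K) (sel : FoldRule s σ T) {E : List (Stream σ)}
    (hE : ∀ w ∈ E, ∃ a, IsDocument a w) :
    learn k l dts sel E = (toXVPA (observed s k l dts {w | w ∈ E})).minimize sel := by
  rw [learn, genXVPA, toXVPA_trim_memory dts hE]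

theorem finite_names_list (E : List (Stream σ)) :
    {b | ∃ w ∈ {w | w ∈ E}, Event.startElement b ∈ w}.Finite := by
  have h : {b | ∃ w ∈ {w | w ∈ E}, Event.startElement b ∈ w} =
      ⋃ w ∈ {w | w ∈ E}, {b | Event.startElement b ∈ w} := by
    ext b
    simp
  rw [h]
  refine E.finite_toSet.biUnion fun w _ => ?_
  exact w.finite_toSet.preimage (f := Event.startElement) fun _ _ _ _ h => by cases h; rfl

theorem IsSample.nonempty {E : List (Stream σ)} (h : IsSample E) : {w | w ∈ E}.Nonempty :=
  List.exists_mem_of_ne_nil E h.1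

theorem IsSample.learn_spec (hk : 1 ≤ k) (hl : s = Scheme.ancestor → 1 ≤ l)
    (dts : DatatypeSystem T K) (sel : FoldRule s σ T) {E : List (Stream σ)} (h : IsSample E) :
    learn k l dts sel E = (toXVPA (observed s k l dts {w | w ∈ E})).minimize sel ∧
      (learn k l dts sel E).Coherent ∧
      (learn k l dts sel E).language = (toXVPA (observed s k l dts {w | w ∈ E})).language := by
  obtain ⟨a, ha⟩ := h.2
  have h1 := learn_eq (k := k) (l := l) dts sel fun w hw => ⟨a, ha w hw⟩
  rw [h1]
  exact ⟨rfl, (observed_coherent hk hl ha h.nonempty (finite_names_list E)).minimize sel⟩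

theorem DXVPA.docLanguage_congr {C S C' S' : Type*} {A : DXVPA C S σ T} {A' : DXVPA C' S' σ T}
    (h : A.language = A'.language) : A.docLanguage dts = A'.docLanguage dts := by
  unfold DXVPA.docLanguage
  rw [h]

theorem DXVPA.inferredLanguage_congr {C S C' S' : Type*} {A : DXVPA C S σ T}
    {A' : DXVPA C' S' σ T} (h : A.language = A'.language) :
    A.inferredLanguage dts = A'.inferredLanguage dts := by
  unfold DXVPA.inferredLanguage
  rw [h]

theorem isSample_range {E : ℕ → Stream σ} (hE : ∀ i, IsDocument a (E i)) (i : ℕ) :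
    IsSample ((List.range (i + 1)).map E) := by
  refine ⟨by simp, a, fun w hw => ?_⟩
  obtain ⟨j, -, rfl⟩ := List.mem_map.1 hw
  exact hE j

/-- On an enumeration of a language over finitely many names the learner converges to the
hypothesis of the whole language. -/
theorem learn_converges [Finite T] (hl : s = Scheme.ancestor → 1 ≤ l)
    (dts : DatatypeSystem T K) (sel : FoldRule s σ T) (hL : ∀ w ∈ L, IsDocument a w)
    (hF : {b | ∃ w ∈ L, Event.startElement b ∈ w}.Finite) {E : ℕ → Stream σ}
    (hE : Set.range E = L) :
    ∃ N, ∀ j ≥ N, learn k l dts sel ((List.range (j + 1)).map E) =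
      (toXVPA (observed s k l dts L)).minimize sel := by
  obtain ⟨F, hFL, hF', h⟩ := exists_finite_observed (dts := dts) (k := k) hl hL hF
  have hF'' : ∀ w ∈ F, ∃ i, E i = w := fun w hw => by
    have := hFL hw
    rwa [← hE] at this
  -- `f` locates each witness in the enumeration, and `N` bounds these positions.
  choose! f hf using hF''
  obtain ⟨N, hN⟩ := (hF'.image f).bddAbove
  refine ⟨N, fun j hj => ?_⟩
  have hd : ∀ w ∈ (List.range (j + 1)).map E, w ∈ L := by
    intro w hw
    obtain ⟨i, -, rfl⟩ := List.mem_map.1 hw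
    exact hE ▸ ⟨i, rfl⟩
  rw [learn_eq dts sel fun w hw => ⟨a, hL w (hd w hw)⟩,
    h {w | w ∈ (List.range (j + 1)).map E} ?_ hd]
  intro w hw
  refine List.mem_map.2 ⟨f w, List.mem_range.2 ?_, hf w hw⟩
  have := hN ⟨w, hw, rfl⟩
  omega

/-- Both classes are treated at once: `lang` depends only on the datatyped language, so it does not
notice minimization. -/
theorem identifiesInLimit_of_observed [Finite T] (hk : 1 ≤ k) (hl : s = Scheme.ancestor → 1 ≤ l)
    (dts : DatatypeSystem T K) (sel : FoldRule s σ T)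
    {lang : DXVPA (Ctx s σ) (NState s σ) σ T → Set (Stream σ)}
    (hlang : ∀ A A', A.language = A'.language → lang A = lang A') {𝓛 : Set (Set (Stream σ))}
    (h𝓛 : ∀ L ∈ 𝓛, L.Nonempty ∧ (∃ a, ∀ w ∈ L, IsDocument a w) ∧
      {b | ∃ w ∈ L, Event.startElement b ∈ w}.Finite ∧
      lang (toXVPA (observed s k l dts L)) = L) :
    IdentifiesInLimit (learn k l dts sel) {D | D.Valid} lang 𝓛 := by
  intro L hL E hE
  obtain ⟨hne, ⟨a, ha⟩, hF, hlL⟩ := h𝓛 L hL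
  have hE' : ∀ i, IsDocument a (E i) := fun i => ha _ (hE ▸ ⟨i, rfl⟩)
  obtain ⟨N, hN⟩ := learn_converges (k := k) hl dts sel ha hF hE
  refine ⟨fun i => ((isSample_range hE' i).learn_spec hk hl dts sel).2.1.toValid, N, ?_, ?_⟩
  · rw [hN N le_rfl, hlang _ _ ((observed_coherent hk hl ha hne hF).minimize sel).2, hlL]
  · intro j hj
    rw [hN j hj, hN N le_rfl]

end Hypothesis

end XMLLearner

open XMLLearner in
theorem theorem2 {σ : Type u} {T : Type v} {K : Type w} [Finite T] [PartialOrder K] (dts : DatatypeSystem T K)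
    (s : Scheme) (k l : ℕ) (hk : 1 ≤ k) (hl : s = Scheme.ancestor → 1 ≤ l)
    (sel : FoldRule s σ T) (hsel : DXVPA.IsFoldStrategy sel) :
    -- hypotheses are dXVPAs with one-pass preorder typing
    (∀ E : List (Stream σ), IsSample E →
      (learn k l dts sel E).Valid ∧ (learn k l dts sel E).OnePassPreorderTyped) ∧
    -- incremental
    (∀ (E : List (Stream σ)) (w : Stream σ),
      memory s k l dts (E ++ [w]) = incWeightedVPA k l dts (memory s k l dts E) w ∧
      learn k l dts sel (E ++ [w]) =
        genXVPA sel (trim dts (incWeightedVPA k l dts (memory s k l dts E) w))) ∧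
    -- set-driven
    (∀ E E' : List (Stream σ), (∀ w, w ∈ E ↔ w ∈ E') → (∀ w ∈ E, ∃ a, IsDocument a w) →
      learn k l dts sel E = learn k l dts sel E') ∧
    -- consistent
    (∀ E : List (Stream σ), IsSample E → ∀ w ∈ E,
      w ∈ (learn k l dts sel E).docLanguage dts ∧
      w ∈ (learn k l dts sel E).inferredLanguage dts) ∧
    -- conservative
    (∀ (E : List (Stream σ)) (w : Stream σ), IsSample E → IsSample (E ++ [w]) →
      w ∈ (learn k l dts sel E).inferredLanguage dts →
      learn k l dts sel (E ++ [w]) = learn k l dts sel E) ∧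
    -- strong-monotonic
    (∀ (E : List (Stream σ)) (w : Stream σ), IsSample E → IsSample (E ++ [w]) →
      (learn k l dts sel E).docLanguage dts ⊆ (learn k l dts sel (E ++ [w])).docLanguage dts ∧
      (learn k l dts sel E).inferredLanguage dts ⊆
        (learn k l dts sel (E ++ [w])).inferredLanguage dts) ∧
    -- identification in the limit
    IdentifiesInLimit (learn k l dts sel) {D | D.Valid} (fun D => D.docLanguage dts)
      {L : Set (Stream σ) | IsLocalLanguage (LexicallyCovered dts) s k l L} ∧
    IdentifiesInLimit (learn k l dts sel) {D | D.Valid} (fun D => D.inferredLanguage dts)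
      {L : Set (Stream σ) | IsLocalLanguage (DatatypeCovered dts) s k l L} ∧
    -- the identified languages are one-pass preorder typeable
    (∀ L : Set (Stream σ), IsLocalLanguage (LexicallyCovered dts) s k l L →
      ∃ (C S : Type u) (D : DXVPA C S σ T),
        D.Valid ∧ D.OnePassPreorderTyped ∧ D.docLanguage dts = L) ∧
    (∀ L : Set (Stream σ), IsLocalLanguage (DatatypeCovered dts) s k l L →
      ∃ (C S : Type u) (D : DXVPA C S σ T),
        D.Valid ∧ D.OnePassPreorderTyped ∧ D.inferredLanguage dts = L) := by
  refine ⟨?_, ?_, ?_, ?_, ?_, ?_, ?_, ?_, ?_, ?_⟩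
  · intro E hE
    have h := (hE.learn_spec hk hl dts sel).2.1
    exact ⟨h.toValid, h.onePassPreorderTyped⟩
  · intro E w
    exact ⟨memory_append dts E w, by rw [learn, memory_append]⟩
  · intro E E' h hE
    rw [learn_eq dts sel hE, learn_eq dts sel fun w hw => hE w ((h w).2 hw)]
    simp only [h]
  · intro E hE w hw
    have h := (hE.learn_spec hk hl dts sel).2.2
    obtain ⟨a, ha⟩ := hE.2
    have h' := subset_languages_observed (dts := dts) hk hl (L := {w | w ∈ E}) ha
    rw [DXVPA.docLanguage_congr h, DXVPA.inferredLanguage_congr h]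
    exact ⟨h'.1 hw, h'.2 hw⟩
  · intro E w hE hE' hw
    obtain ⟨h1, -, h2⟩ := hE.learn_spec hk hl dts sel
    obtain ⟨a, ha⟩ := hE.2
    rw [DXVPA.inferredLanguage_congr h2] at hw
    rw [(hE'.learn_spec hk hl dts sel).1, h1]
    -- The automata already agree before minimization, and the fold rule is the same.
    congr 1
    refine toXVPA_observed_conservative hk hl ?_ ?_ ha hE.nonempty hw
    · intro v hv
      exact List.mem_append_left _ hv
    · intro v hv
      simpa using hv
  · intro E w hE hE'
    have h1 := (hE.learn_spec hk hl dts sel).2.2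
    have h2 := (hE'.learn_spec hk hl dts sel).2.2
    obtain ⟨a, ha⟩ := hE'.2
    have h := language_observed_mono (dts := dts) hk hl (L := {w | w ∈ E})
      (L' := {v | v ∈ E ++ [w]}) (fun v hv => List.mem_append_left [w] hv) ha hE.nonempty
    rw [← h1, ← h2] at h
    exact ⟨DXVPA.docLanguage_mono h, DXVPA.inferredLanguage_mono h⟩
  · exact identifiesInLimit_of_observed hk hl dts sel
      (fun A A' h => DXVPA.docLanguage_congr h)
      fun L hL => ⟨hL.nonempty, hL.document, hL.finite_names, hL.docLanguage_observed hk hl⟩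
  · exact identifiesInLimit_of_observed hk hl dts sel
      (fun A A' h => DXVPA.inferredLanguage_congr h)
      fun L hL => ⟨hL.nonempty, hL.document, hL.finite_names, hL.inferredLanguage_observed hk hl⟩
  · intro L hL
    obtain ⟨a, ha⟩ := hL.document
    -- The unminimized hypothesis of the whole, possibly infinite, language serves as witness; it is
    -- finite because the names are.
    have h := observed_coherent (dts := dts) hk hl ha hL.nonempty hL.finite_names
    exact ⟨_, _, _, h.toValid, h.onePassPreorderTyped, hL.docLanguage_observed hk hl⟩
  · intro L hL
    obtain ⟨a, ha⟩ := hL.document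
    have h := observed_coherent (dts := dts) hk hl ha hL.nonempty hL.finite_names
    exact ⟨_, _, _, h.toValid, h.onePassPreorderTyped, hL.inferredLanguage_observed hk hl⟩
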